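/- **Conventions.** Let $\mathrm{Pipes}_0=\mathrm{Pro}(\mathrm{FinSet})$ be the category of profinite sets and $\mathrm{Pipes}_{n+1}=\mathrm{Pro}(\mathrm{Ind}(\mathrm{Pipes}_n))$. An *$n$-pipe ring* is a commutative ring object of $\mathrm{Pipes}_n$; $n$-pipe rings are regarded as $(n+1)$-pipe rings through the constant ind- and pro-objects. The *realization* of $X$ is the ring of maps from the terminal object to $X$. Let $k$ be a finite field of characteristic $p$, let $h\ge 1$, let $\Gamma$ be a commutative one-dimensional formal group law over $k$ of height $h$ (the leading term of $[p]_\Gamma(x)$ is in degree $p^h$), and let $h=h_0\ge h_1\ge h_2\ge\cdots\ge 0$ be integers. Let $A$ be a complete Noetherian local ring with residue field $k$ that carries a universal deformation of $\Gamma$, with underlying formal group law $F$. (A deformation to $R$ is a commutative formal group law over $R$ together with an isomorphism from its reduction to $\Gamma$; universal means that each deformation to a complete Noetherian local ring $R$ with residue field $k$ is isomorphic, by an isomorphism compatible with the identifications with $\Gamma$, to the push-forward along exactly one ring map $A\to R$ over $k$.) So $A\cong\pi_0E_h$. A *Lubin–Tate coordinate system* for $F$ consists of $u_0=p$ and $u_1,\dots,u_{h-1}\in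 A$ that identify $A$ with $\mathbb W(k)[[u_1,\dots,u_{h-1}]]$, compatibly with the maps to $k$, and satisfy $$[p]_F(x)\equiv u_t\,x^{p^t}\pmod{(u_0,\dots,u_{t-1},\,x^{1+p^t})}\qquad(0\le t<h).$$ We also put $u_h=1$, or let $u_h$ be any unit of $A$, and write $I_t=(u_0,\dots,u_{t-1})$. Define $X_n=X_n^u$ as follows. For an ideal $J$ of $A$ let $X_0/J$ be the profinite ring given by the pro-system over $m\ge1$ of the finite rings $A/(J+I_h^m)$. Let $X_{n}/J$ be the $n$-pipe ring given by the pro-system over $m\ge 1$ of the ind-systems $$X_{n-1}/(J+I_{h_n}^m)\xrightarrow{\;u_{h_n}\;}X_{n-1}/(J+I_{h_n}^m)\xrightarrow{\;u_{h_n}\;}\cdots .$$ Then $X_n=X_n/(0)$, that is, $X_n=(u_{h_n}^{-1}X_{n-1})^\wedge_{I_{h_n}}$; this is the $n$-pipe ring $\pi_0L_{K(h_n)}\cdots L_{K(h_1)}E_h$ as presented in the coordinates $u$. There are natural maps of pipe rings $s_n:X_n\to X_{n+1}$, and by composition $X_0\to X_n$. **Theorem (independence of Lubin–Tate coordinates).**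 Let $(A,F)$ and $(A',F')$ be universal deformations of $\Gamma$ as above (for instance the same one), with Lubin–Tate coordinate systems $u$ for $F$ and $v$ for $F'$. Let $\varphi:A\to A'$ be the unique ring isomorphism over $k$ along which the first universal deformation pushes forward to one isomorphic to the second (the identity of $A$ if they are the same). There are isomorphisms of $n$-pipe rings $$\varphi_n:X_n^u\xrightarrow{\ \cong\ }X_n^v\qquad(n\ge 0)$$ such that $\varphi_0$ induces $\varphi$ on the elements of $A$ in the realization, and $s_n\circ\varphi_n=\varphi_{n+1}\circ s_n$ for all $n$. They are unique: $\varphi_0$ is the only isomorphism $X_0^u\to X_0^v$ that induces $\varphi$, and for each $n$, $\varphi_n$ is the only isomorphism of $n$-pipe rings $X_n^u\to X_n^v$ that is compatible with $\varphi_0$ and the natural maps $X_0^u\to X_n^u$ and $X_0^v\to X_n^v$. -/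

import Mathlib

universe u
open CategoryTheory

noncomputable section
namespace PipeRings
universe w v
set_option linter.unusedVariables false
set_option linter.unusedSectionVars false
set_option linter.style.haveILetI false

open Limits MonoidalCategory CartesianMonoidalCategory Opposite
open scoped CommRingObj

/-- Pro-objects of `C`, defined as the opposite of the ind-objects of the opposite category. -/
def Pro (C : Type u) [Category.{v} C] : Type (max u (v + 1)) := (Ind Cᵒᵖ)ᵒᵖ

instance (C : Type u) [Category.{v} C] : Category.{v} (Pro C) :=
  inferInstanceAs (Category.{v} (Ind Cᵒᵖ)ᵒᵖ)

/-- The constant pro-objects. -/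
def Pro.const (C : Type u) [Category.{v} C] : C ⥤ Pro C :=
  opOp C ⋙ (Ind.yoneda (C := Cᵒᵖ)).op

/-- The ordered set of natural numbers, as an index category. -/
abbrev Idx : Type v := ULift.{v} ℕ

section inst
variable (C : Type u) [Category.{v} C]

instance [HasFiniteProducts C] : HasFiniteProducts (Ind C) :=
  ⟨fun _ => hasLimitsOfShape_of_equivalence (Discrete.equivalence (Equiv.ulift.{v}))⟩

instance [HasFiniteProducts C] : HasFiniteProducts (Pro C) := by
  have : HasFiniteCoproducts (Ind Cᵒᵖ) :=
    ⟨fun _ => hasColimitsOfShape_of_equivalence (Discrete.equivalence (Equiv.ulift.{v}))⟩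
  exact inferInstanceAs (HasFiniteProducts (Ind Cᵒᵖ)ᵒᵖ)

instance : HasLimitsOfShape (Idx.{v})ᵒᵖ (Pro C) :=
  inferInstanceAs (HasLimitsOfShape (Idx.{v})ᵒᵖ (Ind Cᵒᵖ)ᵒᵖ)

instance : PreservesFiniteProducts (Ind.yoneda (C := C)) := by
  have : PreservesLimits (Ind.yoneda (C := C)) := inferInstance
  have : PreservesFiniteLimits (Ind.yoneda (C := C)) := inferInstance
  infer_instance

instance : PreservesFiniteProducts (Pro.const C) := by
  have : PreservesFiniteLimits (Pro.const C) := by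
    have : PreservesFiniteLimits (Ind.yoneda (C := Cᵒᵖ)).op := preservesFiniteLimits_op _
    exact inferInstanceAs (PreservesFiniteLimits (opOp C ⋙ (Ind.yoneda (C := Cᵒᵖ)).op))
  infer_instance


instance [CartesianMonoidalCategory C] : CartesianMonoidalCategory (Ind C) := .ofHasFiniteProducts

instance [CartesianMonoidalCategory C] : BraidedCategory (Ind C) := .ofCartesianMonoidalCategory

instance [CartesianMonoidalCategory C] : CartesianMonoidalCategory (Pro C) := .ofHasFiniteProducts

instance [CartesianMonoidalCategory C] : BraidedCategory (Pro C) := .ofCartesianMonoidalCategory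

end inst
section ofRep
open scoped MonObj AddMonObj

variable {C : Type u} [Category.{v} C] [CartesianMonoidalCategory C] [BraidedCategory C]

/-- An object whose functor of points is a presheaf of commutative rings is a ring object. -/
@[reducible]
def commRingObjOfRep (X : C) (F : Cᵒᵖ ⥤ CommRingCat.{w}) (α : (F ⋙ forget _).RepresentableBy X) :
    CommRingObj X :=
  letI i1 : AddGrpObj X := AddGrpObj.ofRepresentableBy X
    (F ⋙ forget₂ CommRingCat RingCat ⋙ forget₂ RingCat AddCommGrpCat ⋙
      forget₂ AddCommGrpCat AddGrpCat) α
  letI i2 : MonObj X := MonObj.ofRepresentableBy X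
    (F ⋙ forget₂ CommRingCat CommMonCat ⋙ forget₂ CommMonCat MonCat) α
  have hadd : ∀ {T : C} (a b : T ⟶ X), α.homEquiv' (a + b) = α.homEquiv' a + α.homEquiv' b := by
    intro T a b
    change α.homEquiv' (lift a b ≫ α.homEquiv'.symm (α.homEquiv' (fst X X) +
          α.homEquiv' (snd X X))) = _
    simp only [α.homEquiv'_comp, Equiv.apply_symm_apply, map_add]
    simp only [← α.homEquiv'_comp]
    simp
  have hmul : ∀ {T : C} (a b : T ⟶ X), α.homEquiv' (a * b) = α.homEquiv' a * α.homEquiv' b := by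
    intro T a b
    change α.homEquiv' (lift a b ≫ α.homEquiv'.symm (α.homEquiv' (fst X X) *
          α.homEquiv' (snd X X))) = _
    simp only [α.homEquiv'_comp, Equiv.apply_symm_apply, map_mul]
    simp only [← α.homEquiv'_comp]
    simp
  { i1, i2 with
    add_comm := by
      have h : lift (snd X X) (fst X X) ≫ σ = σ := by
        have : (snd X X) + (fst X X) = fst X X + snd X X :=
          α.homEquiv'.injective (by rw [hadd, hadd, add_comm])
        simpa [Hom.add_def] using this
      rw [show (β_ X X).hom = lift (snd X X) (fst X X) by ext <;> simp]
      exact h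
    mul_comm := by
      have h : lift (snd X X) (fst X X) ≫ μ = μ := by
        have : (snd X X) * (fst X X) = fst X X * snd X X :=
          α.homEquiv'.injective (by rw [hmul, hmul, mul_comm])
        simpa [Hom.mul_def] using this
      rw [show (β_ X X).hom = lift (snd X X) (fst X X) by ext <;> simp]
      exact h
    mul_add := (mul_add_iff X).2 fun T a b c => α.homEquiv'.injective (by
      simp only [hadd, hmul, mul_add])
    add_mul := (add_mul_iff X).2 fun T a b c => α.homEquiv'.injective (by
      simp only [hadd, hmul, add_mul]) }

variable {D : Type w} [Category.{v} D] [CartesianMonoidalCategory D] [BraidedCategory D]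

lemma commRingObjOfRep_add (X : C) (F : Cᵒᵖ ⥤ CommRingCat.{w})
    (α : (F ⋙ forget _).RepresentableBy X) {T : C} (a b : T ⟶ X) :
    letI := commRingObjOfRep X F α
    α.homEquiv' (a + b) = α.homEquiv' a + α.homEquiv' b := by
  change α.homEquiv' (lift a b ≫ α.homEquiv'.symm (α.homEquiv' (fst X X) +
        α.homEquiv' (snd X X))) = _
  simp only [α.homEquiv'_comp, Equiv.apply_symm_apply, map_add]
  simp only [← α.homEquiv'_comp]
  simp

lemma commRingObjOfRep_mul (X : C) (F : Cᵒᵖ ⥤ CommRingCat.{w})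
    (α : (F ⋙ forget _).RepresentableBy X) {T : C} (a b : T ⟶ X) :
    letI := commRingObjOfRep X F α
    α.homEquiv' (a * b) = α.homEquiv' a * α.homEquiv' b := by
  change α.homEquiv' (lift a b ≫ α.homEquiv'.symm (α.homEquiv' (fst X X) *
        α.homEquiv' (snd X X))) = _
  simp only [α.homEquiv'_comp, Equiv.apply_symm_apply, map_mul]
  simp only [← α.homEquiv'_comp]
  simp

lemma commRingObjOfRep_one (X : C) (F : Cᵒᵖ ⥤ CommRingCat.{w})
    (α : (F ⋙ forget _).RepresentableBy X) (T : C) :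
    letI := commRingObjOfRep X F α
    α.homEquiv' (1 : T ⟶ X) = 1 := by
  change α.homEquiv' (toUnit T ≫ α.homEquiv'.symm 1) = _
  simp [α.homEquiv'_comp]

lemma isRingHom_of_points {X Y : C} [CommRingObj X] [CommRingObj Y] (f : X ⟶ Y)
    (h1 : ∀ T : C, (1 : T ⟶ X) ≫ f = 1)
    (hadd : ∀ (T : C) (a b : T ⟶ X), (a + b) ≫ f = a ≫ f + b ≫ f)
    (hmul : ∀ (T : C) (a b : T ⟶ X), (a * b) ≫ f = a ≫ f * b ≫ f) : IsRingHom f where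
  zero_hom := by
    have := hadd (𝟙_ C) 0 0
    rw [add_zero, left_eq_add] at this
    simpa [AddMonObj.zero_eq_zero] using this
  add_hom := by
    have := hadd _ (fst X X) (snd X X)
    simp only [Hom.add_def, lift_fst_snd, Category.id_comp] at this
    rw [this]
    congr 1
    ext <;> simp
  one_hom := by
    simpa [MonObj.one_eq_one] using h1 (𝟙_ C)
  mul_hom := by
    have := hmul _ (fst X X) (snd X X)
    simp only [Hom.mul_def, lift_fst_snd, Category.id_comp] at this
    rw [this]
    congr 1
    ext <;> simp

lemma exists_common_point (G : C ⥤ D) [G.Monoidal] {T : D} {M N : C} (a : T ⟶ G.obj M)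
    (b : T ⟶ G.obj N) : ∃ t : T ⟶ G.obj (M ⊗ N), t ≫ G.map (fst M N) = a ∧
      t ≫ G.map (snd M N) = b :=
  ⟨lift a b ≫ Functor.LaxMonoidal.μ G M N, by simp, by simp⟩

open scoped Obj in
/-- Functors that preserve finite products carry ring objects to ring objects. -/
@[reducible]
def mapCommRingObj (G : C ⥤ D) [PreservesFiniteProducts G] (R : C) [CommRingObj R] :
    CommRingObj (G.obj R) :=
  letI : G.Braided := .ofChosenFiniteProducts G
  { (inferInstance : AddGrpObj (G.obj R)), (inferInstance : MonObj (G.obj R)),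
    (inferInstance : IsCommMonObj (G.obj R)) with
    add_comm := by
      obtain h : fst (G.obj R) (G.obj R) + snd _ _ = snd _ _ + fst _ _ := by
        obtain ⟨t, h1, h2⟩ := exists_common_point G (fst (G.obj R) (G.obj R)) (snd _ _)
        rw [← h1, ← h2, ← AddMonObj.comp_add, ← AddMonObj.comp_add, ← G.map_add', ← G.map_add',
          add_comm]
      rw [show (β_ (G.obj R) (G.obj R)).hom = lift (snd _ _) (fst _ _) by ext <;> simp]
      simpa [Hom.add_def] using h.symm
    mul_add := by
      refine (mul_add_iff _).2 fun T a b c => ?_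
      obtain ⟨s, hb, hc⟩ := exists_common_point G b c
      obtain ⟨t, ha, hs⟩ := exists_common_point G a s
      rw [← hs, Category.assoc, ← G.map_comp] at hb hc
      rw [← ha, ← hb, ← hc, ← AddMonObj.comp_add, ← MonObj.comp_mul, ← MonObj.comp_mul,
        ← MonObj.comp_mul, ← AddMonObj.comp_add, ← G.map_add', ← G.map_mul, ← G.map_mul,
        ← G.map_mul, ← G.map_add', mul_add]
    add_mul := by
      refine (add_mul_iff _).2 fun T a b c => ?_
      obtain ⟨s, hb, hc⟩ := exists_common_point G b c
      obtain ⟨t, ha, hs⟩ := exists_common_point G a s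
      rw [← hs, Category.assoc, ← G.map_comp] at hb hc
      rw [← ha, ← hb, ← hc, ← AddMonObj.comp_add, ← MonObj.comp_mul, ← MonObj.comp_mul,
        ← MonObj.comp_mul, ← AddMonObj.comp_add, ← G.map_add', ← G.map_mul, ← G.map_mul,
        ← G.map_mul, ← G.map_add', add_mul] }

/-- The functor on ring objects induced by a functor that preserves finite products. -/
def mapRing (G : C ⥤ D) [PreservesFiniteProducts G] : CommRingObjCat C ⥤ CommRingObjCat D where
  obj R := letI := mapCommRingObj G R.X; ⟨G.obj R.X⟩
  map {R S} f :=
    letI : G.Braided := .ofChosenFiniteProducts G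
    letI := mapCommRingObj G R.X
    letI := mapCommRingObj G S.X
    { hom := G.map f.hom
      isRingHom :=
        { toIsAddMonHom := inferInstanceAs (IsAddMonHom (G.map f.hom))
          toIsMonHom := inferInstanceAs (IsMonHom (G.map f.hom)) } }

end ofRep

section natRing
variable {C : Type u} [Category.{v} C]

/-- Natural transformations from a presheaf of sets to a presheaf of commutative rings form a
commutative ring under the pointwise operations. -/
instance natCommRing (H : Cᵒᵖ ⥤ Type v) (G : Cᵒᵖ ⥤ CommRingCat.{v}) :
    CommRing (H ⟶ G ⋙ forget CommRingCat) :=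
  letI : Zero (H ⟶ G ⋙ forget CommRingCat) := ⟨{ app T := ↾fun _ => (0 : G.obj T) }⟩
  letI : One (H ⟶ G ⋙ forget CommRingCat) := ⟨{ app T := ↾fun _ => (1 : G.obj T) }⟩
  letI : Add (H ⟶ G ⋙ forget CommRingCat) :=
    ⟨fun a b => { app T := ↾fun x => (a.app T x + b.app T x : G.obj T) }⟩
  letI : Mul (H ⟶ G ⋙ forget CommRingCat) :=
    ⟨fun a b => { app T := ↾fun x => (a.app T x * b.app T x : G.obj T) }⟩
  letI : Neg (H ⟶ G ⋙ forget CommRingCat) :=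
    ⟨fun a => { app T := ↾fun x => (- a.app T x : G.obj T) }⟩
  { add_assoc a b c := by ext T x; exact add_assoc (G := G.obj T) _ _ _
    zero_add a := by ext T x; exact zero_add (M := G.obj T) _
    add_zero a := by ext T x; exact add_zero (M := G.obj T) _
    add_comm a b := by ext T x; exact add_comm (G := G.obj T) _ _
    neg_add_cancel a := by ext T x; exact neg_add_cancel (G := G.obj T) _
    mul_assoc a b c := by ext T x; exact mul_assoc (G := G.obj T) _ _ _
    mul_comm a b := by ext T x; exact mul_comm (G := G.obj T) _ _
    one_mul a := by ext T x; exact one_mul (M := G.obj T) _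
    mul_one a := by ext T x; exact mul_one (M := G.obj T) _
    zero_mul a := by ext T x; exact zero_mul (M₀ := G.obj T) _
    mul_zero a := by ext T x; exact mul_zero (M₀ := G.obj T) _
    left_distrib a b c := by ext T x; exact mul_add (R := G.obj T) _ _ _
    right_distrib a b c := by ext T x; exact add_mul (R := G.obj T) _ _ _
    nsmul := nsmulRec
    zsmul := zsmulRec }

@[simp] lemma nat_add_app {H : Cᵒᵖ ⥤ Type v} {G : Cᵒᵖ ⥤ CommRingCat.{v}}
    (a b : H ⟶ G ⋙ forget CommRingCat) (T : Cᵒᵖ) (x : H.obj T) :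
    (a + b).app T x = (a.app T x + b.app T x : G.obj T) := rfl

@[simp] lemma nat_mul_app {H : Cᵒᵖ ⥤ Type v} {G : Cᵒᵖ ⥤ CommRingCat.{v}}
    (a b : H ⟶ G ⋙ forget CommRingCat) (T : Cᵒᵖ) (x : H.obj T) :
    (a * b).app T x = (a.app T x * b.app T x : G.obj T) := rfl

@[simp] lemma nat_one_app {H : Cᵒᵖ ⥤ Type v} {G : Cᵒᵖ ⥤ CommRingCat.{v}}
    (T : Cᵒᵖ) (x : H.obj T) :
    (1 : H ⟶ G ⋙ forget CommRingCat).app T x = (1 : G.obj T) := rfl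

@[simp] lemma nat_zero_app {H : Cᵒᵖ ⥤ Type v} {G : Cᵒᵖ ⥤ CommRingCat.{v}}
    (T : Cᵒᵖ) (x : H.obj T) :
    (0 : H ⟶ G ⋙ forget CommRingCat).app T x = (0 : G.obj T) := rfl

end natRing

section loc
variable {C : Type u} [Category.{v} C] [CartesianMonoidalCategory C] [BraidedCategory C]

/-- The constant `T`-valued point given by an element of the realization. -/
abbrev constPt {X : C} (x : 𝟙_ C ⟶ X) (T : C) : T ⟶ X := toUnit T ≫ x

/-- The ind-system `R → R → R → ⋯` whose transition maps are multiplication by `x`. -/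
def mulTower (R : CommRingObjCat C) (x : 𝟙_ C ⟶ R.X) : Idx.{v} ⥤ C where
  obj _ := R.X
  map {i j} _ := constPt x R.X ^ (j.down - i.down) * 𝟙 R.X
  map_id i := by simp
  map_comp {i j k} f g := by
    have hij : i.down ≤ j.down := f.down.down
    have hjk : j.down ≤ k.down := g.down.down
    rw [MonObj.comp_mul, MonObj.comp_pow, Category.comp_id, ← mul_assoc, ← Category.assoc, toUnit_unique (_ ≫ toUnit _) (toUnit _), ← pow_add]
    congr 2; omega

lemma comp_mulTower_map (R : CommRingObjCat C) (x : 𝟙_ C ⟶ R.X) {i j : Idx.{v}} (f : i ⟶ j) {T : C}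
   (a : T ⟶ R.X) : a ≫ (mulTower R x).map f = constPt x T ^ (j.down - i.down) * a := by
    simp only [mulTower]
    rw [MonObj.comp_mul, MonObj.comp_pow, Category.comp_id, ← Category.assoc, toUnit_unique (_ ≫ toUnit _) (toUnit _)]

/-- The underlying object of `x⁻¹R`: the formal colimit of the multiplication tower. -/
def locObj (R : CommRingObjCat C) (x : 𝟙_ C ⟶ R.X) : Ind C := (Ind.lim Idx.{v}).obj (mulTower R x)

/-- Precomposition as a ring homomorphism. -/
def precomp (R : CommRingObjCat C) {S T : C} (f : S ⟶ T) : (T ⟶ R.X) →+* (S ⟶ R.X) :=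
  ((yonedaCommRing.obj R).map f.op).hom

@[simp] lemma precomp_apply (R : CommRingObjCat C) {S T : C} (f : S ⟶ T) (a : T ⟶ R.X) :
    precomp R f a = f ≫ a := rfl

/-- Postcomposition with a map of ring objects as a ring homomorphism. -/
def postcomp {R S : CommRingObjCat C} (f : R ⟶ S) (T : C) : (T ⟶ R.X) →+* (T ⟶ S.X) :=
  ((yonedaCommRing.map f).app (op T)).hom

@[simp] lemma postcomp_apply {R S : CommRingObjCat C} (f : R ⟶ S) {T : C} (a : T ⟶ R.X) :
    postcomp f T a = a ≫ f.hom := rfl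

/-- The effect on points of a functor that preserves finite products. -/
def mapPt {D : Type w} [Category.{v} D] [CartesianMonoidalCategory D] [BraidedCategory D]
    (G : C ⥤ D) [PreservesFiniteProducts G] (R : CommRingObjCat C) (T : C) :
    (T ⟶ R.X) →+* (G.obj T ⟶ ((mapRing G).obj R).X) :=
  letI : G.Braided := .ofChosenFiniteProducts G
  { toFun a := G.map a
    map_one' := G.map_one
    map_mul' := G.map_mul
    map_zero' := G.map_zero'
    map_add' := G.map_add' }

lemma precomp_constPt (R : CommRingObjCat C) (x : 𝟙_ C ⟶ R.X) {S T : C} (f : S ⟶ T) :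
    precomp R f (constPt x T) = constPt x S := by
  simp [constPt]

/-- The map `R(T)[1/x] → R(S)[1/x]` induced by `S ⟶ T`. -/
def locRestrict (R : CommRingObjCat C) (x : 𝟙_ C ⟶ R.X) {S T : C} (f : S ⟶ T) :
    Localization.Away (constPt x T) →+* Localization.Away (constPt x S) :=
  IsLocalization.map (M := Submonoid.powers (constPt x T)) (T := Submonoid.powers (constPt x S))
    (Localization.Away (constPt x S)) (precomp R f) (by
      rw [Submonoid.powers_le]
      exact ⟨1, by simp⟩)

/-- The presheaf of rings `T ↦ R(T)[1/x]`. -/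
def locPresheaf (R : CommRingObjCat C) (x : 𝟙_ C ⟶ R.X) : Cᵒᵖ ⥤ CommRingCat.{v} where
  obj T := CommRingCat.of (Localization.Away (constPt x T.unop))
  map f := CommRingCat.ofHom (locRestrict R x f.unop)
  map_id T := by
    ext1
    refine IsLocalization.ringHom_ext (Submonoid.powers (constPt x T.unop)) (RingHom.ext fun a => ?_)
    simp [locRestrict]
  map_comp {S _ _} f g := by
    ext1
    refine IsLocalization.ringHom_ext (Submonoid.powers (constPt x S.unop)) (RingHom.ext fun a => ?_)
    simp [locRestrict]

/-- The fraction `a / x ^ j`. -/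
def locMk (R : CommRingObjCat C) (x : 𝟙_ C ⟶ R.X) (T : C) (j : ℕ) (a : T ⟶ R.X) :
    Localization.Away (constPt x T) :=
  IsLocalization.mk' (M := Submonoid.powers (constPt x T)) _ a ⟨constPt x T ^ j, j, rfl⟩

lemma locRestrict_locMk (R : CommRingObjCat C) (x : 𝟙_ C ⟶ R.X) {S T : C} (f : S ⟶ T) (j : ℕ)
    (a : T ⟶ R.X) : locRestrict R x f (locMk R x T j a) = locMk R x S j (f ≫ a) := by
  unfold locMk locRestrict
  rw [IsLocalization.map_mk']
  congr 2
  rw [map_pow, precomp_constPt]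

lemma locMk_eq_iff (R : CommRingObjCat C) (x : 𝟙_ C ⟶ R.X) {T : C} (i j : ℕ) (a b : T ⟶ R.X) :
    locMk R x T i a = locMk R x T j b ↔
      ∃ n : ℕ, constPt x T ^ (n + j) * a = constPt x T ^ (n + i) * b := by
  unfold locMk
  rw [IsLocalization.mk'_eq_iff_eq, IsLocalization.eq_iff_exists (Submonoid.powers (constPt x T))]
  constructor
  · rintro ⟨⟨_, n, rfl⟩, h⟩
    exact ⟨n, by simpa [pow_add, mul_assoc] using h⟩
  · rintro ⟨n, h⟩
    exact ⟨⟨_, n, rfl⟩, by simpa [pow_add, mul_assoc] using h⟩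

lemma locMk_surjective (R : CommRingObjCat C) (x : 𝟙_ C ⟶ R.X) (T : C)
    (z : Localization.Away (constPt x T)) : ∃ j a, z = locMk R x T j a := by
  obtain ⟨a, ⟨_, j, rfl⟩, h⟩ := IsLocalization.exists_mk'_eq (Submonoid.powers (constPt x T)) z
  exact ⟨j, a, h.symm⟩

lemma locMk_pow_mul (R : CommRingObjCat C) (x : 𝟙_ C ⟶ R.X) {T : C} {i j : ℕ} (h : i ≤ j)
    (a : T ⟶ R.X) : locMk R x T j (constPt x T ^ (j - i) * a) = locMk R x T i a := by
  refine (locMk_eq_iff R x _ _ _ _).2 ⟨0, ?_⟩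
  rw [← mul_assoc, ← pow_add]
  congr 2
  omega

/-- The natural map `a ↦ a / x ^ j` from `R(T)` to `R(T)[1/x]`. -/
def locNat (R : CommRingObjCat C) (x : 𝟙_ C ⟶ R.X) (j : ℕ) :
    yoneda.obj R.X ⟶ locPresheaf R x ⋙ forget CommRingCat where
  app T := ↾fun a => locMk R x T.unop j a
  naturality S T f := by
    ext a
    exact (locRestrict_locMk R x f.unop j a).symm

/-- The tower of multiplications by `x` maps to the localizations: the `j`-th term by
`a ↦ a / x ^ j`. -/
def locCocone (R : CommRingObjCat C) (x : 𝟙_ C ⟶ R.X) : Cocone (mulTower R x ⋙ yoneda) where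
  pt := locPresheaf R x ⋙ forget CommRingCat
  ι :=
    { app j := locNat R x j.down
      naturality i j f := by
        ext T a
        have hij : i.down ≤ j.down := f.down.down
        exact (congrArg (locMk R x T.unop j.down) (comp_mulTower_map R x f (T := T.unop) a)).trans
          (locMk_pow_mul R x hij a) }

/-- `T ↦ R(T)[1/x]` is the colimit of the tower of multiplications by `x`. -/
def locCoconeIsColimit (R : CommRingObjCat C) (x : 𝟙_ C ⟶ R.X) : IsColimit (locCocone R x) :=
  evaluationJointlyReflectsColimits _ fun T =>
    Types.FilteredColimit.isColimitOf _ _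
      (fun z => by
        obtain ⟨j, a, h⟩ := locMk_surjective R x T.unop z
        exact ⟨⟨j⟩, a, h⟩)
      (fun i j a b h => by
        obtain ⟨n, hn⟩ := (locMk_eq_iff R x i.down j.down a b).1 h
        refine ⟨⟨n + i.down + j.down⟩, homOfLE (by change i.down ≤ n + i.down + j.down; omega),
          homOfLE (by change j.down ≤ n + i.down + j.down; omega), ?_⟩
        refine (comp_mulTower_map R x _ (T := T.unop) a).trans
          (Eq.trans ?_ (comp_mulTower_map R x _ (T := T.unop) b).symm)
        have h1 : n + i.down + j.down - i.down = n + j.down := by omega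
        have h2 : n + i.down + j.down - j.down = n + i.down := by omega
        dsimp only
        rw [h1, h2]
        exact hn)

/-- The `j`-th structure map `R ⟶ x⁻¹R` of the formal colimit. -/
def locι (R : CommRingObjCat C) (x : 𝟙_ C ⟶ R.X) (j : ℕ) : Ind.yoneda.obj R.X ⟶ locObj R x :=
  colimit.ι (mulTower R x ⋙ Ind.yoneda) ⟨j⟩

/-- The functor of points of `x⁻¹R` on `C` is `T ↦ R(T)[1/x]`. -/
def locIso (R : CommRingObjCat C) (x : 𝟙_ C ⟶ R.X) :
    (Ind.inclusion C).obj (locObj R x) ≅ locPresheaf R x ⋙ forget CommRingCat :=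
  (isColimitOfPreserves (Ind.inclusion C)
    (colimit.isColimit (mulTower R x ⋙ Ind.yoneda))).coconePointUniqueUpToIso
    ((IsColimit.precomposeHomEquiv (Functor.isoWhiskerLeft (mulTower R x) Ind.yonedaCompInclusion)
      (locCocone R x)).symm (locCoconeIsColimit R x))

lemma locι_locIso (R : CommRingObjCat C) (x : 𝟙_ C ⟶ R.X) (j : ℕ) :
    (Ind.inclusion C).map (locι R x j) ≫ (locIso R x).hom =
      Ind.yonedaCompInclusion.hom.app R.X ≫ locNat R x j :=
  IsColimit.comp_coconePointUniqueUpToIso_hom (isColimitOfPreserves (Ind.inclusion C)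
    (colimit.isColimit (mulTower R x ⋙ Ind.yoneda))) _ ⟨j⟩

/-- The `P`-valued points of `x⁻¹R`, for an ind-object `P`, as a commutative ring. -/
def locPoints (R : CommRingObjCat C) (x : 𝟙_ C ⟶ R.X) : (Ind C)ᵒᵖ ⥤ CommRingCat.{max u v} where
  obj P := CommRingCat.of ((Ind.inclusion C).obj P.unop ⟶ locPresheaf R x ⋙ forget CommRingCat)
  map f := CommRingCat.ofHom
    { toFun a := (Ind.inclusion C).map f.unop ≫ a
      map_one' := rfl
      map_mul' _ _ := rfl
      map_zero' := rfl
      map_add' _ _ := rfl }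
  map_id P := by ext a; simp
  map_comp f g := by
    ext1
    refine RingHom.ext fun a => ?_
    change (Ind.inclusion C).map (g.unop ≫ f.unop) ≫ a = _
    rw [Functor.map_comp, Category.assoc]
    rfl

def locRep (R : CommRingObjCat C) (x : 𝟙_ C ⟶ R.X) :
    (locPoints R x ⋙ forget _).RepresentableBy (locObj R x) where
  homEquiv := Ind.inclusion.fullyFaithful.homEquiv.trans (locIso R x).homToEquiv
  homEquiv_comp f g := by
    change (Ind.inclusion C).map (f ≫ g) ≫ _ = (Ind.inclusion C).map f ≫ _ ≫ _
    rw [Functor.map_comp, Category.assoc]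
    rfl

/-- `x⁻¹R` is a ring object in ind-objects. -/
def locRing (R : CommRingObjCat C) (x : 𝟙_ C ⟶ R.X) : CommRingObjCat (Ind C) :=
  letI := commRingObjOfRep (locObj R x) (locPoints R x) (locRep R x)
  ⟨locObj R x⟩

lemma ind_hom_ext {X Y : Ind C} {f g : X ⟶ Y}
    (h : ∀ (c : C) (t : Ind.yoneda.obj c ⟶ X), t ≫ f = t ≫ g) : f = g := by
  apply (Ind.inclusion C).map_injective
  have key : ∀ (c : C) (z : yoneda.obj c ⟶ (Ind.inclusion C).obj X),
      z ≫ (Ind.inclusion C).map f = z ≫ (Ind.inclusion C).map g := by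
    intro c z
    have h1 := congrArg ((Ind.inclusion C).map ·) (h c (Ind.inclusion.fullyFaithful.preimage
      (Ind.yonedaCompInclusion.hom.app c ≫ z)))
    simp only [Functor.map_comp, Functor.FullyFaithful.map_preimage, Category.assoc] at h1
    exact (cancel_epi (Ind.yonedaCompInclusion.hom.app c)).1 h1
  ext c z
  have h2 := congrArg (fun q => (q.app c) (𝟙 c.unop)) (key c.unop (yonedaEquiv.symm z))
  simpa [yonedaEquiv] using h2

/-- The `c`-valued points of `x⁻¹R`, for `c` in `C`, are the elements of `R(c)[1/x]`. -/
def locPt (R : CommRingObjCat C) (x : 𝟙_ C ⟶ R.X) {c : C} (z : Ind.yoneda.obj c ⟶ locObj R x) :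
    Localization.Away (constPt x c) :=
  yonedaEquiv (Ind.yonedaCompInclusion.inv.app c ≫ (Ind.inclusion C).map z ≫ (locIso R x).hom)

lemma locPt_injective (R : CommRingObjCat C) (x : 𝟙_ C ⟶ R.X) {c : C} :
    Function.Injective (locPt R x (c := c)) := by
  intro z w h
  have h1 := yonedaEquiv.injective h
  rw [cancel_epi, cancel_mono] at h1
  exact (Ind.inclusion C).map_injective h1

lemma locPt_ι (R : CommRingObjCat C) (x : 𝟙_ C ⟶ R.X) {c : C} (a : c ⟶ R.X) (j : ℕ) :
    locPt R x (Ind.yoneda.map a ≫ locι R x j) = locMk R x c j a := by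
  have h : Ind.yonedaCompInclusion.inv.app c ≫
      (Ind.inclusion C).map (Ind.yoneda.map a ≫ locι R x j) ≫ (locIso R x).hom =
      yoneda.map a ≫ locNat R x j := by
    have h2 := Ind.yonedaCompInclusion.hom.naturality a
    rw [Functor.comp_map] at h2
    rw [Functor.map_comp, Category.assoc, locι_locIso, reassoc_of% h2, Iso.inv_hom_id_app_assoc]
  unfold locPt
  rw [h]
  change locMk R x c j (𝟙 c ≫ a) = _
  rw [Category.id_comp]

lemma exists_eq_locι (R : CommRingObjCat C) (x : 𝟙_ C ⟶ R.X) {c : C}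
    (z : Ind.yoneda.obj c ⟶ locObj R x) : ∃ j a, z = Ind.yoneda.map a ≫ locι R x j := by
  obtain ⟨j, a, h⟩ := locMk_surjective R x c (locPt R x z)
  exact ⟨j, a, locPt_injective R x (h.trans (locPt_ι R x a j).symm)⟩

lemma locPt_add (R : CommRingObjCat C) (x : 𝟙_ C ⟶ R.X) {c : C}
    (z w : Ind.yoneda.obj c ⟶ (locRing R x).X) :
    locPt R x (z + w) = locPt R x z + locPt R x w := by
  have h := commRingObjOfRep_add (locObj R x) (locPoints R x) (locRep R x) z w
  exact congrArg (fun q => (q.app (op c)) ((Ind.yonedaCompInclusion.inv.app c).app (op c) (𝟙 c))) h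

lemma locPt_mul (R : CommRingObjCat C) (x : 𝟙_ C ⟶ R.X) {c : C}
    (z w : Ind.yoneda.obj c ⟶ (locRing R x).X) :
    locPt R x (z * w) = locPt R x z * locPt R x w := by
  have h := commRingObjOfRep_mul (locObj R x) (locPoints R x) (locRep R x) z w
  exact congrArg (fun q => (q.app (op c)) ((Ind.yonedaCompInclusion.inv.app c).app (op c) (𝟙 c))) h

lemma locPt_one (R : CommRingObjCat C) (x : 𝟙_ C ⟶ R.X) (c : C) :
    locPt R x (1 : Ind.yoneda.obj c ⟶ (locRing R x).X) = 1 := by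
  have h := commRingObjOfRep_one (locObj R x) (locPoints R x) (locRep R x) (Ind.yoneda.obj c)
  exact congrArg (fun q => (q.app (op c)) ((Ind.yonedaCompInclusion.inv.app c).app (op c) (𝟙 c))) h

/-- A map out of an ind-ring object is a ring map as soon as it is one on points valued in
objects of `C`. -/
lemma isRingHom_ind {X Y : Ind C} [CommRingObj X] [CommRingObj Y] (f : X ⟶ Y)
    (h1 : ∀ c : C, (1 : Ind.yoneda.obj c ⟶ X) ≫ f = 1)
    (hadd : ∀ (c : C) (a b : Ind.yoneda.obj c ⟶ X), (a + b) ≫ f = a ≫ f + b ≫ f)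
    (hmul : ∀ (c : C) (a b : Ind.yoneda.obj c ⟶ X), (a * b) ≫ f = a ≫ f * b ≫ f) :
    IsRingHom f :=
  isRingHom_of_points f
    (fun T => ind_hom_ext fun c t => by
      rw [← Category.assoc, MonObj.comp_one, h1, MonObj.comp_one])
    (fun T a b => ind_hom_ext fun c t => by
      rw [← Category.assoc, AddMonObj.comp_add, hadd, AddMonObj.comp_add, Category.assoc,
        Category.assoc])
    (fun T a b => ind_hom_ext fun c t => by
      rw [← Category.assoc, MonObj.comp_mul, hmul, MonObj.comp_mul, Category.assoc,
        Category.assoc])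

lemma locMk_zero (R : CommRingObjCat C) (x : 𝟙_ C ⟶ R.X) {c : C} (a : c ⟶ R.X) :
    locMk R x c 0 a = algebraMap _ _ a := by
  unfold locMk
  rw [IsLocalization.mk'_eq_iff_eq_mul]
  simp

lemma locPt_mapPt (R : CommRingObjCat C) (x : 𝟙_ C ⟶ R.X) {c : C} (a : c ⟶ R.X) :
    locPt R x (mapPt Ind.yoneda R c a ≫ locι R x 0) = algebraMap _ _ a :=
  (locPt_ι R x a 0).trans (locMk_zero R x a)

lemma mapPt_yoneda_surjective (R : CommRingObjCat C) {c : C} :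
    Function.Surjective (mapPt Ind.yoneda R c) := fun a => Ind.yoneda.map_surjective a

/-- The localization map `R ⟶ x⁻¹R`, a map of ring objects in ind-objects. -/
def toLoc (R : CommRingObjCat C) (x : 𝟙_ C ⟶ R.X) :
    (mapRing Ind.yoneda).obj R ⟶ locRing R x where
  hom := locι R x 0
  isRingHom := isRingHom_ind _
    (fun c => locPt_injective R x (by
      rw [← map_one (mapPt Ind.yoneda R c)]
      exact (locPt_mapPt R x _).trans ((map_one _).trans (locPt_one R x c).symm)))
    (fun c a b => locPt_injective R x (by
      obtain ⟨a, rfl⟩ := mapPt_yoneda_surjective R a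
      obtain ⟨b, rfl⟩ := mapPt_yoneda_surjective R b
      rw [← map_add, locPt_add]
      refine (locPt_mapPt R x _).trans ((map_add _ _ _).trans ?_)
      exact congrArg₂ _ (locPt_mapPt R x _).symm (locPt_mapPt R x _).symm))
    (fun c a b => locPt_injective R x (by
      obtain ⟨a, rfl⟩ := mapPt_yoneda_surjective R a
      obtain ⟨b, rfl⟩ := mapPt_yoneda_surjective R b
      rw [← map_mul, locPt_mul]
      refine (locPt_mapPt R x _).trans ((map_mul _ _ _).trans ?_)
      exact congrArg₂ _ (locPt_mapPt R x _).symm (locPt_mapPt R x _).symm))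

/-- Functoriality of the multiplication tower. -/
def mulTowerMap {R S : CommRingObjCat C} (f : R ⟶ S) {x : 𝟙_ C ⟶ R.X} {y : 𝟙_ C ⟶ S.X}
    (h : x ≫ f.hom = y) : mulTower R x ⟶ mulTower S y where
  app _ := f.hom
  naturality i j g := by
    subst h
    change (mulTower R x).map g ≫ f.hom = f.hom ≫ (mulTower S (x ≫ f.hom)).map g
    refine Eq.trans ?_ (comp_mulTower_map S (x ≫ f.hom) g f.hom).symm
    simp only [mulTower]
    rw [MonObj.mul_comp, MonObj.pow_comp, Category.id_comp, Category.assoc]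

/-- The map `R(c)[1/x] → S(c)[1/f(x)]`. -/
def locPtMap {R S : CommRingObjCat C} (f : R ⟶ S) {x : 𝟙_ C ⟶ R.X} {y : 𝟙_ C ⟶ S.X}
    (h : x ≫ f.hom = y) (c : C) :
    Localization.Away (constPt x c) →+* Localization.Away (constPt y c) :=
  IsLocalization.map (M := Submonoid.powers (constPt x c))
    (T := Submonoid.powers (constPt y c))
    (Localization.Away (constPt y c)) (postcomp f c) (by
      subst h
      rw [Submonoid.powers_le]
      exact ⟨1, by simp⟩)

lemma locPtMap_locMk {R S : CommRingObjCat C} (f : R ⟶ S) {x : 𝟙_ C ⟶ R.X} {y : 𝟙_ C ⟶ S.X}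
    (h : x ≫ f.hom = y) (c : C) (j : ℕ) (a : c ⟶ R.X) :
    locPtMap f h c (locMk R x c j a) = locMk S y c j (a ≫ f.hom) := by
  subst h
  unfold locMk locPtMap
  rw [IsLocalization.map_mk']
  congr 2
  rw [map_pow]
  simp

/-- The map `x⁻¹R ⟶ f(x)⁻¹S` of underlying ind-objects. -/
def locObjMap {R S : CommRingObjCat C} (f : R ⟶ S) {x : 𝟙_ C ⟶ R.X} {y : 𝟙_ C ⟶ S.X}
    (h : x ≫ f.hom = y) : locObj R x ⟶ locObj S y :=
  (Ind.lim Idx.{v}).map (mulTowerMap f h)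

lemma locι_map {R S : CommRingObjCat C} (f : R ⟶ S) {x : 𝟙_ C ⟶ R.X} {y : 𝟙_ C ⟶ S.X}
    (h : x ≫ f.hom = y) (j : ℕ) :
    locι R x j ≫ locObjMap f h = Ind.yoneda.map f.hom ≫ locι S y j :=
  ι_colimMap (Functor.whiskerRight (mulTowerMap f h) Ind.yoneda) _

lemma locPt_map {R S : CommRingObjCat C} (f : R ⟶ S) {x : 𝟙_ C ⟶ R.X} {y : 𝟙_ C ⟶ S.X}
    (h : x ≫ f.hom = y) {c : C} (z : Ind.yoneda.obj c ⟶ locObj R x) :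
    locPt S y (z ≫ locObjMap f h) = locPtMap f h c (locPt R x z) := by
  obtain ⟨j, a, rfl⟩ := exists_eq_locι R x z
  rw [Category.assoc, locι_map, ← Category.assoc, ← Functor.map_comp, locPt_ι, locPt_ι,
    locPtMap_locMk]

/-- Functoriality of localization. -/
def locMap {R S : CommRingObjCat C} (f : R ⟶ S) {x : 𝟙_ C ⟶ R.X} {y : 𝟙_ C ⟶ S.X}
    (h : x ≫ f.hom = y) : locRing R x ⟶ locRing S y where
  hom := locObjMap f h
  isRingHom := isRingHom_ind _
    (fun c => locPt_injective S _ (by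
      refine (locPt_map f h _).trans ?_
      rw [locPt_one, locPt_one, map_one]))
    (fun c a b => locPt_injective S _ (by
      refine (locPt_map f h _).trans ?_
      rw [locPt_add, locPt_add, map_add]
      exact congrArg₂ _ (locPt_map f h _).symm (locPt_map f h _).symm))
    (fun c a b => locPt_injective S _ (by
      refine (locPt_map f h _).trans ?_
      rw [locPt_mul, locPt_mul, map_mul]
      exact congrArg₂ _ (locPt_map f h _).symm (locPt_map f h _).symm))

end loc


section lim
variable {E : Type u} [Category.{v} E] [CartesianMonoidalCategory E] [BraidedCategory E]
variable {K : Type v} [SmallCategory K] [HasLimitsOfShape K E]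

/-- The ring of compatible families of `T`-valued points of a diagram of ring objects. -/
def limSubring (Q : K ⥤ CommRingObjCat E) (T : E) : Subring (∀ k, T ⟶ (Q.obj k).X) where
  carrier := {s | ∀ ⦃k l⦄ (f : k ⟶ l), s k ≫ (Q.map f).hom = s l}
  one_mem' k l f := map_one (postcomp (Q.map f) T)
  zero_mem' k l f := map_zero (postcomp (Q.map f) T)
  mul_mem' {a b} ha hb k l f := (map_mul (postcomp (Q.map f) T) (a k) (b k)).trans
    (congrArg₂ _ (ha f) (hb f))
  add_mem' {a b} ha hb k l f := (map_add (postcomp (Q.map f) T) (a k) (b k)).trans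
    (congrArg₂ _ (ha f) (hb f))
  neg_mem' {a} ha k l f := (map_neg (postcomp (Q.map f) T) (a k)).trans (congrArg _ (ha f))

/-- The functor of points of the limit of a diagram of ring objects. -/
def limPoints (Q : K ⥤ CommRingObjCat E) : Eᵒᵖ ⥤ CommRingCat.{v} where
  obj T := CommRingCat.of (limSubring Q T.unop)
  map {S T} f := CommRingCat.ofHom
    (((RingHom.pi fun k => (precomp (Q.obj k) f.unop).comp (Pi.evalRingHom _ k)).comp
      (limSubring Q S.unop).subtype).codRestrict (limSubring Q T.unop) (fun s k l g => by
        change (f.unop ≫ s.1 k) ≫ _ = f.unop ≫ s.1 l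
        rw [Category.assoc, s.2 g]))
  map_id T := by
    ext1
    refine RingHom.ext fun a => Subtype.ext (funext fun k => ?_)
    exact Category.id_comp _
  map_comp f g := by
    ext1
    refine RingHom.ext fun a => Subtype.ext (funext fun k => ?_)
    exact Category.assoc _ _ _

/-- The underlying object of the limit of a diagram of ring objects. -/
def limObj (Q : K ⥤ CommRingObjCat E) : E := limit (Q ⋙ CommRingObjCat.forget E)

def limπ (Q : K ⥤ CommRingObjCat E) (k : K) : limObj Q ⟶ (Q.obj k).X :=
  limit.π (Q ⋙ CommRingObjCat.forget E) k

lemma limπ_w (Q : K ⥤ CommRingObjCat E) {k l : K} (f : k ⟶ l) :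
    limπ Q k ≫ (Q.map f).hom = limπ Q l := limit.w (Q ⋙ CommRingObjCat.forget E) f

lemma lim_hom_ext (Q : K ⥤ CommRingObjCat E) {T : E} {f g : T ⟶ limObj Q}
    (h : ∀ k, f ≫ limπ Q k = g ≫ limπ Q k) : f = g := limit.hom_ext h

def limLiftObj (Q : K ⥤ CommRingObjCat E) {T : E} (s : ∀ k, T ⟶ (Q.obj k).X)
    (h : ∀ ⦃k l⦄ (f : k ⟶ l), s k ≫ (Q.map f).hom = s l) : T ⟶ limObj Q :=
  limit.lift (Q ⋙ CommRingObjCat.forget E)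
    ⟨T, { app := s, naturality := fun k l f => (Category.id_comp _).trans (h f).symm }⟩

@[simp] lemma limLiftObj_π (Q : K ⥤ CommRingObjCat E) {T : E} (s : ∀ k, T ⟶ (Q.obj k).X)
    (h : ∀ ⦃k l⦄ (f : k ⟶ l), s k ≫ (Q.map f).hom = s l) (k : K) :
    limLiftObj Q s h ≫ limπ Q k = s k := limit.lift_π _ _

def limRep (Q : K ⥤ CommRingObjCat E) : (limPoints Q ⋙ forget _).RepresentableBy (limObj Q) where
  homEquiv {T} :=
    { toFun z := (⟨fun k => z ≫ limπ Q k, fun k l f => by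
        simp [limπ_w]⟩ : limSubring Q T)
      invFun s := limLiftObj Q (Subtype.val (p := (· ∈ limSubring Q T)) s) s.2
      left_inv z := lim_hom_ext Q fun k => limLiftObj_π Q _ _ k
      right_inv s := Subtype.ext (funext fun k => limLiftObj_π Q _ _ k) }
  homEquiv_comp f g := Subtype.ext (funext fun k => Category.assoc _ _ _)

/-- The limit of a diagram of ring objects; its underlying object is the limit of the underlying
objects. -/
def limRing (Q : K ⥤ CommRingObjCat E) : CommRingObjCat E :=
  letI := commRingObjOfRep (limObj Q) (limPoints Q) (limRep Q)
  ⟨limObj Q⟩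

/-- The projections of the limit are maps of ring objects. -/
def limProj (Q : K ⥤ CommRingObjCat E) (k : K) : limRing Q ⟶ Q.obj k where
  hom := limπ Q k
  isRingHom := isRingHom_of_points _
    (fun T => congrArg (fun s => (Subtype.val (p := (· ∈ limSubring Q T)) s) k)
      (commRingObjOfRep_one (limObj Q) (limPoints Q) (limRep Q) T))
    (fun T a b => congrArg (fun s => (Subtype.val (p := (· ∈ limSubring Q T)) s) k)
      (commRingObjOfRep_add (limObj Q) (limPoints Q) (limRep Q) a b))
    (fun T a b => congrArg (fun s => (Subtype.val (p := (· ∈ limSubring Q T)) s) k)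
      (commRingObjOfRep_mul (limObj Q) (limPoints Q) (limRep Q) a b))

lemma limRing_hom_ext (Q : K ⥤ CommRingObjCat E) {T : E} {f g : T ⟶ (limRing Q).X}
    (h : ∀ k, f ≫ (limProj Q k).hom = g ≫ (limProj Q k).hom) : f = g := limit.hom_ext h

/-- The map of underlying objects for the universal property of the limit of ring objects. -/
def limLiftHom (Q : K ⥤ CommRingObjCat E) {T : E} (s : ∀ k, T ⟶ (Q.obj k).X)
    (h : ∀ ⦃k l⦄ (f : k ⟶ l), s k ≫ (Q.map f).hom = s l) : T ⟶ (limRing Q).X :=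
  limLiftObj Q s h

lemma limLiftHom_proj (Q : K ⥤ CommRingObjCat E) {T : E} (s : ∀ k, T ⟶ (Q.obj k).X)
    (h : ∀ ⦃k l⦄ (f : k ⟶ l), s k ≫ (Q.map f).hom = s l) (k : K) :
    limLiftHom Q s h ≫ (limProj Q k).hom = s k := limLiftObj_π Q s h k

/-- The universal property of the limit of a diagram of ring objects. -/
def limLift (Q : K ⥤ CommRingObjCat E) {R : CommRingObjCat E} (s : ∀ k, R ⟶ Q.obj k)
    (h : ∀ ⦃k l⦄ (f : k ⟶ l), s k ≫ Q.map f = s l) : R ⟶ limRing Q where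
  hom := limLiftHom Q (fun k => (s k).hom) fun _ _ f => congrArg CommRingObjCat.Hom.hom (h f)
  isRingHom := isRingHom_of_points _
    (fun T => limRing_hom_ext Q fun k => by
      rw [Category.assoc, limLiftHom_proj, MonObj.one_comp, MonObj.one_comp])
    (fun T a b => limRing_hom_ext Q fun k => by
      rw [Category.assoc, limLiftHom_proj, AddMonObj.add_comp, AddMonObj.add_comp,
        Category.assoc, Category.assoc, limLiftHom_proj])
    (fun T a b => limRing_hom_ext Q fun k => by
      rw [Category.assoc, limLiftHom_proj, MonObj.mul_comp, MonObj.mul_comp,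
        Category.assoc, Category.assoc, limLiftHom_proj])

@[simp] lemma limLift_proj (Q : K ⥤ CommRingObjCat E) {R : CommRingObjCat E}
    (s : ∀ k, R ⟶ Q.obj k) (h : ∀ ⦃k l⦄ (f : k ⟶ l), s k ≫ Q.map f = s l) (k : K) :
    limLift Q s h ≫ limProj Q k = s k :=
  CommRingObjCat.hom_ext (limLiftObj_π Q _
    (fun _ _ f => congrArg CommRingObjCat.Hom.hom (h f)) k)

lemma limProj_w (Q : K ⥤ CommRingObjCat E) {k l : K} (f : k ⟶ l) :
    limProj Q k ≫ Q.map f = limProj Q l := CommRingObjCat.hom_ext (limπ_w Q f)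

lemma lim_ring_hom_ext (Q : K ⥤ CommRingObjCat E) {R : CommRingObjCat E} {f g : R ⟶ limRing Q}
    (h : ∀ k, f ≫ limProj Q k = g ≫ limProj Q k) : f = g :=
  CommRingObjCat.hom_ext (limRing_hom_ext Q fun k => congrArg CommRingObjCat.Hom.hom (h k))

end lim

section alg
variable (A : Type w) [CommRing A]
variable (C : Type u) [Category.{v} C] [CartesianMonoidalCategory C] [BraidedCategory C]

/-- A commutative ring object `R` together with a ring homomorphism from `A` to its realization,
the ring of maps from the terminal object to `R`. -/
structure AlgObj where
  R : CommRingObjCat C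
  str : A →+* (𝟙_ C ⟶ R.X)

namespace AlgObj
variable {A C}

/-- Maps of ring objects that respect the elements of `A`. -/
@[ext]
structure Hom (P Q : AlgObj A C) where
  hom : P.R ⟶ Q.R
  str_comp : ∀ a, P.str a ≫ hom.hom = Q.str a

instance : Category (AlgObj A C) where
  Hom := Hom
  id P := ⟨𝟙 P.R, fun a => Category.comp_id _⟩
  comp f g := ⟨f.hom ≫ g.hom, fun a => by
    change _ ≫ (f.hom.hom ≫ g.hom.hom) = _
    rw [← Category.assoc, f.str_comp, g.str_comp]⟩
  id_comp f := Hom.ext (Category.id_comp _)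
  comp_id f := Hom.ext (Category.comp_id _)
  assoc f g h := Hom.ext (Category.assoc _ _ _)

@[ext] lemma hom_ext {P Q : AlgObj A C} {f g : P ⟶ Q} (h : f.hom = g.hom) : f = g := Hom.ext h

@[simp] lemma id_hom (P : AlgObj A C) : Hom.hom (𝟙 P) = 𝟙 P.R := rfl

@[simp] lemma comp_hom {P Q S : AlgObj A C} (f : P ⟶ Q) (g : Q ⟶ S) :
    (f ≫ g).hom = f.hom ≫ g.hom := rfl

variable (A C) in
/-- The underlying ring object. -/
def forgetRing : AlgObj A C ⥤ CommRingObjCat C where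
  obj P := P.R
  map f := f.hom

variable {D : Type*} [Category.{v} D] [CartesianMonoidalCategory D] [BraidedCategory D]

/-- The structure map for the image under a functor that preserves finite products. -/
def mapStr (G : C ⥤ D) [PreservesFiniteProducts G] (P : AlgObj A C) :
    A →+* (𝟙_ D ⟶ ((mapRing G).obj P.R).X) :=
  letI : G.Braided := .ofChosenFiniteProducts G
  ((precomp ((mapRing G).obj P.R) (Functor.LaxMonoidal.ε G)).comp (mapPt G P.R (𝟙_ C))).comp P.str

lemma mapStr_comp (G : C ⥤ D) [PreservesFiniteProducts G] {P Q : AlgObj A C} (f : P ⟶ Q) (a : A) :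
    mapStr G P a ≫ ((mapRing G).map f.hom).hom = mapStr G Q a := by
  letI : G.Braided := .ofChosenFiniteProducts G
  change (Functor.LaxMonoidal.ε G ≫ G.map (P.str a)) ≫ G.map f.hom.hom =
    Functor.LaxMonoidal.ε G ≫ G.map (Q.str a)
  rw [Category.assoc, ← G.map_comp, f.str_comp]

variable (A) in
/-- The functor on `A`-algebra objects induced by a functor that preserves finite products. -/
def mapAlg (G : C ⥤ D) [PreservesFiniteProducts G] : AlgObj A C ⥤ AlgObj A D where
  obj P := ⟨(mapRing G).obj P.R, mapStr G P⟩
  map f := ⟨(mapRing G).map f.hom, mapStr_comp G f⟩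
  map_id P := by ext1; exact (mapRing G).map_id _
  map_comp f g := by ext1; exact (mapRing G).map_comp _ _

/-- The functor `P ↦ a⁻¹P`, for an element `a` of `A`, from `A`-algebra objects of `C` to
`A`-algebra objects of the ind-category. -/
def loc (a : A) : AlgObj A C ⥤ AlgObj A (Ind C) where
  obj P := ⟨locRing P.R (P.str a), (postcomp (toLoc P.R (P.str a)) _).comp (mapStr Ind.yoneda P)⟩
  map {P Q} f := ⟨locMap f.hom (f.str_comp a), fun b => by
    have h1 : (toLoc P.R (P.str a)).hom ≫ (locMap f.hom (f.str_comp a)).hom =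
        ((mapRing Ind.yoneda).map f.hom).hom ≫ (toLoc Q.R (Q.str a)).hom :=
      locι_map f.hom (f.str_comp a) 0
    change (mapStr Ind.yoneda P b ≫ (toLoc P.R (P.str a)).hom) ≫ _ = 
      mapStr Ind.yoneda Q b ≫ (toLoc Q.R (Q.str a)).hom
    rw [Category.assoc, h1, ← Category.assoc, mapStr_comp]⟩
  map_id P := by
    ext1
    refine CommRingObjCat.hom_ext ?_
    exact (Ind.lim Idx.{v}).map_id _
  map_comp f g := by
    ext1
    refine CommRingObjCat.hom_ext ?_
    exact (Ind.lim Idx.{v}).map_comp (mulTowerMap f.hom (f.str_comp a))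
      (mulTowerMap g.hom (g.str_comp a))

variable {K : Type v} [SmallCategory K] [HasLimitsOfShape K C]

/-- The ring object underlying the limit of a diagram of `A`-algebra objects. -/
def algLimRing (Q : K ⥤ AlgObj A C) : CommRingObjCat C := limRing (Q ⋙ forgetRing A C)

/-- The projections of the limit. -/
def algLimProj (Q : K ⥤ AlgObj A C) (k : K) : algLimRing Q ⟶ (Q.obj k).R :=
  limProj (Q ⋙ forgetRing A C) k

lemma algLimProj_w (Q : K ⥤ AlgObj A C) {k l : K} (f : k ⟶ l) :
    algLimProj Q k ≫ (Q.map f).hom = algLimProj Q l := limProj_w (Q ⋙ forgetRing A C) f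

lemma algLim_hom_ext (Q : K ⥤ AlgObj A C) {T : C} {f g : T ⟶ (algLimRing Q).X}
    (h : ∀ k, f ≫ (algLimProj Q k).hom = g ≫ (algLimProj Q k).hom) : f = g :=
  limRing_hom_ext (Q ⋙ forgetRing A C) h

lemma algLim_ring_hom_ext (Q : K ⥤ AlgObj A C) {R : CommRingObjCat C} {f g : R ⟶ algLimRing Q}
    (h : ∀ k, f ≫ algLimProj Q k = g ≫ algLimProj Q k) : f = g :=
  lim_ring_hom_ext (Q ⋙ forgetRing A C) h

/-- The universal property of the limit. -/
def algLimLift (Q : K ⥤ AlgObj A C) {R : CommRingObjCat C} (s : ∀ k, R ⟶ (Q.obj k).R)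
    (h : ∀ ⦃k l⦄ (f : k ⟶ l), s k ≫ (Q.map f).hom = s l) : R ⟶ algLimRing Q :=
  limLift (Q ⋙ forgetRing A C) s h

lemma algLimLift_proj (Q : K ⥤ AlgObj A C) {R : CommRingObjCat C} (s : ∀ k, R ⟶ (Q.obj k).R)
    (h : ∀ ⦃k l⦄ (f : k ⟶ l), s k ≫ (Q.map f).hom = s l) (k : K) :
    algLimLift Q s h ≫ algLimProj Q k = s k := limLift_proj (Q ⋙ forgetRing A C) s h k

/-- The underlying function of the structure map of the limit. -/
def limStrFun (Q : K ⥤ AlgObj A C) (a : A) : 𝟙_ C ⟶ (algLimRing Q).X :=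
  limLiftHom (Q ⋙ forgetRing A C) (fun k => (Q.obj k).str a) fun _ _ f => (Q.map f).str_comp a

lemma limStrFun_proj (Q : K ⥤ AlgObj A C) (a : A) (k : K) :
    limStrFun Q a ≫ (algLimProj Q k).hom = (Q.obj k).str a :=
  limLiftHom_proj (Q ⋙ forgetRing A C) _ (fun _ _ f => (Q.map f).str_comp a) k

/-- The structure map of the limit of a diagram of `A`-algebra objects. -/
def limStr (Q : K ⥤ AlgObj A C) : A →+* (𝟙_ C ⟶ (algLimRing Q).X) where
  toFun := limStrFun Q
  map_one' := algLim_hom_ext _ fun k => by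
    rw [limStrFun_proj, map_one, MonObj.one_comp]
  map_mul' a b := algLim_hom_ext _ fun k => by
    rw [limStrFun_proj, map_mul, MonObj.mul_comp, limStrFun_proj, limStrFun_proj]
  map_zero' := algLim_hom_ext _ fun k => by
    rw [limStrFun_proj, map_zero, AddMonObj.zero_comp]
  map_add' a b := algLim_hom_ext _ fun k => by
    rw [limStrFun_proj, map_add, AddMonObj.add_comp, limStrFun_proj, limStrFun_proj]

/-- The map of ring objects underlying the functoriality of limits of `A`-algebra objects. -/
def limMap {Q Q' : K ⥤ AlgObj A C} (f : Q ⟶ Q') : algLimRing Q ⟶ algLimRing Q' :=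
  algLimLift _ (fun k => algLimProj Q k ≫ (f.app k).hom) (fun k l g => by
    have h1 : (f.app k).hom ≫ (Q'.map g).hom = (Q.map g).hom ≫ (f.app l).hom :=
      congrArg Hom.hom (f.naturality g).symm
    rw [Category.assoc, h1, ← Category.assoc, algLimProj_w])

lemma limMap_proj {Q Q' : K ⥤ AlgObj A C} (f : Q ⟶ Q') (k : K) :
    limMap f ≫ algLimProj Q' k = algLimProj Q k ≫ (f.app k).hom :=
  algLimLift_proj _ _ _ _

/-- Limits of diagrams of `A`-algebra objects. -/
def lim : (K ⥤ AlgObj A C) ⥤ AlgObj A C where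
  obj Q := ⟨algLimRing Q, limStr Q⟩
  map {Q Q'} f := ⟨limMap f, fun a => algLim_hom_ext _ fun k => by
    have h1 : (limMap f).hom ≫ (algLimProj Q' k).hom = (algLimProj Q k).hom ≫ (f.app k).hom.hom :=
      congrArg CommRingObjCat.Hom.hom (limMap_proj f k)
    change (limStrFun Q a ≫ _) ≫ _ = limStrFun Q' a ≫ _
    rw [Category.assoc, h1, limStrFun_proj, ← Category.assoc, limStrFun_proj]
    exact (f.app k).str_comp a⟩
  map_id Q := by
    ext1
    refine algLim_ring_hom_ext _ fun k => (limMap_proj _ k).trans ?_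
    change _ ≫ 𝟙 _ = 𝟙 _ ≫ _
    rw [Category.comp_id, Category.id_comp]
  map_comp {P Q S} f g := by
    ext1
    refine algLim_ring_hom_ext _ fun k => (limMap_proj _ k).trans ?_
    change algLimProj P k ≫ ((f.app k).hom ≫ (g.app k).hom) = (limMap f ≫ limMap g) ≫ _
    rw [Category.assoc, limMap_proj, ← Category.assoc, ← Category.assoc, limMap_proj]

end AlgObj
end alg


section finite

/-- Finite sets have finite products. -/
instance : CartesianMonoidalCategory FintypeCat.{u} :=
  have : HasFiniteProducts FintypeCat.{u} := hasFiniteProducts_of_hasFiniteLimits _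
  .ofHasFiniteProducts

instance : BraidedCategory FintypeCat.{u} := .ofCartesianMonoidalCategory

variable {C : Type u} [Category.{v} C] [CartesianMonoidalCategory C] [BraidedCategory C]

/-- The points of a ring object given by a representable presheaf of rings. -/
def ofRepPoints (X : C) (F : Cᵒᵖ ⥤ CommRingCat.{w}) (α : (F ⋙ forget _).RepresentableBy X) (T : C) :
    letI := commRingObjOfRep X F α
    (T ⟶ X) ≃+* F.obj (op T) :=
  letI := commRingObjOfRep X F α
  { α.homEquiv (X := T) with
    map_mul' := commRingObjOfRep_mul X F α
    map_add' := commRingObjOfRep_add X F α }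

/-- The functor of points of a finite commutative ring. -/
def finPoints (B : Type u) [CommRing B] : FintypeCat.{u}ᵒᵖ ⥤ CommRingCat.{u} where
  obj T := CommRingCat.of (T.unop.obj → B)
  map {S T} f := CommRingCat.ofHom
    (RingHom.pi fun t : T.unop.obj => Pi.evalRingHom (fun _ : S.unop.obj => B) (f.unop t))

/-- A finite commutative ring represents its functor of points. -/
def finRep (B : Type u) [CommRing B] [Finite B] :
    (finPoints B ⋙ forget _).RepresentableBy (FintypeCat.of B) where
  homEquiv {T} :=
    { toFun f := (fun t => f t : T.obj → B)
      invFun g := FintypeCat.homMk (X := T) (Y := FintypeCat.of B) (g : T.obj → B)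
      left_inv _ := rfl
      right_inv _ := rfl }
  homEquiv_comp _ _ := rfl

/-- A finite commutative ring, as a ring object in finite sets. -/
def finRing (B : Type u) [CommRing B] [Finite B] : CommRingObjCat FintypeCat.{u} :=
  letI := commRingObjOfRep _ (finPoints B) (finRep B)
  ⟨FintypeCat.of B⟩

/-- The points of a finite ring are the functions to it, with the pointwise operations. -/
def finPt (B : Type u) [CommRing B] [Finite B] (T : FintypeCat.{u}) :
    (T ⟶ (finRing B).X) ≃+* (T.obj → B) :=
  ofRepPoints _ (finPoints B) (finRep B) T

/-- A homomorphism of finite commutative rings, as a map of ring objects in finite sets. -/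
def finRingMap {B B' : Type u} [CommRing B] [Finite B] [CommRing B'] [Finite B'] (f : B →+* B') :
    finRing B ⟶ finRing B' :=
  letI g : (finRing B).X ⟶ (finRing B').X :=
    FintypeCat.homMk (X := FintypeCat.of B) (Y := FintypeCat.of B') f
  have hg (T : FintypeCat.{u}) (a : T ⟶ (finRing B).X) (t : T.obj) :
    finPt B' T (a ≫ g) t = f (finPt B T a t) := rfl
  { hom := g
    isRingHom := isRingHom_of_points g
      (fun T => (finPt B' T).injective (funext fun t => by
        rw [hg, map_one, map_one, Pi.one_apply, Pi.one_apply, map_one]))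
      (fun T a b => (finPt B' T).injective (funext fun t => by
        rw [hg, map_add, map_add, Pi.add_apply, Pi.add_apply, hg, hg, map_add]))
      (fun T a b => (finPt B' T).injective (funext fun t => by
        rw [hg, map_mul, map_mul, Pi.mul_apply, Pi.mul_apply, hg, hg, map_mul])) }

variable (A : Type u) [CommRing A]

/-- The ideals of `A` with finite quotient. -/
abbrev FinQuot := {J : Ideal A // Finite (A ⧸ J)}

variable {A} in
/-- The finite quotient `A / J` as a ring object in finite sets. -/
def quotAlg (J : FinQuot A) : AlgObj A FintypeCat.{u} :=
  haveI := J.2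
  { R := finRing (A ⧸ J.1)
    str := (finPt (A ⧸ J.1) (𝟙_ FintypeCat.{u})).symm.toRingHom.comp
      (RingHom.pi fun _ : (𝟙_ FintypeCat.{u}).obj => Ideal.Quotient.mk J.1) }

/-- The finite quotients of `A`, as ring objects in finite sets. -/
def quotFunctor : FinQuot A ⥤ AlgObj A FintypeCat.{u} where
  obj := quotAlg
  map {J J'} f :=
    haveI := J.2
    haveI := J'.2
    ⟨finRingMap (Ideal.Quotient.factor (S := J.1) (T := J'.1) (leOfHom f)), fun _ => rfl⟩
  map_id J := by
    ext1
    refine CommRingObjCat.hom_ext (FintypeCat.hom_ext _ _ fun x => ?_)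
    obtain ⟨x, rfl⟩ := Ideal.Quotient.mk_surjective x
    rfl
  map_comp {J J' J''} f g := by
    ext1
    refine CommRingObjCat.hom_ext (FintypeCat.hom_ext _ _ fun x => ?_)
    obtain ⟨x, rfl⟩ := Ideal.Quotient.mk_surjective x
    rfl

end finite

section tower

/-- A category with finite products, bundled. -/
structure PipeCat : Type (u + 2) where
  C : Type (u + 1)
  [cat : Category.{u} C]
  [cart : CartesianMonoidalCategory C]
  [braid : BraidedCategory C]

attribute [instance] PipeCat.cat PipeCat.cart PipeCat.braid

/-- `0`-pipes are pro-objects in finite sets, that is, profinite sets, and `(n + 1)`-pipes are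
pro-objects in ind-objects in `n`-pipes. -/
def pipeCat : ℕ → PipeCat.{u}
  | 0 => ⟨Pro FintypeCat.{u}⟩
  | n + 1 => ⟨Pro (Ind (pipeCat n).C)⟩

/-- The category of `n`-pipes. -/
abbrev Pipes (n : ℕ) : Type (u + 1) := (pipeCat.{u} n).C

/-- The category of `n`-pipe rings: commutative ring objects in `n`-pipes. -/
abbrev PipeRing (n : ℕ) := CommRingObjCat (Pipes.{u} n)

/-- Ring objects, as constant ring objects in pro-objects in ind-objects. -/
def inclStage (C : Type (u + 1)) [Category.{u} C] [CartesianMonoidalCategory C]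
    [BraidedCategory C] : CommRingObjCat C ⥤ CommRingObjCat (Pro (Ind C)) :=
  mapRing (Ind.yoneda (C := C)) ⋙ mapRing (Pro.const (Ind C))

/-- The inclusion of `n`-pipe rings in `(n + 1)`-pipe rings. -/
def incl (n : ℕ) : PipeRing.{u} n ⥤ PipeRing.{u} (n + 1) := inclStage (Pipes.{u} n)

/-- The inclusion of `0`-pipe rings in `n`-pipe rings. -/
def inclZero : ∀ n : ℕ, PipeRing.{u} 0 ⥤ PipeRing.{u} n
  | 0 => 𝟭 _
  | n + 1 => inclZero n ⋙ incl n

variable {A : Type u} [CommRing A]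

lemma adicSys_le (I J : Ideal A) {m n : ℕ} (h : m ≤ n) :
    J ⊔ I ^ (n + 1) ≤ J ⊔ I ^ (m + 1) :=
  sup_le_sup_left (Ideal.pow_le_pow_right (Nat.succ_le_succ h)) _

/-- The system of ideals `m ↦ J + I ^ (m + 1)`. -/
def adicSys (I : Ideal A) : Ideal A ⥤ Idx.{u}ᵒᵖ ⥤ Ideal A where
  obj J :=
    { obj m := J ⊔ I ^ (m.unop.down + 1)
      map f := homOfLE (adicSys_le I J f.unop.down.down) }
  map f := { app m := homOfLE (sup_le_sup_right (leOfHom f) _) }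

lemma finite_quotient_of_le {I J : Ideal A} (h : I ≤ J) (hI : Finite (A ⧸ I)) :
    Finite (A ⧸ J) :=
  Finite.of_surjective _ (Ideal.Quotient.factor_surjective h)

/-- The system of ideals `m ↦ J + I ^ (m + 1)`, when they have finite quotients. -/
def adicSysFin (I : Ideal A) (hfin : ∀ m, Finite (A ⧸ I ^ m)) :
    Ideal A ⥤ Idx.{u}ᵒᵖ ⥤ FinQuot A where
  obj J :=
    { obj m := ⟨J ⊔ I ^ (m.unop.down + 1), finite_quotient_of_le le_sup_right (hfin _)⟩
      map f := homOfLE (Subtype.mk_le_mk.2 (adicSys_le I J f.unop.down.down)) }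
  map f := { app m := homOfLE (Subtype.mk_le_mk.2 (sup_le_sup_right (leOfHom f) _)) }

section stage
variable {C : Type (u + 1)} [Category.{u} C] [CartesianMonoidalCategory C] [BraidedCategory C]

/-- The localization map `P ⟶ a⁻¹P`. -/
def algToLoc (a : A) (P : AlgObj A C) :
    (mapRing (Ind.yoneda (C := C))).obj P.R ⟶ ((AlgObj.loc a).obj P).R :=
  toLoc P.R (P.str a)

lemma algToLoc_naturality (a : A) {P Q : AlgObj A C} (f : P ⟶ Q) :
    algToLoc a P ≫ ((AlgObj.loc a).map f).hom =
      (mapRing (Ind.yoneda (C := C))).map f.hom ≫ algToLoc a Q :=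
  CommRingObjCat.hom_ext (locι_map f.hom (f.str_comp a) 0)

/-- Given the quotients `X / J` of a ring object `X` by ideals `J` of `A`, the quotients `Y / J` of
the completed localization `Y` of `X`, which is the pro-system over `m` of the ind-systems
`X / I ^ (m + 1) → X / I ^ (m + 1) → ⋯` with all maps given by multiplication by `a`. -/
def locComplete (a : A) (I : Ideal A) (G : Ideal A ⥤ AlgObj A C) :
    Ideal A ⥤ AlgObj A (Pro (Ind C)) :=
  adicSys I ⋙ (Functor.whiskeringRight _ _ _).obj
    (G ⋙ AlgObj.loc a ⋙ AlgObj.mapAlg A (Pro.const (Ind C))) ⋙ AlgObj.lim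

/-- The natural map from a ring object to its completed localization. -/
def toLocComplete (a : A) (I : Ideal A) (G : Ideal A ⥤ AlgObj A C) :
    (inclStage C).obj (G.obj ⊥).R ⟶
      ((locComplete a I G).obj ⊥).R :=
  AlgObj.algLimLift _ (fun m => (mapRing (Pro.const (Ind C))).map
      ((mapRing (Ind.yoneda (C := C))).map (G.map (homOfLE bot_le)).hom ≫
        algToLoc a (G.obj (((adicSys I).obj ⊥).obj m)))) (fun k l f => by
    have h0 : G.map (homOfLE bot_le) ≫ G.map (((adicSys I).obj ⊥).map f) =
      G.map (homOfLE bot_le) := (G.map_comp _ _).symm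
    have h1 := congrArg AlgObj.Hom.hom h0
    have h2 := algToLoc_naturality a (G.map (((adicSys I).obj ⊥).map f))
    have h3 : (mapRing Ind.yoneda).map (G.map (homOfLE bot_le)).hom ≫
          (mapRing Ind.yoneda).map (G.map (((adicSys I).obj ⊥).map f)).hom =
        (mapRing (Ind.yoneda (C := C))).map (G.map (homOfLE bot_le)).hom :=
      ((mapRing (Ind.yoneda (C := C))).map_comp _ _).symm.trans
        (congrArg ((mapRing (Ind.yoneda (C := C))).map ·) h1)
    refine ((mapRing (Pro.const (Ind C))).map_comp _ _).symm.trans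
        (congrArg ((mapRing (Pro.const (Ind C))).map ·) ?_)
    rw [Category.assoc, h2, ← Category.assoc, h3])

end stage

/-- The ideal `I_t = (u_0, …, u_(t-1))`. -/
def flagIdeal (u : ℕ → A) (t : ℕ) : Ideal A := Ideal.span (u '' Set.Iio t)

section
variable (u : ℕ → A) (h : ℕ) (ht : ℕ → ℕ) (hfin : ∀ m, Finite (A ⧸ flagIdeal u h ^ m))

/-- The quotients, by the ideals `J` of `A`, of the iterated completed localizations of `A`.
Stage `0` is `A` as a profinite ring: the pro-system of the finite rings `A / I_h ^ (m + 1)`.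
Stage `n + 1` is stage `n` localized at `u_t` and completed at `I_t`, where `t = ht (n + 1)`. -/
def tower : ∀ n : ℕ, Ideal A ⥤ AlgObj A (Pipes.{u} n)
  | 0 => adicSysFin _ hfin ⋙ (Functor.whiskeringRight _ _ _).obj
      (quotFunctor A ⋙ AlgObj.mapAlg A (Pro.const FintypeCat.{u})) ⋙ AlgObj.lim
  | n + 1 => locComplete (u (ht (n + 1))) (flagIdeal u (ht (n + 1))) (tower n)

/-- Stage `n` of the iterated completed localization of `A`, as an `n`-pipe ring. -/
def towerRing (n : ℕ) : PipeRing.{u} n := ((tower u h ht hfin n).obj ⊥).R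

/-- The natural map from stage `n` to stage `n + 1`. -/
def towerStep (n : ℕ) : (incl n).obj (towerRing u h ht hfin n) ⟶ towerRing u h ht hfin (n + 1) :=
  toLocComplete (u (ht (n + 1))) (flagIdeal u (ht (n + 1))) (tower u h ht hfin n)

/-- The natural map from stage `0` to stage `n`. -/
def towerFromZero : ∀ n : ℕ,
    (inclZero n).obj (towerRing u h ht hfin 0) ⟶ towerRing u h ht hfin n
  | 0 => 𝟙 _
  | n + 1 => (incl n).map (towerFromZero n) ≫ towerStep u h ht hfin n

/-- The map from `A` to the realization of stage `n`, that is, to the ring of maps from the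
terminal `n`-pipe. -/
def towerStr (n : ℕ) : A →+* (𝟙_ (Pipes.{u} n) ⟶ (towerRing u h ht hfin n).X) :=
  ((tower u h ht hfin n).obj ⊥).str

end

end tower

section formalGroup

/-- The series `[n](x)` of a formal group law. -/
def nSeries {R : Type u} [CommRing R] (F : FormalGroup R) : ℕ → PowerSeries R
  | 0 => 0
  | n + 1 => MvPowerSeries.subst ![nSeries F n, PowerSeries.X] F.toPowerSeries

/-- `f` is an isomorphism of formal group laws from `F` to `G`: `f(0) = 0`, `f'(0)` is a unit and
`f(F(x, y)) = G(f(x), f(y))`. -/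
structure IsFormalIso {R : Type u} [CommRing R] (F G : FormalGroup R) (f : PowerSeries R) :
    Prop where
  constantCoeff : PowerSeries.constantCoeff f = 0
  isUnit_coeff_one : IsUnit (PowerSeries.coeff 1 f)
  map_add : PowerSeries.subst F.toPowerSeries f =
    MvPowerSeries.subst ![PowerSeries.subst (MvPowerSeries.X 0 : MvPowerSeries (Fin 2) R) f,
      PowerSeries.subst (MvPowerSeries.X 1 : MvPowerSeries (Fin 2) R) f] G.toPowerSeries

/-- A formal group law over a field of characteristic `p` has height `h` if the leading term of
its `p`-series is in degree `p ^ h`. -/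
def HasHeight {k : Type u} [Field k] (p h : ℕ) (H : FormalGroup k) : Prop :=
  (∀ i < p ^ h, PowerSeries.coeff i (nSeries H p) = 0) ∧
    PowerSeries.coeff (p ^ h) (nSeries H p) ≠ 0

variable {k : Type u} [Field k]

/-- `R` is a complete Noetherian local ring with residue field `k`, by means of `π`. -/
structure IsCoeffRing {R : Type u} [CommRing R] (π : R →+* k) : Prop where
  isLocalRing : IsLocalRing R
  isNoetherianRing : IsNoetherianRing R
  surjective : Function.Surjective π
  isAdicComplete : IsAdicComplete (RingHom.ker π) R

/-- A deformation of `H` to `R`: a commutative formal group law over `R` with an isomorphism from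
its reduction to `H`. -/
structure Deformation (H : FormalGroup k) {R : Type u} [CommRing R] (π : R →+* k) where
  F : FormalGroup R
  isComm : F.IsComm
  g : PowerSeries k
  isFormalIso : IsFormalIso (F.map π) H g

namespace Deformation
variable {H : FormalGroup k} {R R' : Type u} [CommRing R] [CommRing R'] {π : R →+* k}
  {π' : R' →+* k}

/-- `φ : R → R'` is a map over `k` along which `D` pulls back to a deformation isomorphic
to `D'`, by an isomorphism that reduces to the identity of `H`. -/
def Classifies (D : Deformation H π) (D' : Deformation H π') (φ : R →+* R') : Prop :=
  π'.comp φ = π ∧ ∃ f : PowerSeries R', IsFormalIso (D.F.map φ) D'.F f ∧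
    PowerSeries.subst (PowerSeries.map π' f) D'.g = D.g

/-- `D` is a universal deformation of `H` over a complete Noetherian local ring with residue field `k`. -/
def IsUniversal (D : Deformation H π) : Prop :=
  IsCoeffRing π ∧ ∀ (S : Type u) [CommRing S] (ρ : S →+* k), IsCoeffRing ρ →
    ∀ E : Deformation H ρ, ∃! φ : R →+* S, D.Classifies E φ

end Deformation

/-- Lubin-Tate coordinates `p = u_0, u_1, …, u_(h-1)` for the formal group law of a deformation.
The entries beyond `u_h` carry no information; `u_h` may be any unit. -/
structure LubinTateCoords (p h : ℕ) [Fact p.Prime] {H : FormalGroup k} {A : Type u} [CommRing A]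
    {π : A →+* k} (D : Deformation H π) where
  u : ℕ → A
  u_zero : u 0 = p
  isUnit_u : IsUnit (u h)
  /-- `u_1, …, u_(h-1)` are coordinates: they identify `A` with the power series ring in `h - 1`
  variables over the Witt vectors of `k`, compatibly with the maps to `k`. -/
  coords : ∃ e : MvPowerSeries (Fin (h - 1)) (WittVector p k) ≃+* A,
    (∀ i : Fin (h - 1), e (MvPowerSeries.X i) = u (i + 1)) ∧
      ∀ w : WittVector p k, π (e (MvPowerSeries.C w)) = w.coeff 0
  /-- `[p](x)` is congruent to `u_t x ^ (p ^ t)` modulo `I_t` and `x ^ (1 + p ^ t)`. -/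
  pSeries : ∀ t < h, (∀ i < p ^ t, PowerSeries.coeff i (nSeries D.F p) ∈ flagIdeal u t) ∧
    PowerSeries.coeff (p ^ t) (nSeries D.F p) - u t ∈ flagIdeal u t

/-- A power series without constant term is in the ideal generated by the variables. -/
lemma mem_span_X {n : ℕ} {B : Type u} [CommRing B] (f : MvPowerSeries (Fin n) B)
    (hf : MvPowerSeries.constantCoeff f = 0) :
    f ∈ Ideal.span (Set.range (MvPowerSeries.X : Fin n → MvPowerSeries (Fin n) B)) := by
  classical
  let c (d : Fin n →₀ ℕ) (i : Fin n) : Prop := d i ≠ 0 ∧ ∀ j < i, d j = 0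
  let g (i : Fin n) : MvPowerSeries (Fin n) B := fun d =>
    if c (d + Finsupp.single i 1) i then MvPowerSeries.coeff (d + Finsupp.single i 1) f else 0
  have hg (i : Fin n) (d : Fin n →₀ ℕ) : MvPowerSeries.coeff d (MvPowerSeries.X i * g i) =
      if c d i then MvPowerSeries.coeff d f else 0 := by
    rw [MvPowerSeries.X, MvPowerSeries.coeff_monomial_mul, one_mul]
    by_cases h : Finsupp.single i 1 ≤ d
    · rw [if_pos h]
      have h2 : d - Finsupp.single i 1 + Finsupp.single i 1 = d := tsub_add_cancel_of_le h
      change (if c (d - Finsupp.single i 1 + Finsupp.single i 1) i then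
        MvPowerSeries.coeff (d - Finsupp.single i 1 + Finsupp.single i 1) f else 0) = _
      rw [h2]
    · rw [if_neg h, if_neg]
      rintro ⟨h1, -⟩
      exact h (Finsupp.single_le_iff.2 (Nat.one_le_iff_ne_zero.2 h1))
  have hfg : f = ∑ i, MvPowerSeries.X i * g i := by
    ext d
    rw [map_sum]
    simp only [hg]
    by_cases hd : d = 0
    · subst hd
      simp [c, hf]
    · have hex : ∃ i, d i ≠ 0 := by
        by_contra! h
        exact hd (Finsupp.ext h)
      obtain ⟨i, hi⟩ : ∃ i, c d i := by
        let S : Finset (Fin n) := Finset.univ.filter fun i => d i ≠ 0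
        have hS : S.Nonempty := by
          obtain ⟨i, hi⟩ := hex
          exact ⟨i, by simp [S, hi]⟩
        refine ⟨S.min' hS, ?_, fun j hj => ?_⟩
        · have := S.min'_mem hS
          simpa [S] using this
        · by_contra h
          exact absurd (S.min'_le j (by simp [S, h])) (not_le.2 hj)
      rw [Finset.sum_eq_single i, if_pos hi]
      · intro j _ hji
        refine if_neg fun hj => ?_
        rcases lt_trichotomy j i with h | h | h
        · exact hj.1 (hi.2 j h)
        · exact hji h
        · exact hi.1 (hj.2 i h)
      · simp
  rw [hfg]
  exact Ideal.sum_mem _ fun i _ => Ideal.mul_mem_right _ _ (Ideal.subset_span ⟨i, rfl⟩)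

lemma finite_quotient_flagIdeal {p h : ℕ} [Fact p.Prime] {A : Type u} [CommRing A] [Finite k]
    [CharP k p]
    (u : ℕ → A) (hu0 : u 0 = p) (hh : 1 ≤ h)
    (e : MvPowerSeries (Fin (h - 1)) (WittVector p k) ≃+* A)
    (he : ∀ i : Fin (h - 1), e (MvPowerSeries.X i) = u (i + 1)) (m : ℕ) :
    Finite (A ⧸ flagIdeal u h ^ m) := by
  have : PerfectRing k p := inferInstance
  have hp : (p : A) ∈ flagIdeal u h :=
    Ideal.subset_span ⟨0, Nat.lt_of_lt_of_le Nat.zero_lt_one hh, hu0⟩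
  have hX : (Ideal.span (Set.range MvPowerSeries.X)).map e.toRingHom ≤ flagIdeal u h := by
    rw [Ideal.map_span, Ideal.span_le]
    rintro _ ⟨_, ⟨i, rfl⟩, rfl⟩
    exact Ideal.subset_span ⟨i + 1, Set.mem_Iio.2 (by omega), (he i).symm⟩
  have hmem (f : MvPowerSeries (Fin (h - 1)) (WittVector p k))
      (hf : (MvPowerSeries.constantCoeff f).coeff 0 = 0) : e f ∈ flagIdeal u h := by
    have h1 : MvPowerSeries.constantCoeff f ∈
        RingHom.ker (WittVector.constantCoeff (p := p) (R := k)) := hf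
    rw [WittVector.ker_constantCoeff, Ideal.mem_span_singleton'] at h1
    obtain ⟨w, hw⟩ := h1
    have h2 : f - MvPowerSeries.C (w * p) ∈ Ideal.span (Set.range MvPowerSeries.X) :=
      mem_span_X _ (by simp [← hw])
    have h3 := hX (Ideal.mem_map_of_mem e.toRingHom h2)
    have h4 : e (MvPowerSeries.C (w * p)) ∈ flagIdeal u h := by
      rw [map_mul, map_mul, map_natCast, map_natCast]
      exact Ideal.mul_mem_left _ _ hp
    have := Ideal.add_mem _ h3 h4
    simpa using this
  have hfin : Finite (A ⧸ flagIdeal u h) := by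
    refine Finite.of_injective (β := k) (fun q =>
      (MvPowerSeries.constantCoeff (e.symm (Quotient.out q))).coeff 0) fun q q' hq => ?_
    rw [← Quotient.out_eq q, ← Quotient.out_eq q']
    refine Ideal.Quotient.eq.2 ?_
    have hq' : WittVector.constantCoeff (MvPowerSeries.constantCoeff (e.symm (Quotient.out q))) =
      WittVector.constantCoeff (MvPowerSeries.constantCoeff (e.symm (Quotient.out q'))) := hq
    have := hmem (e.symm (Quotient.out q - Quotient.out q')) (by
      change WittVector.constantCoeff _ = 0
      rw [map_sub, map_sub, map_sub, hq', sub_self])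
    simpa using this
  have hfg : (flagIdeal u h).FG := Submodule.fg_span ((Set.finite_Iio h).image u)
  exact Ideal.finite_quotient_pow hfg m

namespace LubinTateCoords
variable {p h : ℕ} [Fact p.Prime] {H : FormalGroup k} {A : Type u} [CommRing A]
    {π : A →+* k} {D : Deformation H π}

lemma finite_quotient (U : LubinTateCoords p h D) [Finite k] [CharP k p] (hh : 1 ≤ h) (m : ℕ) :
    Finite (A ⧸ flagIdeal U.u h ^ m) := by
  obtain ⟨e, he, -⟩ := U.coords
  exact finite_quotient_flagIdeal U.u U.u_zero hh e he m

variable [Finite k] [CharP k p] (U : LubinTateCoords p h D) (hh : 1 ≤ h) (ht : ℕ → ℕ) (n : ℕ)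

/-- The `n`-pipe ring obtained from `A` by localizing at `u_t` and completing at `I_t`
successively for `t = ht 1, …, ht n`. -/
def pipeRing : PipeRing.{u} n := towerRing U.u h ht (U.finite_quotient hh) n

/-- The natural map from the `n`-th to the `(n + 1)`-st ring. -/
def step : (incl n).obj (U.pipeRing hh ht n) ⟶ U.pipeRing hh ht (n + 1) :=
  towerStep U.u h ht (U.finite_quotient hh) n

/-- The natural map from the `0`-th to the `n`-th ring. -/
def fromZero : (inclZero n).obj (U.pipeRing hh ht 0) ⟶ U.pipeRing hh ht n :=
  towerFromZero U.u h ht (U.finite_quotient hh) n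

/-- The map from `A` to the realization of the `n`-th ring, that is, to the ring of maps from the
terminal `n`-pipe. -/
def str : A →+* (𝟙_ (Pipes.{u} n) ⟶ (U.pipeRing hh ht n).X) :=
  towerStr U.u h ht (U.finite_quotient hh) n

end LubinTateCoords
end formalGroup

end PipeRings

end

/-! Existence. The isomorphism of universal deformations supplies a power series `f` with `f'(0)`
invertible that intertwines the two `p`-series. Modulo `(v_0, …, v_(t-1))` both `p`-series start in
degree `q = p ^ t`, and the leading coefficients in `f ∘ [p] = [p] ∘ f` give `φ(u_t) f'(0) = v_t
f'(0) ^ q`. By induction on `t`, `φ` carries the ideal `I_t` for `u` into that for `v`, and `φ(u_t)`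
is a unit times `v_t` modulo this ideal (`LubinTateCoords.map_flagIdeal`). In each quotient that
enters the completion at `I_t`, a power of `I_t` vanishes. There `φ(u_t)` differs from a unit
multiple of `v_t` by a nilpotent element, so it becomes invertible when `v_t` does
(`LaxMap.isUnit_of_kills`). The universal property of localization and passage to limits then give
maps of towers in both directions (`LaxMap.tower`). Their composites fix the elements of the base
ring and commute with the natural maps, so they are identities by the uniqueness half.

Uniqueness. At stage `0`, a map to a finite quotient factors through a finite quotient of `A`, so
its values on `A` determine it. For the later stages one would like to say that localization and
completion are epimorphisms of rings. However, a ring map from a pro-system to a constant object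
factors through a term only as a map of objects, and a map to `y⁻¹Y` is a fraction `s₀ / y ^ j`
whose numerator is not a ring map. The notion that survives both operations is `ScaledMul`: `s(1) =
e` and `e s(ab) = s(a) s(b)`. Such maps that agree on stage `0` agree after multiplication by `e ^
N`, where `N = 2n` depends only on the stage `n` of the source (`uniqueUpTo_towerFromZero`).

The exponent `N` is unchanged when the target is replaced by a limit, a constant object or a
localization. It grows by `2` when the source moves up one stage, by a zigzag computation with an
invertible element (`ScaledMul.comp_fraction_eq`). That computation uses that projections to the
terms of the pro-systems are epimorphisms, which follows from `epiSys_tower`. For ring maps `e = 1`,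
and the factor disappears. -/

noncomputable section
namespace PipeRings
universe w v
open Limits MonoidalCategory CartesianMonoidalCategory Opposite
open scoped CommRingObj

/-! ### Homomorphisms of formal group laws and their effect on the series `[n](x)`. -/

section formal
variable {R S : Type u} [CommRing R] [CommRing S]

lemma IsFormalIso.hasSubst {F G : FormalGroup R} {f : PowerSeries R} (hf : IsFormalIso F G f) :
    PowerSeries.HasSubst f := .of_constantCoeff_zero' hf.constantCoeff

lemma constantCoeff_nSeries (F : FormalGroup R) (n : ℕ) :
    PowerSeries.constantCoeff (nSeries F n) = 0 := by
  induction n with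
  | zero => simp [nSeries]
  | succ n ih =>
    have hc : ∀ i, MvPowerSeries.constantCoeff
        ((![nSeries F n, PowerSeries.X] : Fin 2 → PowerSeries R) i) = 0 := by
      intro i
      fin_cases i
      · exact ih
      · exact PowerSeries.constantCoeff_X
    exact MvPowerSeries.constantCoeff_subst_eq_zero
      (MvPowerSeries.hasSubst_of_constantCoeff_zero hc) hc F.zero_constantCoeff

lemma hasSubst_pair {σ : Type*} {a b : MvPowerSeries σ R} (ha : PowerSeries.HasSubst a)
    (hb : PowerSeries.HasSubst b) : MvPowerSeries.HasSubst ![a, b] :=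
  MvPowerSeries.hasSubst_of_constantCoeff_nilpotent fun i => by
    fin_cases i
    · exact ha
    · exact hb

lemma hasSubst_subst {σ : Type*} {f : PowerSeries R} {a : MvPowerSeries σ R}
    (hf : PowerSeries.HasSubst f) (ha : PowerSeries.HasSubst a) :
    PowerSeries.HasSubst (PowerSeries.subst a f) := by
  rw [← PowerSeries.coe_substAlgHom ha]
  exact hf.comp ha

lemma hasSubst_nSeries (F : FormalGroup R) (n : ℕ) : PowerSeries.HasSubst (nSeries F n) :=
  .of_constantCoeff_zero' (constantCoeff_nSeries F n)

lemma hasSubst_formalGroup (F : FormalGroup R) : PowerSeries.HasSubst F.toPowerSeries :=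
  .of_constantCoeff_zero F.zero_constantCoeff

/-- A homomorphism of formal group laws is additive on power series. -/
lemma IsFormalIso.subst_add {F G : FormalGroup R} {f : PowerSeries R} (hf : IsFormalIso F G f)
    {σ : Type*} {a b : MvPowerSeries σ R} (ha : PowerSeries.HasSubst a)
    (hb : PowerSeries.HasSubst b) :
    PowerSeries.subst (MvPowerSeries.subst ![a, b] F.toPowerSeries) f =
      MvPowerSeries.subst ![PowerSeries.subst a f, PowerSeries.subst b f] G.toPowerSeries := by
  have hab := hasSubst_pair ha hb
  have h0 : PowerSeries.HasSubst (MvPowerSeries.X 0 : MvPowerSeries (Fin 2) R) := .X 0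
  have h1 : PowerSeries.HasSubst (MvPowerSeries.X 1 : MvPowerSeries (Fin 2) R) := .X 1
  have hX (i : Fin 2) (c : MvPowerSeries σ R) (hc : ![a, b] i = c) :
      MvPowerSeries.subst ![a, b] (PowerSeries.subst (MvPowerSeries.X i : MvPowerSeries (Fin 2) R) f)
        = PowerSeries.subst c f := by
    have hi : PowerSeries.HasSubst (MvPowerSeries.X i : MvPowerSeries (Fin 2) R) := .X i
    rw [PowerSeries.subst, MvPowerSeries.subst_comp_subst_apply hi.const hab, PowerSeries.subst]
    simp only [MvPowerSeries.subst_X hab, hc]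
  have h := congrArg (MvPowerSeries.subst ![a, b]) hf.map_add
  rw [PowerSeries.subst, MvPowerSeries.subst_comp_subst_apply (hasSubst_formalGroup F).const hab,
    MvPowerSeries.subst_comp_subst_apply] at h
  · refine h.trans ?_
    congr 1
    funext i
    fin_cases i
    · exact hX 0 a rfl
    · exact hX 1 b rfl
  · refine hasSubst_pair ?_ ?_
    · exact hasSubst_subst hf.hasSubst h0
    · exact hasSubst_subst hf.hasSubst h1
  · exact hab

/-- Induction on `n`: additivity of `f` turns the recursion for `[n]` over `F` into the one over
`G`. -/
lemma IsFormalIso.subst_nSeries {F G : FormalGroup R} {f : PowerSeries R}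
    (hf : IsFormalIso F G f) (n : ℕ) :
    PowerSeries.subst (nSeries F n) f = PowerSeries.subst f (nSeries G n) := by
  induction n with
  | zero =>
    rw [nSeries, nSeries]
    change PowerSeries.subst (0 : MvPowerSeries Unit R) f = _
    rw [PowerSeries.subst_zero_of_constantCoeff_zero hf.constantCoeff]
    exact (map_zero (PowerSeries.substAlgHom hf.hasSubst)).symm.trans
      (congrFun (PowerSeries.coe_substAlgHom hf.hasSubst) 0)
  | succ n ih =>
    have hX : PowerSeries.HasSubst (PowerSeries.X : PowerSeries R) := .X'
    rw [nSeries, hf.subst_add (hasSubst_nSeries F n) hX, ih, nSeries]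
    refine Eq.trans ?_ (MvPowerSeries.subst_comp_subst_apply
      (hasSubst_pair (hasSubst_nSeries G n) hX) hf.hasSubst.const G.toPowerSeries).symm
    congr 1
    funext i
    fin_cases i
    · rfl
    · change PowerSeries.subst PowerSeries.X f = PowerSeries.subst f PowerSeries.X
      rw [PowerSeries.subst_X hf.hasSubst]
      exact PowerSeries.X_subst f

lemma map_nSeries (φ : R →+* S) (F : FormalGroup R) (n : ℕ) :
    PowerSeries.map φ (nSeries F n) = nSeries (F.map φ) n := by
  induction n with
  | zero => exact map_zero _
  | succ n ih =>
    have hX : PowerSeries.HasSubst (PowerSeries.X : PowerSeries R) := .X'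
    rw [nSeries, nSeries, ← ih]
    refine (MvPowerSeries.map_subst (hasSubst_pair (hasSubst_nSeries F n) hX)
      F.toPowerSeries).trans ?_
    congr 1
    funext i
    fin_cases i
    · rfl
    · exact PowerSeries.map_X φ

lemma constantCoeff_subst_of_zero {P f : PowerSeries R} (hP : PowerSeries.constantCoeff P = 0) :
    PowerSeries.constantCoeff (PowerSeries.subst P f) = PowerSeries.constantCoeff f := by
  have hs : PowerSeries.HasSubst P := .of_constantCoeff_zero' hP
  obtain ⟨g, hg⟩ := PowerSeries.X_dvd_iff.2
    (show PowerSeries.constantCoeff (f - PowerSeries.C (PowerSeries.constantCoeff f)) = 0 by simp)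
  rw [sub_eq_iff_eq_add] at hg
  conv_lhs => rw [hg]
  rw [PowerSeries.subst_add hs, PowerSeries.subst_mul hs, PowerSeries.subst_X hs,
    PowerSeries.subst_C]
  change PowerSeries.constantCoeff (P * PowerSeries.subst P g + PowerSeries.C _) = _
  simp [hP]

/-- With `P = x^q P'`, `Q = x^q Q'` and `f = x f'`, both sides of the hypothesis are divisible by
`x^q`, and the quotients are compared at `x = 0`. This is applied to `p`-series modulo `I_t`, with
`q = p ^ t`. -/
lemma coeff_subst_leading {P Q f : PowerSeries R} {q : ℕ} (hq : q ≠ 0)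
    (hP : ∀ i < q, PowerSeries.coeff i P = 0) (hQ : ∀ i < q, PowerSeries.coeff i Q = 0)
    (hf : PowerSeries.constantCoeff f = 0)
    (h : PowerSeries.subst P f = PowerSeries.subst f Q) :
    PowerSeries.coeff q P * PowerSeries.coeff 1 f =
      PowerSeries.coeff q Q * PowerSeries.coeff 1 f ^ q := by
  obtain ⟨P', rfl⟩ := PowerSeries.X_pow_dvd_iff.2 hP
  obtain ⟨Q', rfl⟩ := PowerSeries.X_pow_dvd_iff.2 hQ
  obtain ⟨f', rfl⟩ := PowerSeries.X_dvd_iff.2 hf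
  have hP0 : PowerSeries.constantCoeff (PowerSeries.X ^ q * P') = 0 := by simp [hq]
  have hsP : PowerSeries.HasSubst (PowerSeries.X ^ q * P') := .of_constantCoeff_zero' hP0
  have hsf : PowerSeries.HasSubst (PowerSeries.X * f') := .of_constantCoeff_zero' hf
  rw [PowerSeries.subst_mul hsP, PowerSeries.subst_X hsP, PowerSeries.subst_mul hsf,
    PowerSeries.subst_pow hsf, PowerSeries.subst_X hsf, mul_pow] at h
  have h2 := congrArg (PowerSeries.coeff q) h
  rw [mul_assoc, mul_assoc] at h2
  have e (g : PowerSeries R) : PowerSeries.coeff q (PowerSeries.X ^ q * g) =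
      PowerSeries.constantCoeff g := by
    simpa using PowerSeries.coeff_X_pow_mul g q 0
  have e1 : PowerSeries.coeff 1 (PowerSeries.X * f') = PowerSeries.constantCoeff f' := by
    simp
  rw [e, e, map_mul, map_mul, constantCoeff_subst_of_zero hP0, constantCoeff_subst_of_zero hf,
    map_pow] at h2
  rw [e, e, e1, h2, mul_comm]

lemma isFormalIso_X (F : FormalGroup R) : IsFormalIso F F PowerSeries.X where
  constantCoeff := PowerSeries.constantCoeff_X
  isUnit_coeff_one := by simp
  map_add := by
    rw [PowerSeries.subst_X (hasSubst_formalGroup F), PowerSeries.subst_X (.X 0),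
      PowerSeries.subst_X (.X 1)]
    have : (![MvPowerSeries.X 0, MvPowerSeries.X 1] : Fin 2 → MvPowerSeries (Fin 2) R) =
        MvPowerSeries.X := by
      funext i
      fin_cases i <;> rfl
    rw [this, MvPowerSeries.subst_self]
    rfl

lemma coeff_one_subst {f g : PowerSeries R} (hf : PowerSeries.constantCoeff f = 0)
    (hg : PowerSeries.constantCoeff g = 0) : PowerSeries.coeff 1 (PowerSeries.subst f g) =
      PowerSeries.coeff 1 f * PowerSeries.coeff 1 g := by
  have hs : PowerSeries.HasSubst f := .of_constantCoeff_zero' hf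
  obtain ⟨g', rfl⟩ := PowerSeries.X_dvd_iff.2 hg
  rw [PowerSeries.subst_mul hs, PowerSeries.subst_X hs]
  obtain ⟨f', rfl⟩ := PowerSeries.X_dvd_iff.2 hf
  have e1 (g : PowerSeries R) : PowerSeries.coeff 1 (PowerSeries.X * g) =
      PowerSeries.constantCoeff g := by
    simp
  rw [mul_assoc, e1, e1, e1, map_mul, constantCoeff_subst_of_zero (by simp)]

lemma IsFormalIso.comp {F G K : FormalGroup R} {f g : PowerSeries R} (hf : IsFormalIso F G f)
    (hg : IsFormalIso G K g) : IsFormalIso F K (PowerSeries.subst f g) where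
  constantCoeff := (constantCoeff_subst_of_zero hf.constantCoeff).trans hg.constantCoeff
  isUnit_coeff_one := by
    rw [coeff_one_subst hf.constantCoeff hg.constantCoeff]
    exact hf.isUnit_coeff_one.mul hg.isUnit_coeff_one
  map_add := by
    have h0 : PowerSeries.HasSubst (MvPowerSeries.X 0 : MvPowerSeries (Fin 2) R) := .X 0
    have h1 : PowerSeries.HasSubst (MvPowerSeries.X 1 : MvPowerSeries (Fin 2) R) := .X 1
    rw [PowerSeries.subst_comp_subst_apply hf.hasSubst (hasSubst_formalGroup F),
      PowerSeries.subst_comp_subst_apply hf.hasSubst h0,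
      PowerSeries.subst_comp_subst_apply hf.hasSubst h1, hf.map_add]
    exact hg.subst_add (hasSubst_subst hf.hasSubst h0) (hasSubst_subst hf.hasSubst h1)

lemma IsFormalIso.map {F G : FormalGroup R} {f : PowerSeries R} (hf : IsFormalIso F G f)
    (φ : R →+* S) : IsFormalIso (F.map φ) (G.map φ) (PowerSeries.map φ f) where
  constantCoeff := by
    rw [← PowerSeries.coeff_zero_eq_constantCoeff_apply, PowerSeries.coeff_map,
      PowerSeries.coeff_zero_eq_constantCoeff_apply, hf.constantCoeff, map_zero]
  isUnit_coeff_one := by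
    rw [PowerSeries.coeff_map]
    exact hf.isUnit_coeff_one.map φ
  map_add := by
    have h0 : PowerSeries.HasSubst (MvPowerSeries.X 0 : MvPowerSeries (Fin 2) R) := .X 0
    have h1 : PowerSeries.HasSubst (MvPowerSeries.X 1 : MvPowerSeries (Fin 2) R) := .X 1
    have h := congrArg (MvPowerSeries.map φ) hf.map_add
    rw [PowerSeries.map_subst (hasSubst_formalGroup F), MvPowerSeries.map_subst
      (hasSubst_pair (hasSubst_subst hf.hasSubst h0) (hasSubst_subst hf.hasSubst h1))] at h
    refine h.trans ?_
    congr 1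
    funext i
    fin_cases i
    · exact (PowerSeries.map_subst h0 f).trans (by rw [MvPowerSeries.map_X]; rfl)
    · exact (PowerSeries.map_subst h1 f).trans (by rw [MvPowerSeries.map_X]; rfl)

end formal

/-! ### Comparison of universal deformations and of their Lubin–Tate coordinates. -/

section deformation
variable {k : Type u} [Field k] {H : FormalGroup k} {A A' A'' : Type u} [CommRing A] [CommRing A']
  [CommRing A''] {π : A →+* k} {π' : A' →+* k} {π'' : A'' →+* k}

lemma FormalGroup_map_map {R S T : Type u} [CommRing R] [CommRing S] [CommRing T]
    (F : FormalGroup R) (f : R →+* S) (g : S →+* T) : (F.map f).map g = F.map (g.comp f) := by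
  ext1
  exact MvPowerSeries.ext fun n => rfl

namespace Deformation

lemma classifies_id (D : Deformation H π) : D.Classifies D (RingHom.id A) := by
  refine ⟨RingHom.comp_id π, PowerSeries.X, ?_, ?_⟩
  · have : D.F.map (RingHom.id A) = D.F := by
      ext1
      exact MvPowerSeries.ext fun n => rfl
    rw [this]
    exact isFormalIso_X _
  · rw [PowerSeries.map_X]
    exact PowerSeries.X_subst _

lemma Classifies.comp {D : Deformation H π} {D' : Deformation H π'} {D'' : Deformation H π''}
    {φ : A →+* A'} {ψ : A' →+* A''} (h : D.Classifies D' φ) (h' : D'.Classifies D'' ψ) :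
    D.Classifies D'' (ψ.comp φ) := by
  obtain ⟨hφ, f, hf, hfg⟩ := h
  obtain ⟨hψ, g, hg, hgg⟩ := h'
  refine ⟨by rw [← RingHom.comp_assoc, hψ, hφ], PowerSeries.subst (PowerSeries.map ψ f) g, ?_, ?_⟩
  · rw [← FormalGroup_map_map]
    exact (hf.map ψ).comp hg
  · have h1 : PowerSeries.map π'' (PowerSeries.subst (PowerSeries.map ψ f) g) =
        PowerSeries.subst (PowerSeries.map π' f) (PowerSeries.map π'' g) := by
      refine (PowerSeries.map_subst (hf.map ψ).hasSubst g).trans ?_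
      congr 1
      rw [← hψ]
      exact PowerSeries.ext fun n => rfl
    rw [h1, ← hfg, ← hgg]
    exact (PowerSeries.subst_comp_subst_apply (hg.map π'').hasSubst (hf.map π').hasSubst D''.g).symm

/-- Universal deformations of the same formal group law are uniquely isomorphic. -/
lemma IsUniversal.exists_equiv {D : Deformation H π} {D' : Deformation H π'} (hD : D.IsUniversal)
    (hD' : D'.IsUniversal) : ∃ φ : A ≃+* A', D.Classifies D' φ.toRingHom ∧
      D'.Classifies D φ.symm.toRingHom := by
  obtain ⟨φ, hφ, -⟩ := hD.2 A' π' hD'.1 D'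
  obtain ⟨ψ, hψ, -⟩ := hD'.2 A π hD.1 D
  have h1 := (hD.2 A π hD.1 D).unique (hφ.comp hψ) D.classifies_id
  have h2 := (hD'.2 A' π' hD'.1 D').unique (hψ.comp hφ) D'.classifies_id
  exact ⟨RingEquiv.ofRingHom φ ψ h2 h1, hφ, hψ⟩

end Deformation

lemma flagIdeal_mono {B : Type u} [CommRing B] (u : ℕ → B) {s t : ℕ} (h : s ≤ t) :
    flagIdeal u s ≤ flagIdeal u t :=
  Ideal.span_mono (Set.image_mono (Set.Iio_subset_Iio h))

lemma mem_flagIdeal {B : Type u} [CommRing B] (u : ℕ → B) {s t : ℕ} (h : s < t) :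
    u s ∈ flagIdeal u t := Ideal.subset_span ⟨s, h, rfl⟩

/-- Maps that classify deformations respect Lubin-Tate coordinates, up to units and modulo the
preceding coordinates. -/
lemma LubinTateCoords.map_flagIdeal {p h : ℕ} [Fact p.Prime] {D : Deformation H π}
    {D' : Deformation H π'} (U : LubinTateCoords p h D) (V : LubinTateCoords p h D')
    {φ : A →+* A'} (hφ : D.Classifies D' φ) : ∀ t ≤ h,
      (flagIdeal U.u t).map φ ≤ flagIdeal V.u t ∧
        ∃ w, IsUnit w ∧ φ (U.u t) - w * V.u t ∈ flagIdeal V.u t := by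
  obtain ⟨-, f, hf, -⟩ := hφ
  intro t
  induction t using Nat.strong_induction_on with
  | _ t ih =>
  intro hth
  -- Each generator `u_s` with `s < t` goes to a multiple of `v_s` plus an element of the smaller
  -- ideal for `s`, by the induction hypothesis.
  have hI : (flagIdeal U.u t).map φ ≤ flagIdeal V.u t := by
    rw [flagIdeal, Ideal.map_span, Ideal.span_le]
    rintro _ ⟨_, ⟨s, hs, rfl⟩, rfl⟩
    have hs' : s < t := hs
    obtain ⟨-, w, -, hw⟩ := ih s hs' (by omega)
    have := (flagIdeal V.u t).add_mem (flagIdeal_mono V.u hs'.le hw)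
      ((flagIdeal V.u t).mul_mem_left w (mem_flagIdeal V.u hs'))
    simpa using this
  refine ⟨hI, ?_⟩
  rcases hth.lt_or_eq with hlt | rfl
  · have hp : p ^ t ≠ 0 := pow_ne_zero _ (Fact.out : p.Prime).ne_zero
    obtain ⟨hU1, hU2⟩ := U.pSeries t hlt
    obtain ⟨hV1, hV2⟩ := V.pSeries t hlt
    let ρ := Ideal.Quotient.mk (flagIdeal V.u t)
    have hk {a : A} (ha : a ∈ flagIdeal U.u t) : ρ (φ a) = 0 :=
      Ideal.Quotient.eq_zero_iff_mem.2 (hI (Ideal.mem_map_of_mem φ ha))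
    have hk' {a : A'} (ha : a ∈ flagIdeal V.u t) : ρ a = 0 := Ideal.Quotient.eq_zero_iff_mem.2 ha
    -- After reduction modulo `(v_0, …, v_(t-1))`, both `p`-series begin in degree `p ^ t`, with
    -- leading coefficients the classes of `φ(u_t)` and `v_t`.
    have hfρ := hf.map ρ
    have key := coeff_subst_leading hp (P := nSeries ((D.F.map φ).map ρ) p)
      (Q := nSeries (D'.F.map ρ) p) (f := PowerSeries.map ρ f)
      (fun i hi => by
        rw [← map_nSeries, ← map_nSeries, PowerSeries.coeff_map, PowerSeries.coeff_map]
        exact hk (hU1 i hi))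
      (fun i hi => by
        rw [← map_nSeries, PowerSeries.coeff_map]
        exact hk' (hV1 i hi)) hfρ.constantCoeff (hfρ.subst_nSeries p)
    rw [← map_nSeries, ← map_nSeries, ← map_nSeries, PowerSeries.coeff_map, PowerSeries.coeff_map,
      PowerSeries.coeff_map, PowerSeries.coeff_map] at key
    have e1 := hk hU2
    have e2 := hk' hV2
    rw [map_sub, map_sub, sub_eq_zero] at e1
    rw [map_sub, sub_eq_zero] at e2
    rw [e1, e2] at key
    obtain ⟨c, hc⟩ := hf.isUnit_coeff_one
    rw [← hc] at key
    -- `key` reads `φ(u_t) c = v_t c ^ (p ^ t)` with `c = f'(0)`, which dictates the unit `c ^ (p ^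
    -- t - 1)`.
    refine ⟨(c ^ (p ^ t) * c⁻¹ : A'ˣ), Units.isUnit _, Ideal.Quotient.eq_zero_iff_mem.1 ?_⟩
    change ρ _ = 0
    rw [map_sub, sub_eq_zero]
    have hcc : ρ c * ρ (c⁻¹ : A'ˣ) = 1 := by rw [← map_mul, Units.mul_inv, map_one]
    calc ρ (φ (U.u t)) = (ρ (φ (U.u t)) * ρ c) * ρ (c⁻¹ : A'ˣ) := by rw [mul_assoc, hcc, mul_one]
      _ = _ := by
        rw [key, Units.val_mul, map_mul, map_mul, Units.val_pow_eq_pow_val, map_pow]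
        ring
  -- At `t = h` both coordinates are units and their quotient serves, with no error term.
  · obtain ⟨a, ha⟩ := U.isUnit_u.map φ
    obtain ⟨b, hb⟩ := V.isUnit_u
    refine ⟨(a * b⁻¹ : A'ˣ), Units.isUnit _, ?_⟩
    rw [← ha, ← hb]
    simp

end deformation

/-! ### Maps from pro-objects to constant ones, and epimorphisms of pro-objects. -/

section proHom
variable {C : Type u} [Category.{v} C]

/-- Maps from a representable ind-object are elements of the presheaf. -/
def indHomEquiv (c : C) (X : Ind C) :
    (Ind.yoneda.obj c ⟶ X) ≃ ((Ind.inclusion C).obj X).obj (op c) :=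
  Ind.inclusion.fullyFaithful.homEquiv.trans
    (((Ind.yonedaCompInclusion.app c).homCongr (Iso.refl _)).trans yonedaEquiv)

lemma indHomEquiv_comp (c : C) {X Y : Ind C} (z : Ind.yoneda.obj c ⟶ X) (f : X ⟶ Y) :
    indHomEquiv c Y (z ≫ f) = ((Ind.inclusion C).map f).app (op c) (indHomEquiv c X z) := by
  simp [indHomEquiv, Functor.FullyFaithful.homEquiv, yonedaEquiv]

/-- Maps of ind-objects are detected on representable ind-objects. -/
lemma ind_hom_ext_of_yoneda {X Y : Ind C} {f g : X ⟶ Y}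
    (h : ∀ (c : C) (t : Ind.yoneda.obj c ⟶ X), t ≫ f = t ≫ g) : f = g := by
  apply (Ind.inclusion C).map_injective
  ext c z
  obtain ⟨t, rfl⟩ := (indHomEquiv c.unop X).surjective z
  have := congrArg (indHomEquiv c.unop Y) (h c.unop t)
  rwa [indHomEquiv_comp, indHomEquiv_comp] at this

variable (C) in
/-- Pro-objects of `C` are, contravariantly, ind-objects of the opposite category. -/
def proUnop : (Pro C)ᵒᵖ ⥤ Ind Cᵒᵖ := unopUnop (Ind Cᵒᵖ)

instance : (proUnop C).IsEquivalence :=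
  inferInstanceAs (opOpEquivalence (Ind Cᵒᵖ)).functor.IsEquivalence

/-- The presheaf of maps to a constant pro-object. -/
def proPoints (Y : C) : (Pro C)ᵒᵖ ⥤ Type v :=
  proUnop C ⋙ Ind.inclusion Cᵒᵖ ⋙ (evaluation _ _).obj (op (op Y))

/-- Filtered colimits of ind-objects are computed in presheaves, hence pointwise. In terms of
pro-objects: maps to a constant object turn cofiltered limits into filtered colimits of sets. -/
instance (Y : C) {J : Type v} [SmallCategory J] [IsFiltered J] :
    PreservesColimitsOfShape J (proPoints Y) := by
  have : PreservesColimitsOfShape J (Ind.inclusion Cᵒᵖ) := inferInstance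
  have : PreservesColimitsOfShape J ((evaluation Cᵒᵖᵒᵖ (Type v)).obj (op (op Y))) := inferInstance
  have : PreservesColimitsOfShape J (proUnop C) := inferInstance
  exact inferInstanceAs (PreservesColimitsOfShape J
    (proUnop C ⋙ Ind.inclusion Cᵒᵖ ⋙ (evaluation Cᵒᵖᵒᵖ (Type v)).obj (op (op Y))))

/-- Maps from a pro-object to a constant one are elements of the associated presheaf. -/
def proHomEquiv (X : Pro C) (Y : C) :
    (X ⟶ (Pro.const C).obj Y) ≃ (proPoints Y).obj (op X) :=
  (opEquiv (C := Ind Cᵒᵖ) X ((Pro.const C).obj Y)).trans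
    (indHomEquiv (op Y) ((proUnop C).obj (op X)))

lemma proHomEquiv_comp {X X' : Pro C} {Y : C} (f : X ⟶ X') (g : X' ⟶ (Pro.const C).obj Y) :
    proHomEquiv X Y (f ≫ g) = (proPoints Y).map f.op (proHomEquiv X' Y g) :=
  indHomEquiv_comp (op Y) _ _

section cone
variable {Q : (Idx.{v})ᵒᵖ ⥤ Pro C} {c : Cone Q} (hc : IsLimit c)
include hc

/-- An element of a filtered colimit of sets comes from one of its terms. The factor `g` is only a
map of objects, even when `f` is a ring map. -/
lemma pro_exists_factor {Y : C} (f : c.pt ⟶ (Pro.const C).obj Y) :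
    ∃ k g, f = c.π.app k ≫ g := by
  obtain ⟨j, y, hy⟩ := Types.jointly_surjective _ (isColimitOfPreserves (proPoints Y) hc.op)
    (proHomEquiv _ Y f)
  obtain ⟨g, rfl⟩ := (proHomEquiv (Q.obj j.unop) Y).surjective y
  refine ⟨j.unop, g, (proHomEquiv _ Y).injective ?_⟩
  rw [proHomEquiv_comp]
  exact hy.symm

lemma pro_exists_eq {Y : C} {k : (Idx.{v})ᵒᵖ} {g g' : Q.obj k ⟶ (Pro.const C).obj Y}
    (h : c.π.app k ≫ g = c.π.app k ≫ g') : ∃ (l : (Idx.{v})ᵒᵖ) (f : l ⟶ k),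
      Q.map f ≫ g = Q.map f ≫ g' := by
  have h1 := congrArg (proHomEquiv _ Y) h
  rw [proHomEquiv_comp, proHomEquiv_comp] at h1
  obtain ⟨l, f, f', hf⟩ := (Types.FilteredColimit.isColimit_eq_iff (Q.op ⋙ proPoints Y)
    (isColimitOfPreserves (proPoints Y) hc.op) (i := op k) (j := op k)).1 h1
  -- The index category is an ordered set, so the two arrows that witness equality in the colimit
  -- coincide.
  obtain rfl : f' = f := Quiver.Hom.unop_inj (Subsingleton.elim _ _)
  refine ⟨l.unop, f'.unop, (proHomEquiv _ Y).injective ?_⟩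
  rw [proHomEquiv_comp, proHomEquiv_comp]
  exact hf

lemma pro_exists_factor_pair {Y : C} (f f' : c.pt ⟶ (Pro.const C).obj Y) :
    ∃ k g g', f = c.π.app k ≫ g ∧ f' = c.π.app k ≫ g' := by
  obtain ⟨k, g, rfl⟩ := pro_exists_factor hc f
  obtain ⟨k', g', rfl⟩ := pro_exists_factor hc f'
  let a := IsCofiltered.minToLeft k k'
  let b := IsCofiltered.minToRight k k'
  exact ⟨_, Q.map a ≫ g, Q.map b ≫ g', by rw [← Category.assoc, c.w],
    by rw [← Category.assoc, c.w]⟩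

end cone

/-- Constant pro-objects cogenerate; this is dual to the detection of maps of ind-objects on
representable ones. -/
lemma pro_hom_ext {X Z : Pro C} {f g : X ⟶ Z}
    (h : ∀ (Y : C) (t : Z ⟶ (Pro.const C).obj Y), f ≫ t = g ≫ t) : f = g :=
  Quiver.Hom.unop_inj (C := Ind Cᵒᵖ) (ind_hom_ext_of_yoneda fun Y t =>
    congrArg Quiver.Hom.unop (h Y.unop (Quiver.Hom.op (V := Ind Cᵒᵖ) t)))

/-- Tested against constant objects, two maps that agree on the limit agree already on some term `l`
over `k`, and the transition map from `l` to `k` can be cancelled. -/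
lemma pro_epi_proj {Q : (Idx.{v})ᵒᵖ ⥤ Pro C} {c : Cone Q} (hc : IsLimit c)
    (hQ : ∀ ⦃k l⦄ (f : k ⟶ l), Epi (Q.map f)) (k : (Idx.{v})ᵒᵖ) : Epi (c.π.app k) :=
  ⟨fun g g' h => pro_hom_ext fun Y t => by
    obtain ⟨l, f, hf⟩ := pro_exists_eq hc (g := g ≫ t) (g' := g' ≫ t)
      (by rw [← Category.assoc, h, Category.assoc])
    have := hQ f
    exact (cancel_epi _).1 hf⟩

/-- Maps from the target limit to a constant object factor through a term `k`. If they agree after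
`F`, then they agree after restriction to some term `l` of the source; naturality of `α` moves the
transition map past `α.app l`, which is cancelled. -/
lemma pro_epi_limMap {Q Q' : (Idx.{v})ᵒᵖ ⥤ Pro C} {c : Cone Q} (hc : IsLimit c) {c' : Cone Q'}
    (hc' : IsLimit c') (α : Q ⟶ Q') (hα : ∀ k, Epi (α.app k)) (F : c.pt ⟶ c'.pt)
    (hF : ∀ k, F ≫ c'.π.app k = c.π.app k ≫ α.app k) : Epi F :=
  ⟨fun g g' h => pro_hom_ext fun Y t => by
    obtain ⟨k, s, s', hs, hs'⟩ := pro_exists_factor_pair hc' (g ≫ t) (g' ≫ t)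
    have h1 : c.π.app k ≫ α.app k ≫ s = c.π.app k ≫ α.app k ≫ s' := by
      rw [← Category.assoc, ← Category.assoc, ← hF, Category.assoc, Category.assoc, ← hs, ← hs',
        ← Category.assoc, h, Category.assoc]
    obtain ⟨l, f, hf⟩ := pro_exists_eq hc h1
    rw [← Category.assoc, ← Category.assoc, α.naturality, Category.assoc, Category.assoc] at hf
    have := hα l
    have h2 := (cancel_epi _).1 hf
    rw [hs, hs', ← c'.w f, Category.assoc, Category.assoc, h2]⟩

instance : (Pro.const C).Full :=
  inferInstanceAs (opOp C ⋙ (Ind.yoneda (C := Cᵒᵖ)).op).Full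

instance : (Pro.const C).Faithful :=
  inferInstanceAs (opOp C ⋙ (Ind.yoneda (C := Cᵒᵖ)).op).Faithful

instance : (Ind.yoneda (C := C)).PreservesEpimorphisms where
  preserves _ _ := inferInstance

instance : (Pro.const C).PreservesEpimorphisms where
  preserves f hf := by
    have : Mono f.op := inferInstance
    have : Mono ((Ind.yoneda (C := Cᵒᵖ)).map f.op) := inferInstance
    exact inferInstanceAs (Epi ((Ind.yoneda (C := Cᵒᵖ)).map f.op).op)

end proHom

/-! ### Epimorphisms and the universal property of localization. -/

section locEpi
variable {C : Type u} [Category.{v} C] [CartesianMonoidalCategory C] [BraidedCategory C]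

lemma locObj_hom_ext (R : CommRingObjCat C) (x : 𝟙_ C ⟶ R.X) {Z : Ind C} {f g : locObj R x ⟶ Z}
    (h : ∀ j, locι R x j ≫ f = locι R x j ≫ g) : f = g :=
  colimit.hom_ext (F := mulTower R x ⋙ Ind.yoneda) fun j => h j.down

/-- The structure maps of the colimit detect maps out of it, and at each level of the multiplication
tower the map is the epimorphism `f`. -/
lemma locObjMap_epi {R S : CommRingObjCat C} (f : R ⟶ S) {x : 𝟙_ C ⟶ R.X} {y : 𝟙_ C ⟶ S.X}
    (h : x ≫ f.hom = y) [Epi f.hom] : Epi (locObjMap f h) :=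
  ⟨fun g g' hg => locObj_hom_ext S y fun j => by
    rw [← cancel_epi (Ind.yoneda.map f.hom), ← Category.assoc, ← Category.assoc, ← locι_map f h,
      Category.assoc, Category.assoc, hg]⟩

/-- The points of `x⁻¹R` with values in an object `c` of `C`, as a ring. -/
def locPtEquiv (R : CommRingObjCat C) (x : 𝟙_ C ⟶ R.X) (c : C) :
    (Ind.yoneda.obj c ⟶ (locRing R x).X) ≃+* Localization.Away (constPt x c) :=
  RingEquiv.ofBijective (show (Ind.yoneda.obj c ⟶ (locRing R x).X) →+*
      Localization.Away (constPt x c) from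
    { toFun := locPt R x
      map_one' := locPt_one R x c
      map_mul' := locPt_mul R x
      map_zero' := by
        have := locPt_add R x (c := c) 0 0
        rwa [add_zero, left_eq_add] at this
      map_add' := locPt_add R x })
    ⟨locPt_injective R x, fun z => by
      obtain ⟨j, a, rfl⟩ := locMk_surjective R x c z
      exact ⟨Ind.yoneda.map a ≫ locι R x j, locPt_ι R x a j⟩⟩

lemma locPtEquiv_toLoc (R : CommRingObjCat C) (x : 𝟙_ C ⟶ R.X) {c : C} (a : c ⟶ R.X) :
    locPtEquiv R x c (mapPt Ind.yoneda R c a ≫ (toLoc R x).hom) = algebraMap _ _ a :=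
  locPt_mapPt R x a

lemma isUnit_mapPt_toLoc (R : CommRingObjCat C) (x : 𝟙_ C ⟶ R.X) (c : C) :
    IsUnit (mapPt Ind.yoneda R c (constPt x c) ≫ (toLoc R x).hom) := by
  rw [← MulEquiv.isUnit_map (locPtEquiv R x c), locPtEquiv_toLoc]
  exact IsLocalization.Away.algebraMap_isUnit _

/-- Ring maps out of `x⁻¹R` are determined by their restrictions to `R`. -/
lemma locRing_hom_ext (R : CommRingObjCat C) (x : 𝟙_ C ⟶ R.X) {Z : CommRingObjCat (Ind C)}
    {f g : locRing R x ⟶ Z} (h : toLoc R x ≫ f = toLoc R x ≫ g) : f = g := by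
  refine CommRingObjCat.hom_ext (ind_hom_ext_of_yoneda fun c t => ?_)
  -- On points valued in `c`, both maps become ring homomorphisms out of `R(c)[1/x]`, which are
  -- determined by `R(c)`.
  have key : ((postcomp f (Ind.yoneda.obj c)).comp (locPtEquiv R x c).symm.toRingHom) =
      ((postcomp g (Ind.yoneda.obj c)).comp (locPtEquiv R x c).symm.toRingHom) := by
    refine IsLocalization.ringHom_ext (Submonoid.powers (constPt x c)) (RingHom.ext fun a => ?_)
    have e : (locPtEquiv R x c).symm (algebraMap _ _ a) =
        mapPt Ind.yoneda R c a ≫ (toLoc R x).hom := by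
      rw [RingEquiv.symm_apply_eq, locPtEquiv_toLoc]
    have h' : (toLoc R x).hom ≫ f.hom = (toLoc R x).hom ≫ g.hom :=
      congrArg CommRingObjCat.Hom.hom h
    change (locPtEquiv R x c).symm (algebraMap _ _ a) ≫ f.hom =
      (locPtEquiv R x c).symm (algebraMap _ _ a) ≫ g.hom
    rw [e, Category.assoc, Category.assoc, h']
  have := RingHom.congr_fun key (locPtEquiv R x c t)
  simpa using this

section lift
variable {R S : CommRingObjCat C} (f : R ⟶ S) (x : 𝟙_ C ⟶ R.X) (y : 𝟙_ C ⟶ S.X)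
  (hf : IsUnit (algebraMap (𝟙_ C ⟶ S.X) (Localization.Away (constPt y (𝟙_ C))) (x ≫ f.hom)))

include hf in
-- Invertibility on global points restricts along the map from `c` to the terminal object.
lemma isUnit_loc_constPt (c : C) : IsUnit (algebraMap (c ⟶ S.X) (Localization.Away (constPt y c))
    (constPt (x ≫ f.hom) c)) := by
  have h := hf.map (locRestrict S y (toUnit c))
  rw [locRestrict, IsLocalization.map_eq] at h
  exact h

/-- The map `R(c)[1/x] → S(c)[1/y]` when `x` is invertible in `S[1/y]`. -/
def locLiftPt (c : C) : Localization.Away (constPt x c) →+* Localization.Away (constPt y c) :=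
  IsLocalization.Away.lift (constPt x c) (g := (algebraMap _ _).comp (postcomp f c)) (by
    have := isUnit_loc_constPt f x y hf c
    simpa using this)

lemma locLiftPt_algebraMap (c : C) (a : c ⟶ R.X) :
    locLiftPt f x y hf c (algebraMap _ _ a) = algebraMap _ _ (a ≫ f.hom) :=
  IsLocalization.Away.lift_eq _ _ _

lemma locLiftPt_restrict {c d : C} (g : c ⟶ d) (z : Localization.Away (constPt x d)) :
    locLiftPt f x y hf c (locRestrict R x g z) = locRestrict S y g (locLiftPt f x y hf d z) := by
  refine RingHom.congr_fun (f := (locLiftPt f x y hf c).comp (locRestrict R x g))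
    (g := (locRestrict S y g).comp (locLiftPt f x y hf d)) ?_ z
  refine IsLocalization.ringHom_ext (Submonoid.powers (constPt x d)) (RingHom.ext fun a => ?_)
  simp only [RingHom.comp_apply, locRestrict, IsLocalization.map_eq, locLiftPt_algebraMap,
    precomp_apply, Category.assoc]

/-- The map `x⁻¹R ⟶ y⁻¹S` of underlying ind-objects, when `x` is invertible in `y⁻¹S`. -/
def locLiftObj : locObj R x ⟶ locObj S y :=
  (Ind.inclusion C).preimage ((locIso R x).hom ≫
    { app := fun c => ↾fun z => locLiftPt f x y hf c.unop z
      naturality := fun c d g => by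
        ext z
        exact locLiftPt_restrict f x y hf g.unop z } ≫ (locIso S y).inv)

lemma locPt_locLiftObj {c : C} (z : Ind.yoneda.obj c ⟶ locObj R x) :
    locPt S y (z ≫ locLiftObj f x y hf) = locLiftPt f x y hf c (locPt R x z) := by
  unfold locPt
  rw [Functor.map_comp, locLiftObj, Functor.map_preimage]
  simp only [Category.assoc, Iso.inv_hom_id, Category.comp_id]
  rfl

/-- The universal property of localization: the map `x⁻¹R ⟶ y⁻¹S` induced by `f : R ⟶ S` if `f(x)`
is invertible in `y⁻¹S`. -/
def locLift : locRing R x ⟶ locRing S y where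
  hom := locLiftObj f x y hf
  isRingHom := isRingHom_ind _
    (fun c => locPt_injective S _ (by
      refine (locPt_locLiftObj f x y hf _).trans ?_
      rw [locPt_one, locPt_one, map_one]))
    (fun c a b => locPt_injective S _ (by
      refine (locPt_locLiftObj f x y hf _).trans ?_
      rw [locPt_add, locPt_add, map_add]
      exact congrArg₂ _ (locPt_locLiftObj f x y hf _).symm (locPt_locLiftObj f x y hf _).symm))
    (fun c a b => locPt_injective S _ (by
      refine (locPt_locLiftObj f x y hf _).trans ?_
      rw [locPt_mul, locPt_mul, map_mul]
      exact congrArg₂ _ (locPt_locLiftObj f x y hf _).symm (locPt_locLiftObj f x y hf _).symm))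

lemma toLoc_locLift : toLoc R x ≫ locLift f x y hf = (mapRing Ind.yoneda).map f ≫ toLoc S y := by
  refine CommRingObjCat.hom_ext (ind_hom_ext_of_yoneda fun c t => ?_)
  obtain ⟨a, rfl⟩ := mapPt_yoneda_surjective R t
  apply locPt_injective S y
  refine (congrArg (locPt S y) (Category.assoc (mapPt Ind.yoneda R c a) (locι R x 0)
    (locLiftObj f x y hf)).symm).trans ?_
  rw [locPt_locLiftObj, locPt_mapPt, locLiftPt_algebraMap]
  refine Eq.trans (locPt_mapPt S y (a ≫ f.hom)).symm ?_
  congr 1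
  change Ind.yoneda.map (a ≫ f.hom) ≫ _ = Ind.yoneda.map a ≫ Ind.yoneda.map f.hom ≫ _
  rw [Functor.map_comp, Category.assoc]
  rfl

end lift
end locEpi

/-! ### The transition maps in the towers are epimorphisms. -/

section epi
variable {A : Type w} [CommRing A]
variable {C : Type u} [Category.{v} C] [CartesianMonoidalCategory C]

lemma algLimProj_epi (Q : (Idx.{v})ᵒᵖ ⥤ AlgObj A (Pro C))
    (hQ : ∀ ⦃k l⦄ (f : k ⟶ l), Epi (Q.map f).hom.hom) (k : (Idx.{v})ᵒᵖ) :
    Epi (AlgObj.algLimProj Q k).hom :=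
  pro_epi_proj (limit.isLimit
    ((Q ⋙ AlgObj.forgetRing A (Pro C)) ⋙ CommRingObjCat.forget (Pro C))) hQ k

lemma limMap_epi {Q Q' : (Idx.{v})ᵒᵖ ⥤ AlgObj A (Pro C)} (f : Q ⟶ Q')
    (hf : ∀ k, Epi (f.app k).hom.hom) : Epi (AlgObj.limMap f).hom :=
  pro_epi_limMap
    (limit.isLimit ((Q ⋙ AlgObj.forgetRing A (Pro C)) ⋙ CommRingObjCat.forget (Pro C)))
    (limit.isLimit ((Q' ⋙ AlgObj.forgetRing A (Pro C)) ⋙ CommRingObjCat.forget (Pro C)))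
    (Functor.whiskerRight f (AlgObj.forgetRing A (Pro C) ⋙ CommRingObjCat.forget (Pro C)))
    hf _ fun k => congrArg CommRingObjCat.Hom.hom (AlgObj.limMap_proj f k)

end epi

section epi
variable {A : Type u} [CommRing A]
variable {C : Type (u + 1)} [Category.{u} C] [CartesianMonoidalCategory C] [BraidedCategory C]

/-- The maps between the quotients of a ring object are epimorphisms of underlying objects. -/
def EpiSys {P : Type*} [Category P] (G : P ⥤ AlgObj A C) : Prop :=
  ∀ ⦃J J' : P⦄ (f : J ⟶ J'), Epi (G.map f).hom.hom

lemma EpiSys.loc {P : Type*} [Category P] {G : P ⥤ AlgObj A C} (hG : EpiSys G) (a : A) :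
    EpiSys (G ⋙ AlgObj.loc a) := fun J J' f => by
  have := hG f
  exact locObjMap_epi (G.map f).hom ((G.map f).str_comp a)

lemma EpiSys.const {P : Type*} [Category P] {G : P ⥤ AlgObj A C} (hG : EpiSys G) :
    EpiSys (G ⋙ AlgObj.mapAlg A (Pro.const C)) := fun J J' f => by
  have := hG f
  exact inferInstanceAs (Epi ((Pro.const C).map (G.map f).hom.hom))

lemma EpiSys.lim {P P' : Type*} [Category P] [Category P'] {G : P ⥤ AlgObj A (Pro C)}
    (hG : EpiSys G) (S : P' ⥤ (Idx.{u})ᵒᵖ ⥤ P) :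
    EpiSys (S ⋙ (Functor.whiskeringRight _ _ _).obj G ⋙ AlgObj.lim) := fun _ _ f =>
  limMap_epi (((Functor.whiskeringRight _ _ _).obj G).map (S.map f))
    fun k => hG ((S.map f).app k)

lemma epiSys_quotFunctor : EpiSys (quotFunctor A) := fun _ _ f => by
  refine ConcreteCategory.epi_of_surjective _ ?_
  exact Ideal.Quotient.factor_surjective (leOfHom f)

lemma EpiSys.locComplete {G : Ideal A ⥤ AlgObj A C} (hG : EpiSys G) (a : A) (I : Ideal A) :
    EpiSys (locComplete a I G) :=
  (hG.loc a).const.lim (adicSys I)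

/-- The quotient maps at the bottom are surjective, and localization, constant pro-objects and
limits of pro-objects preserve the property. It makes the projections of the completed localizations
epimorphisms, as the uniqueness argument requires. -/
lemma epiSys_tower (u : ℕ → A) (h : ℕ) (ht : ℕ → ℕ)
    (hfin : ∀ m, Finite (A ⧸ flagIdeal u h ^ m)) (n : ℕ) : EpiSys (tower u h ht hfin n) := by
  induction n with
  | zero => exact (epiSys_quotFunctor (A := A)).const.lim (adicSysFin _ hfin)
  | succ n ih => exact ih.locComplete _ _

end epi

/-! ### Maps of towers along a homomorphism of base rings. -/

section laxMap
variable {A A' : Type u} [CommRing A] [CommRing A']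

section
variable {C : Type w} [Category.{v} C] [CartesianMonoidalCategory C] [BraidedCategory C]

/-- Ring maps out of a localization are determined on the original ring, where both composites
reduce to `h`. -/
lemma locMap_locLift {R₁ R₂ S₁ S₂ : CommRingObjCat C} (f : R₁ ⟶ R₂) {x₁ : 𝟙_ C ⟶ R₁.X}
    {x₂ : 𝟙_ C ⟶ R₂.X} (hx : x₁ ≫ f.hom = x₂) (g : S₁ ⟶ S₂) {y₁ : 𝟙_ C ⟶ S₁.X}
    {y₂ : 𝟙_ C ⟶ S₂.X} (hy : y₁ ≫ g.hom = y₂) (l₁ : R₁ ⟶ S₁) (l₂ : R₂ ⟶ S₂)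
    (h₁ : IsUnit (algebraMap (𝟙_ C ⟶ S₁.X) (Localization.Away (constPt y₁ (𝟙_ C))) (x₁ ≫ l₁.hom)))
    (h₂ : IsUnit (algebraMap (𝟙_ C ⟶ S₂.X) (Localization.Away (constPt y₂ (𝟙_ C))) (x₂ ≫ l₂.hom)))
    (h : f ≫ l₂ = l₁ ≫ g) :
    locMap f hx ≫ locLift l₂ x₂ y₂ h₂ = locLift l₁ x₁ y₁ h₁ ≫ locMap g hy := by
  have e1 : toLoc R₁ x₁ ≫ locMap f hx = (mapRing Ind.yoneda).map f ≫ toLoc R₂ x₂ :=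
    CommRingObjCat.hom_ext (locι_map f hx 0)
  have e2 : toLoc S₁ y₁ ≫ locMap g hy = (mapRing Ind.yoneda).map g ≫ toLoc S₂ y₂ :=
    CommRingObjCat.hom_ext (locι_map g hy 0)
  refine locRing_hom_ext _ _ ?_
  rw [← Category.assoc, e1, Category.assoc, toLoc_locLift, ← Category.assoc, ← Category.assoc,
    toLoc_locLift, Category.assoc, Category.assoc, e2, ← Category.assoc, ← Category.assoc,
    ← Functor.map_comp, ← Functor.map_comp, h]

variable {K : Type v} [SmallCategory K] [HasLimitsOfShape K C]

/-- The map of limits induced by a natural family of maps of ring objects. -/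
def limMapAlong (Q : K ⥤ AlgObj A C) (Q' : K ⥤ AlgObj A' C)
    (s : ∀ k, (Q.obj k).R ⟶ (Q'.obj k).R)
    (hs : ∀ ⦃k l⦄ (f : k ⟶ l), (Q.map f).hom ≫ s l = s k ≫ (Q'.map f).hom) :
    AlgObj.algLimRing Q ⟶ AlgObj.algLimRing Q' :=
  AlgObj.algLimLift Q' (fun k => AlgObj.algLimProj Q k ≫ s k) fun k l f => by
    rw [Category.assoc, ← hs, ← Category.assoc, AlgObj.algLimProj_w]

lemma limMapAlong_proj (Q : K ⥤ AlgObj A C) (Q' : K ⥤ AlgObj A' C)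
    (s : ∀ k, (Q.obj k).R ⟶ (Q'.obj k).R)
    (hs : ∀ ⦃k l⦄ (f : k ⟶ l), (Q.map f).hom ≫ s l = s k ≫ (Q'.map f).hom) (k : K) :
    limMapAlong Q Q' s hs ≫ AlgObj.algLimProj Q' k = AlgObj.algLimProj Q k ≫ s k :=
  AlgObj.algLimLift_proj _ _ _ _

lemma limMapAlong_str (Q : K ⥤ AlgObj A C) (Q' : K ⥤ AlgObj A' C)
    (s : ∀ k, (Q.obj k).R ⟶ (Q'.obj k).R)
    (hs : ∀ ⦃k l⦄ (f : k ⟶ l), (Q.map f).hom ≫ s l = s k ≫ (Q'.map f).hom) {a : A} {a' : A'}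
    (h : ∀ k, (Q.obj k).str a ≫ (s k).hom = (Q'.obj k).str a') :
    AlgObj.limStr Q a ≫ (limMapAlong Q Q' s hs).hom = AlgObj.limStr Q' a' :=
  AlgObj.algLim_hom_ext Q' fun k => by
    have h1 : (limMapAlong Q Q' s hs).hom ≫ (AlgObj.algLimProj Q' k).hom =
      (AlgObj.algLimProj Q k).hom ≫ (s k).hom :=
      congrArg CommRingObjCat.Hom.hom (limMapAlong_proj Q Q' s hs k)
    change (AlgObj.limStrFun Q a ≫ _) ≫ _ = AlgObj.limStrFun Q' a' ≫ _
    rw [Category.assoc, h1, AlgObj.limStrFun_proj, ← Category.assoc, AlgObj.limStrFun_proj, h]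

lemma limMap_limMapAlong {Q₁ Q₂ : K ⥤ AlgObj A C} {Q₁' Q₂' : K ⥤ AlgObj A' C} (f : Q₁ ⟶ Q₂)
    (f' : Q₁' ⟶ Q₂') (s₁ : ∀ k, (Q₁.obj k).R ⟶ (Q₁'.obj k).R)
    (s₂ : ∀ k, (Q₂.obj k).R ⟶ (Q₂'.obj k).R)
    (h₁ : ∀ ⦃k l⦄ (f : k ⟶ l), (Q₁.map f).hom ≫ s₁ l = s₁ k ≫ (Q₁'.map f).hom)
    (h₂ : ∀ ⦃k l⦄ (f : k ⟶ l), (Q₂.map f).hom ≫ s₂ l = s₂ k ≫ (Q₂'.map f).hom)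
    (h : ∀ k, (f.app k).hom ≫ s₂ k = s₁ k ≫ (f'.app k).hom) :
    AlgObj.limMap f ≫ limMapAlong Q₂ Q₂' s₂ h₂ = limMapAlong Q₁ Q₁' s₁ h₁ ≫ AlgObj.limMap f' :=
  AlgObj.algLim_ring_hom_ext Q₂' fun k => by
    rw [Category.assoc, limMapAlong_proj, ← Category.assoc, AlgObj.limMap_proj, Category.assoc, h,
      Category.assoc, AlgObj.limMap_proj, ← Category.assoc, ← Category.assoc, limMapAlong_proj]

end

/-- A map from a system of `A`-algebra objects to a system of `A'`-algebra objects, along a ring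
homomorphism `φ : A → A'` and a relation between the indices. -/
structure LaxMap {E : Type w} [Category.{v} E] [CartesianMonoidalCategory E] [BraidedCategory E]
    {P P' : Type u} [Category.{u} P] [Category.{u} P'] (r : P → P' → Prop) (φ : A →+* A')
    (G : P ⥤ AlgObj A E) (G' : P' ⥤ AlgObj A' E) where
  hom : ∀ {J J'}, r J J' → ((G.obj J).R ⟶ (G'.obj J').R)
  str_hom : ∀ {J J'} (h : r J J') (a : A), (G.obj J).str a ≫ (hom h).hom = (G'.obj J').str (φ a)
  -- The two arrows are chosen independently, because `J'` is only related to `J` and not a function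
  -- of it.
  naturality : ∀ {J J' K K'} (h : r J J') (h' : r K K') (f : J ⟶ K) (f' : J' ⟶ K'),
    (G.map f).hom ≫ hom h' = hom h ≫ (G'.map f').hom

namespace LaxMap
variable {E : Type w} [Category.{v} E] [CartesianMonoidalCategory E] [BraidedCategory E]
  {P P' : Type u} [Category.{u} P] [Category.{u} P'] {r : P → P' → Prop} {φ : A →+* A'}
  {G : P ⥤ AlgObj A E} {G' : P' ⥤ AlgObj A' E}

/-- Restriction to a stronger relation. -/
def restrict (L : LaxMap r φ G G') {s : P → P' → Prop} (hs : ∀ {J J'}, s J J' → r J J') :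
    LaxMap s φ G G' where
  hom h := L.hom (hs h)
  str_hom h := L.str_hom (hs h)
  naturality h h' := L.naturality (hs h) (hs h')

/-- The image under a functor that preserves finite products. -/
def mapAlg (L : LaxMap r φ G G') {D : Type*} [Category.{v} D] [CartesianMonoidalCategory D]
    [BraidedCategory D] (T : E ⥤ D) [PreservesFiniteProducts T] :
    LaxMap r φ (G ⋙ AlgObj.mapAlg A T) (G' ⋙ AlgObj.mapAlg A' T) where
  hom h := (mapRing T).map (L.hom h)
  str_hom {J J'} h a := by
    let : T.Braided := .ofChosenFiniteProducts T
    change (Functor.LaxMonoidal.ε T ≫ T.map ((G.obj J).str a)) ≫ T.map (L.hom h).hom =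
      Functor.LaxMonoidal.ε T ≫ T.map ((G'.obj J').str (φ a))
    rw [Category.assoc, ← T.map_comp, L.str_hom]
  naturality h h' f f' :=
    ((mapRing T).map_comp _ _).symm.trans ((congrArg ((mapRing T).map ·)
      (L.naturality h h' f f')).trans ((mapRing T).map_comp _ _))

/-- Localization, at elements of `A` and `A'` that agree up to units. -/
def loc (L : LaxMap r φ G G') (a : A) (a' : A')
    (H : ∀ {J J'}, r J J' → IsUnit (algebraMap (𝟙_ E ⟶ (G'.obj J').R.X)
      (Localization.Away (constPt ((G'.obj J').str a') (𝟙_ E))) ((G'.obj J').str (φ a)))) :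
    LaxMap r φ (G ⋙ AlgObj.loc a) (G' ⋙ AlgObj.loc a') where
  hom {J J'} h := locLift (L.hom h) _ _ (by
    rw [L.str_hom]
    exact H h)
  str_hom {J J'} h b := by
    have h1 := congrArg CommRingObjCat.Hom.hom (toLoc_locLift (L.hom h) ((G.obj J).str a)
      ((G'.obj J').str a') (by
        rw [L.str_hom]
        exact H h))
    have h2 := (L.mapAlg Ind.yoneda).str_hom h b
    refine (Category.assoc _ _ _).trans ((congrArg (AlgObj.mapStr Ind.yoneda (G.obj J) b ≫ ·)
      h1).trans ((Category.assoc _ _ _).symm.trans ?_))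
    exact congrArg (· ≫ (toLoc (G'.obj J').R ((G'.obj J').str a')).hom) h2
  naturality h h' f f' := locMap_locLift (G.map f).hom ((G.map f).str_comp a) (G'.map f').hom
    ((G'.map f').str_comp a') _ _ _ _ (L.naturality h h' f f')

/-- Limits along systems of indices. -/
def lim (L : LaxMap r φ G G') {K : Type v} [SmallCategory K] [HasLimitsOfShape K E]
    {O O' : Type u} [Category.{u} O] [Category.{u} O'] {s : O → O' → Prop}
    (S : O ⥤ K ⥤ P) (S' : O' ⥤ K ⥤ P')
    (hs : ∀ {J J'}, s J J' → ∀ k, r ((S.obj J).obj k) ((S'.obj J').obj k)) :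
    LaxMap s φ (S ⋙ (Functor.whiskeringRight _ _ _).obj G ⋙ AlgObj.lim)
      (S' ⋙ (Functor.whiskeringRight _ _ _).obj G' ⋙ AlgObj.lim) where
  hom {J J'} h := limMapAlong (S.obj J ⋙ G) (S'.obj J' ⋙ G') (fun k => L.hom (hs h k))
    (fun k l f => L.naturality (hs h k) (hs h l) ((S.obj J).map f) ((S'.obj J').map f))
  str_hom {J J'} h a := limMapAlong_str (S.obj J ⋙ G) (S'.obj J' ⋙ G') (fun k => L.hom (hs h k))
    _ fun k => L.str_hom (hs h k) a
  naturality h h' f f' := limMap_limMapAlong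
    (((Functor.whiskeringRight _ _ _).obj G).map (S.map f))
    (((Functor.whiskeringRight _ _ _).obj G').map (S'.map f'))
    (fun k => L.hom (hs h k)) (fun k => L.hom (hs h' k)) _ _
    fun k => L.naturality (hs h k) (hs h' k) ((S.map f).app k) ((S'.map f').app k)

lemma lim_proj (L : LaxMap r φ G G') {K : Type v} [SmallCategory K] [HasLimitsOfShape K E]
    {O O' : Type u} [Category.{u} O] [Category.{u} O'] {s : O → O' → Prop}
    (S : O ⥤ K ⥤ P) (S' : O' ⥤ K ⥤ P')
    (hs : ∀ {J J'}, s J J' → ∀ k, r ((S.obj J).obj k) ((S'.obj J').obj k)) {J : O} {J' : O'}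
    (h : s J J') (k : K) :
    (L.lim S S' hs).hom h ≫ AlgObj.algLimProj (S'.obj J' ⋙ G') k =
      AlgObj.algLimProj (S.obj J ⋙ G) k ≫ L.hom (hs h k) :=
  limMapAlong_proj (S.obj J ⋙ G) (S'.obj J' ⋙ G') (fun k => L.hom (hs h k))
    (fun k l f => L.naturality (hs h k) (hs h l) ((S.obj J).map f) ((S'.obj J').map f)) k

end LaxMap
end laxMap

/-! ### Elements of `J` vanish in the quotients by `J`. -/

section kills
variable {A : Type u} [CommRing A]

/-- The elements of `J` vanish in `G(J)`. -/
def KillsSys {E : Type w} [Category.{v} E] [CartesianMonoidalCategory E] [BraidedCategory E]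
    (G : Ideal A ⥤ AlgObj A E) : Prop :=
  ∀ (J : Ideal A), ∀ a ∈ J, (G.obj J).str a = 0

lemma limStr_eq_zero {E : Type w} [Category.{v} E] [CartesianMonoidalCategory E]
    [BraidedCategory E] {K : Type v} [SmallCategory K] [HasLimitsOfShape K E] (Q : K ⥤ AlgObj A E)
    {a : A} (h : ∀ k, (Q.obj k).str a = 0) : AlgObj.limStr Q a = 0 :=
  AlgObj.algLim_hom_ext Q fun k => by
    refine (AlgObj.limStrFun_proj Q a k).trans ((h k).trans ?_)
    exact (map_zero (postcomp (AlgObj.algLimProj Q k) _)).symm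

variable {C : Type (u + 1)} [Category.{u} C] [CartesianMonoidalCategory C] [BraidedCategory C]

lemma mapStr_eq_zero {D : Type*} [Category.{u} D] [CartesianMonoidalCategory D]
    [BraidedCategory D] (T : C ⥤ D) [PreservesFiniteProducts T] (P : AlgObj A C) {a : A}
    (h : P.str a = 0) : AlgObj.mapStr T P a = 0 := by
  rw [AlgObj.mapStr, RingHom.comp_apply, h, map_zero]

lemma KillsSys.locComplete {G : Ideal A ⥤ AlgObj A C} (hG : KillsSys G) (a : A) (I : Ideal A) :
    KillsSys (locComplete a I G) := fun J b hb =>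
  limStr_eq_zero (((adicSys I).obj J) ⋙ G ⋙ AlgObj.loc a ⋙ AlgObj.mapAlg A (Pro.const (Ind C)))
    fun k => mapStr_eq_zero (Pro.const (Ind C)) ((AlgObj.loc a).obj (G.obj _)) (by
      refine (congrArg (postcomp (toLoc _ _) _) (mapStr_eq_zero Ind.yoneda _ ?_)).trans
        (map_zero (postcomp (toLoc _ _) _))
      exact hG _ b (le_sup_left (a := J) hb))

/-- Every ideal of the system `J + I ^ (m + 1)` contains `J`, so vanishing passes from stage to
stage. It is used for ideals that contain a power of `I_t`, whose quotients make the elements of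
`I_t` nilpotent. -/
lemma killsSys_tower (u : ℕ → A) (h : ℕ) (ht : ℕ → ℕ)
    (hfin : ∀ m, Finite (A ⧸ flagIdeal u h ^ m)) (n : ℕ) : KillsSys (tower u h ht hfin n) := by
  induction n with
  | zero =>
    refine fun J b hb => limStr_eq_zero ((adicSysFin _ hfin).obj J ⋙ quotFunctor A ⋙
      AlgObj.mapAlg A (Pro.const FintypeCat.{u})) fun k => ?_
    refine mapStr_eq_zero (Pro.const FintypeCat.{u}) _ ?_
    have h0 : Ideal.Quotient.mk (((adicSysFin _ hfin).obj J).obj k).1 b = 0 :=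
      Ideal.Quotient.eq_zero_iff_mem.2 (le_sup_left (a := J) hb)
    have := (((adicSysFin _ hfin).obj J).obj k).2
    change (finPt _ _).symm (fun _ => Ideal.Quotient.mk _ b) = 0
    rw [h0]
    exact map_zero (finPt _ _).symm
  | succ n ih => exact ih.locComplete _ _

end kills

/-! ### The map of towers for coordinates that agree up to units. -/

section laxTower
variable {A A' : Type u} [CommRing A] [CommRing A'] {φ : A →+* A'}

namespace LaxMap

/-- The second clause records that only quotients by ideals containing a power of `I'` occur in the
completion; localization is functorial there, but not for arbitrary pairs of related ideals. -/
lemma adicSys_rel {I : Ideal A} {I' : Ideal A'} (hI : I.map φ ≤ I') {J : Ideal A} {J' : Ideal A'}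
    (h : J.map φ ≤ J') (k : (Idx.{u})ᵒᵖ) :
    (((adicSys I).obj J).obj k).map φ ≤ ((adicSys I').obj J').obj k ∧
      ∃ m, I' ^ (m + 1) ≤ ((adicSys I').obj J').obj k := by
  refine ⟨?_, k.unop.down, le_sup_right⟩
  change (J ⊔ I ^ (k.unop.down + 1)).map φ ≤ J' ⊔ I' ^ (k.unop.down + 1)
  rw [Ideal.map_sup, Ideal.map_pow]
  exact sup_le_sup h (Ideal.pow_right_mono hI _)

section step
variable {C : Type (u + 1)} [Category.{u} C] [CartesianMonoidalCategory C] [BraidedCategory C]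
variable {G : Ideal A ⥤ AlgObj A C} {G' : Ideal A' ⥤ AlgObj A' C}

/-- The image of `φ a` is the sum of `w a'`, which is invertible once `a'` is inverted, and of an
element of `I'`, which is nilpotent because a power of `I'` lies in `J'`. -/
lemma isUnit_of_kills (hG' : KillsSys G') {a : A} {a' : A'} {I' : Ideal A'}
    (ha : ∃ w, IsUnit w ∧ φ a - w * a' ∈ I') {J' : Ideal A'} (hJ : ∃ m, I' ^ (m + 1) ≤ J') :
    IsUnit (algebraMap (𝟙_ C ⟶ (G'.obj J').R.X)
      (Localization.Away (constPt ((G'.obj J').str a') (𝟙_ C))) ((G'.obj J').str (φ a))) := by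
  obtain ⟨w, hw, hi⟩ := ha
  obtain ⟨m, hm⟩ := hJ
  let α := (algebraMap (𝟙_ C ⟶ (G'.obj J').R.X)
      (Localization.Away (constPt ((G'.obj J').str a') (𝟙_ C)))).comp (G'.obj J').str
  have h1 : IsUnit (α a') := by
    have := IsLocalization.Away.algebraMap_isUnit
      (S := Localization.Away (constPt ((G'.obj J').str a') (𝟙_ C)))
      (constPt ((G'.obj J').str a') (𝟙_ C))
    have e : constPt ((G'.obj J').str a') (𝟙_ C) = (G'.obj J').str a' := by
      rw [constPt, toUnit_unique (toUnit (𝟙_ C)) (𝟙 _), Category.id_comp]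
    exact (congrArg IsUnit (congrArg (algebraMap (𝟙_ C ⟶ (G'.obj J').R.X)
      (Localization.Away (constPt ((G'.obj J').str a') (𝟙_ C)))) e)).mp this
  have h2 : IsNilpotent (α (φ a - w * a')) := by
    refine ⟨m + 1, ?_⟩
    rw [← map_pow]
    change algebraMap _ _ ((G'.obj J').str _) = 0
    rw [hG' J' _ (hm (Ideal.pow_mem_pow hi _)), map_zero]
  have h3 : α (φ a) = α (w * a') + α (φ a - w * a') := by
    rw [← map_add, add_sub_cancel]
  change IsUnit (α (φ a))
  rw [h3]
  refine h2.isUnit_add_left_of_commute ?_ (Commute.all _ _)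
  rw [map_mul]
  exact (hw.map α).mul h1

variable (L : LaxMap (fun J J' => J.map φ ≤ J') φ G G') (hG' : KillsSys G') {a : A} {a' : A'}
  {I : Ideal A} {I' : Ideal A'} (hI : I.map φ ≤ I') (ha : ∃ w, IsUnit w ∧ φ a - w * a' ∈ I')

/-- Completed localizations at elements that agree up to units and modulo the ideal. -/
def locComplete : LaxMap (fun J J' => J.map φ ≤ J') φ (locComplete a I G)
    (locComplete a' I' G') :=
  (((L.restrict (s := fun J J' => J.map φ ≤ J' ∧ ∃ m, I' ^ (m + 1) ≤ J') And.left).loc a a'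
    fun h => isUnit_of_kills hG' ha h.2).mapAlg (Pro.const (Ind C))).lim (adicSys I) (adicSys I')
    fun h k => adicSys_rel hI h k

lemma _root_.PipeRings.toLocComplete_proj (a : A) (I : Ideal A) (G : Ideal A ⥤ AlgObj A C) (k : (Idx.{u})ᵒᵖ) :
    toLocComplete a I G ≫ AlgObj.algLimProj ((adicSys I).obj ⊥ ⋙ G ⋙ AlgObj.loc a ⋙
      AlgObj.mapAlg A (Pro.const (Ind C))) k = (mapRing (Pro.const (Ind C))).map
        ((mapRing (Ind.yoneda (C := C))).map (G.map (homOfLE bot_le)).hom ≫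
          algToLoc a (G.obj (((adicSys I).obj ⊥).obj k))) :=
  AlgObj.algLimLift_proj _ _ _ k

/-- It suffices to compare projections to the terms of the limit. There the map is a lift to a
localization, whose restriction to the unlocalized quotient is the given map of systems; naturality
for `⊥ ≤ K` finishes the comparison. -/
lemma toLocComplete_locComplete (h : (⊥ : Ideal A).map φ ≤ ⊥) :
    toLocComplete a I G ≫ (L.locComplete hG' hI ha).hom h =
      (inclStage C).map (L.hom h) ≫ toLocComplete a' I' G' := by
  let Q := (adicSys I).obj ⊥ ⋙ G ⋙ AlgObj.loc a ⋙ AlgObj.mapAlg A (Pro.const (Ind C))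
  let Q' := (adicSys I').obj ⊥ ⋙ G' ⋙ AlgObj.loc a' ⋙ AlgObj.mapAlg A' (Pro.const (Ind C))
  refine AlgObj.algLim_ring_hom_ext Q' fun k => ?_
  let K := ((adicSys I).obj ⊥).obj k
  let K' := ((adicSys I').obj ⊥).obj k
  have hK : K.map φ ≤ K' ∧ ∃ m, I' ^ (m + 1) ≤ K' := adicSys_rel hI h k
  have hu := isUnit_of_kills hG' ha hK.2
  let l : locRing (G.obj K).R ((G.obj K).str a) ⟶ locRing (G'.obj K').R ((G'.obj K').str a') :=
    locLift (L.hom hK.1) _ _ (by rwa [L.str_hom])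
  have e1 : (L.locComplete hG' hI ha).hom h ≫ AlgObj.algLimProj Q' k =
      AlgObj.algLimProj Q k ≫ (mapRing (Pro.const (Ind C))).map l :=
    LaxMap.lim_proj (((L.restrict (s := fun J J' => J.map φ ≤ J' ∧ ∃ m, I' ^ (m + 1) ≤ J')
      And.left).loc a a' fun h => isUnit_of_kills hG' ha h.2).mapAlg (Pro.const (Ind C)))
      (adicSys I) (adicSys I') (fun h k => adicSys_rel hI h k) h k
  have e2 : toLoc (G.obj K).R ((G.obj K).str a) ≫ l = _ := toLoc_locLift _ _ _ _
  have e3 := L.naturality h hK.1 (homOfLE bot_le) (homOfLE bot_le)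
  have e4 : (mapRing (Pro.const (Ind C))).map ((mapRing (Ind.yoneda (C := C))).map
        (G.map (homOfLE bot_le)).hom ≫ toLoc (G.obj K).R ((G.obj K).str a)) ≫
        (mapRing (Pro.const (Ind C))).map l =
      (mapRing (Pro.const (Ind C))).map ((mapRing (Ind.yoneda (C := C))).map (L.hom h)) ≫
        (mapRing (Pro.const (Ind C))).map ((mapRing (Ind.yoneda (C := C))).map
        (G'.map (homOfLE bot_le)).hom ≫ toLoc (G'.obj K').R ((G'.obj K').str a')) := by
    rw [← Functor.map_comp, ← Functor.map_comp, Category.assoc, e2, ← Category.assoc,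
      ← (mapRing (Ind.yoneda (C := C))).map_comp, e3]
    simp only [Functor.map_comp, Category.assoc]
  refine (Category.assoc _ _ _).trans ((congrArg (toLocComplete a I G ≫ ·) e1).trans
    ((Category.assoc _ _ _).symm.trans ?_))
  refine (congrArg (· ≫ _) (toLocComplete_proj a I G k)).trans (e4.trans ?_)
  refine Eq.trans ?_ (Category.assoc _ _ _).symm
  exact congrArg ((inclStage C).map (L.hom h) ≫ ·) (toLocComplete_proj a' I' G' k).symm

end step

/-- The finite quotients of `A` and `A'`. -/
def quot : LaxMap (fun (J : FinQuot A) (J' : FinQuot A') => J.1.map φ ≤ J'.1) φ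
    (quotFunctor A) (quotFunctor A') where
  hom {J J'} h :=
    haveI := J.2
    haveI := J'.2
    finRingMap (Ideal.quotientMap J'.1 φ (Ideal.map_le_iff_le_comap.1 h))
  str_hom h a := rfl
  naturality h h' f f' := by
    refine CommRingObjCat.hom_ext (FintypeCat.hom_ext _ _ fun x => ?_)
    obtain ⟨x, rfl⟩ := Ideal.Quotient.mk_surjective x
    rfl

/-- The towers of completed localizations for coordinates that agree up to units and modulo the
preceding coordinates. -/
def tower {u : ℕ → A} {v : ℕ → A'} {h : ℕ} {ht : ℕ → ℕ}
    (hfin : ∀ m, Finite (A ⧸ flagIdeal u h ^ m)) (hfin' : ∀ m, Finite (A' ⧸ flagIdeal v h ^ m))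
    (hh : ∀ n, ht n ≤ h) (H : ∀ t ≤ h, (flagIdeal u t).map φ ≤ flagIdeal v t ∧
      ∃ w, IsUnit w ∧ φ (u t) - w * v t ∈ flagIdeal v t) : ∀ n,
    LaxMap (fun J J' => J.map φ ≤ J') φ (tower u h ht hfin n) (PipeRings.tower v h ht hfin' n)
  | 0 => (quot.mapAlg (Pro.const FintypeCat.{u})).lim (adicSysFin _ hfin) (adicSysFin _ hfin')
      fun {J J'} hJ k => by
        change (J ⊔ _ ^ (k.unop.down + 1)).map φ ≤ J' ⊔ _ ^ (k.unop.down + 1)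
        rw [Ideal.map_sup, Ideal.map_pow]
        exact sup_le_sup hJ (Ideal.pow_right_mono (H h le_rfl).1 _)
  | n + 1 => (tower hfin hfin' hh H n).locComplete (killsSys_tower v h ht hfin' n)
      (H _ (hh (n + 1))).1 (H _ (hh (n + 1))).2

end LaxMap
end laxTower

/-! ### Scaled multiplicative maps and uniqueness up to powers of the scaling factor. -/

section scaled
variable {E : Type w} [Category.{v} E] [CartesianMonoidalCategory E] [BraidedCategory E]

lemma precomp_one (R : CommRingObjCat E) {S T : E} (f : S ⟶ T) : f ≫ (1 : T ⟶ R.X) = 1 :=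
  map_one (precomp R f)

lemma precomp_mul (R : CommRingObjCat E) {S T : E} (f : S ⟶ T) (a b : T ⟶ R.X) :
    f ≫ (a * b) = (f ≫ a) * (f ≫ b) := map_mul (precomp R f) a b

lemma precomp_pow (R : CommRingObjCat E) {S T : E} (f : S ⟶ T) (a : T ⟶ R.X) (n : ℕ) :
    f ≫ a ^ n = (f ≫ a) ^ n := map_pow (precomp R f) a n

lemma postcomp_one {R S : CommRingObjCat E} (f : R ⟶ S) (T : E) : (1 : T ⟶ R.X) ≫ f.hom = 1 :=
  map_one (postcomp f T)

lemma postcomp_mul {R S : CommRingObjCat E} (f : R ⟶ S) {T : E} (a b : T ⟶ R.X) :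
    (a * b) ≫ f.hom = (a ≫ f.hom) * (b ≫ f.hom) := map_mul (postcomp f T) a b

lemma postcomp_pow {R S : CommRingObjCat E} (f : R ⟶ S) {T : E} (a : T ⟶ R.X) (n : ℕ) :
    (a ^ n) ≫ f.hom = (a ≫ f.hom) ^ n := map_pow (postcomp f T) a n

lemma comp_constPt {X : E} (x : 𝟙_ E ⟶ X) {S T : E} (f : S ⟶ T) :
    f ≫ constPt x T = constPt x S := by
  rw [constPt, ← Category.assoc, toUnit_unique (f ≫ toUnit T) (toUnit S)]

lemma constPt_comp {X Y : E} (x : 𝟙_ E ⟶ X) (f : X ⟶ Y) (T : E) :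
    constPt x T ≫ f = constPt (x ≫ f) T := Category.assoc _ _ _

lemma constPt_unit {X : E} (x : 𝟙_ E ⟶ X) : constPt x (𝟙_ E) = x := by
  rw [constPt, toUnit_unique (toUnit (𝟙_ E)) (𝟙 _), Category.id_comp]

/-- `s` is `e` times a multiplicative map. -/
structure ScaledMul (R Y : CommRingObjCat E) (e : 𝟙_ E ⟶ Y.X) (s : R.X ⟶ Y.X) : Prop where
  one : ∀ T, (1 : T ⟶ R.X) ≫ s = constPt e T
  mul : ∀ {T} (a b : T ⟶ R.X), constPt e T * ((a * b) ≫ s) = (a ≫ s) * (b ≫ s)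

namespace ScaledMul
variable {R Y : CommRingObjCat E} {e : 𝟙_ E ⟶ Y.X} {s : R.X ⟶ Y.X}

lemma of_hom (f : R ⟶ Y) : ScaledMul R Y 1 f.hom where
  one T := by rw [postcomp_one, constPt, precomp_one]
  mul a b := by rw [postcomp_mul, constPt, precomp_one, one_mul]

/-- The unit and the pair of projections are the universal points. Thus two equations suffice, and a
single power of `y` can clear the denominators in both. -/
lemma of_universal (h1 : (1 : 𝟙_ E ⟶ R.X) ≫ s = e)
    (h2 : constPt e (R.X ⊗ R.X) * ((fst R.X R.X * snd R.X R.X) ≫ s) =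
      (fst R.X R.X ≫ s) * (snd R.X R.X ≫ s)) : ScaledMul R Y e s where
  one T := by rw [← precomp_one R (toUnit T), Category.assoc, h1]
  mul {T} a b := by
    have h : lift a b ≫ _ = lift a b ≫ _ := congrArg (lift a b ≫ ·) h2
    rw [precomp_mul, precomp_mul, comp_constPt, ← Category.assoc, precomp_mul, lift_fst, lift_snd,
      ← Category.assoc, ← Category.assoc, lift_fst, lift_snd] at h
    exact h

lemma comp (h : ScaledMul R Y e s) {Y' : CommRingObjCat E} (f : Y ⟶ Y') :
    ScaledMul R Y' (e ≫ f.hom) (s ≫ f.hom) where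
  one T := by rw [← Category.assoc, h.one, constPt_comp]
  mul a b := by
    rw [← Category.assoc, ← constPt_comp, ← postcomp_mul, h.mul, postcomp_mul, Category.assoc,
      Category.assoc]

lemma precomp (h : ScaledMul R Y e s) {R' : CommRingObjCat E} (f : R' ⟶ R) :
    ScaledMul R' Y e (f.hom ≫ s) where
  one T := by rw [← Category.assoc, postcomp_one, h.one]
  mul a b := by rw [← Category.assoc, postcomp_mul, h.mul, Category.assoc, Category.assoc]

end ScaledMul

/-- Scaled multiplicative maps from `R` to `Y` with the same restriction along `i` agree after
multiplication by the `N`-th power of the scaling factor. -/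
def UniqueUpTo (N : ℕ) {Z : E} {R : CommRingObjCat E} (i : Z ⟶ R.X) (Y : CommRingObjCat E) : Prop :=
  ∀ ⦃e : 𝟙_ E ⟶ Y.X⦄ ⦃s s' : R.X ⟶ Y.X⦄, ScaledMul R Y e s → ScaledMul R Y e s' →
    i ≫ s = i ≫ s' → constPt e R.X ^ N * s = constPt e R.X ^ N * s'

/-- A ring map is scaled by `e = 1`, so the power of `e` drops out. -/
lemma UniqueUpTo.hom_ext {N : ℕ} {Z : E} {R : CommRingObjCat E} {i : Z ⟶ R.X}
    {Y : CommRingObjCat E} (h : UniqueUpTo N i Y) {f g : R ⟶ Y} (hfg : i ≫ f.hom = i ≫ g.hom) :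
    f = g := by
  have := h (.of_hom f) (.of_hom g) hfg
  rw [constPt, precomp_one, one_pow, one_mul, one_mul] at this
  exact CommRingObjCat.hom_ext this

/-- Equality in a limit is tested on its terms. The exponent has to be the same for all of them,
which is why `N` is fixed before the maps are. -/
lemma uniqueUpTo_limRing {A : Type*} [CommRing A] {K : Type v} [SmallCategory K]
    [HasLimitsOfShape K E] (Q : K ⥤ AlgObj A E) {N : ℕ} {Z : E} {R : CommRingObjCat E}
    {i : Z ⟶ R.X} (h : ∀ k, UniqueUpTo N i (Q.obj k).R) :
    UniqueUpTo N i (AlgObj.algLimRing Q) := fun e s s' hs hs' hi =>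
  AlgObj.algLim_hom_ext Q fun k => by
    have := h k (hs.comp (AlgObj.algLimProj Q k)) (hs'.comp (AlgObj.algLimProj Q k))
      (by rw [← Category.assoc, hi, Category.assoc])
    rw [postcomp_mul, postcomp_mul, postcomp_pow, constPt_comp]
    exact this

section map
variable {D : Type*} [Category.{v} D] [CartesianMonoidalCategory D] [BraidedCategory D]
  (T : E ⥤ D) [PreservesFiniteProducts T]

/-- The effect on global points of a functor that preserves finite products. -/
def mapGlob (Y : CommRingObjCat E) (e : 𝟙_ E ⟶ Y.X) : 𝟙_ D ⟶ ((mapRing T).obj Y).X :=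
  letI : T.Braided := .ofChosenFiniteProducts T
  precomp ((mapRing T).obj Y) (Functor.LaxMonoidal.ε T) (mapPt T Y _ e)

lemma constPt_mapGlob (Y : CommRingObjCat E) (e : 𝟙_ E ⟶ Y.X) (c : E) :
    constPt (mapGlob T Y e) (T.obj c) = mapPt T Y c (constPt e c) := by
  let : T.Braided := .ofChosenFiniteProducts T
  have h : toUnit (T.obj c) ≫ Functor.LaxMonoidal.ε T = T.map (toUnit c) := by
    rw [← cancel_mono (Functor.OplaxMonoidal.η T)]
    exact toUnit_unique _ _
  refine (Category.assoc _ _ _).symm.trans ((congrArg (· ≫ _) h).trans ?_)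
  exact (T.map_comp _ _).symm

lemma mapGlob_surjective [T.Full] (Y : CommRingObjCat E) : Function.Surjective (mapGlob T Y) := by
  intro e
  let : T.Braided := .ofChosenFiniteProducts T
  obtain ⟨e', he⟩ := T.map_surjective (Functor.OplaxMonoidal.η T ≫ e)
  refine ⟨e', (congrArg (Functor.LaxMonoidal.ε T ≫ ·) he).trans ?_⟩
  refine (Category.assoc _ _ _).symm.trans ((congrArg (· ≫ e) (Functor.Monoidal.ε_η T)).trans ?_)
  exact Category.id_comp _

lemma ScaledMul.of_map [T.Faithful] {R Y : CommRingObjCat E} {e : 𝟙_ E ⟶ Y.X} {s : R.X ⟶ Y.X}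
    (hs : ScaledMul ((mapRing T).obj R) ((mapRing T).obj Y) (mapGlob T Y e) (T.map s)) :
    ScaledMul R Y e s where
  one c := T.map_injective <| by
    have h1 := hs.one (T.obj c)
    rw [constPt_mapGlob, ← map_one (mapPt T R c)] at h1
    exact (T.map_comp _ _).trans h1
  mul {c} a b := T.map_injective <| by
    have h2 := hs.mul (mapPt T R c a) (mapPt T R c b)
    rw [← map_mul, constPt_mapGlob] at h2
    have q (r : c ⟶ R.X) : mapPt T R c r ≫ T.map s = mapPt T Y c (r ≫ s) := (T.map_comp _ _).symm
    refine (map_mul (mapPt T Y c) _ _).trans (Eq.trans ?_ (map_mul (mapPt T Y c) _ _).symm)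
    refine (congrArg (mapPt T Y c (constPt e c) * ·) (q (a * b)).symm).trans (h2.trans ?_)
    exact congrArg₂ (· * ·) (q a) (q b)

/-- Fullness lifts the maps and the scaling factor, and faithfulness lifts the equations between
them. -/
lemma UniqueUpTo.map [T.Full] [T.Faithful] {N : ℕ} {Z : E} {R Y : CommRingObjCat E} {i : Z ⟶ R.X}
    (h : UniqueUpTo N i Y) :
    UniqueUpTo (R := (mapRing T).obj R) N (T.map i) ((mapRing T).obj Y) := fun e s s' hs hs' hi => by
  obtain ⟨s, rfl⟩ := T.map_surjective (X := R.X) (Y := Y.X) s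
  obtain ⟨s', rfl⟩ := T.map_surjective (X := R.X) (Y := Y.X) s'
  obtain ⟨e, rfl⟩ := mapGlob_surjective T Y e
  have h1 := congrArg (mapPt T Y R.X) (h hs.of_map hs'.of_map (T.map_injective
    ((T.map_comp _ _).trans (hi.trans (T.map_comp _ _).symm))))
  rw [map_mul, map_mul, map_pow, ← constPt_mapGlob] at h1
  exact h1

end map
end scaled

/-! ### Uniqueness for maps to a localization. -/

section locUnique
variable {C : Type u} [Category.{v} C] [CartesianMonoidalCategory C] [BraidedCategory C]

lemma locMk_mul (R : CommRingObjCat C) (x : 𝟙_ C ⟶ R.X) {c : C} (i j : ℕ) (a b : c ⟶ R.X) :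
    locMk R x c i a * locMk R x c j b = locMk R x c (i + j) (a * b) := by
  unfold locMk
  rw [← IsLocalization.mk'_mul]
  congr 2
  exact Subtype.ext (pow_add (constPt x c) i j).symm

lemma exists_eq_locι_of_le (R : CommRingObjCat C) (x : 𝟙_ C ⟶ R.X) {c : C}
    (z : Ind.yoneda.obj c ⟶ locObj R x) :
    ∃ j, ∀ i, j ≤ i → ∃ a, z = Ind.yoneda.map a ≫ locι R x i := by
  obtain ⟨j, a, rfl⟩ := exists_eq_locι R x z
  exact ⟨j, fun i hi => ⟨constPt x c ^ (i - j) * a, locPt_injective R x (by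
    rw [locPt_ι, locPt_ι, locMk_pow_mul _ _ hi])⟩⟩

lemma eq_scaled_of_locMk_eq {R : CommRingObjCat C} {x : 𝟙_ C ⟶ R.X} {c : C} {j : ℕ} {a b : c ⟶ R.X}
    (h : locMk R x c j a = locMk R x c j b) :
    ∃ n, ∀ m, n ≤ m → constPt x c ^ m * a = constPt x c ^ m * b := by
  obtain ⟨n, hn⟩ := (locMk_eq_iff R x j j a b).1 h
  refine ⟨n + j, fun m hm => ?_⟩
  obtain ⟨k, rfl⟩ := Nat.exists_eq_add_of_le hm
  rw [pow_add, mul_comm (_ ^ (n + j)), mul_assoc, hn, mul_assoc]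

variable {R Y : CommRingObjCat C} {y : 𝟙_ C ⟶ Y.X}

lemma locPt_constPt {j : ℕ} {e₀ : 𝟙_ C ⟶ Y.X} {e : 𝟙_ (Ind C) ⟶ (locRing Y y).X}
    (he : constPt e (Ind.yoneda.obj (𝟙_ C)) = Ind.yoneda.map e₀ ≫ locι Y y j) (c : C) :
    locPt Y y (constPt e (Ind.yoneda.obj c)) = locMk Y y c j (constPt e₀ c) := by
  have h : constPt e (Ind.yoneda.obj c) = Ind.yoneda.map (constPt e₀ c) ≫ locι Y y j := by
    rw [Functor.map_comp, Category.assoc]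
    exact (comp_constPt e (Ind.yoneda.map (toUnit c))).symm.trans
      (congrArg (Ind.yoneda.map (toUnit c) ≫ ·) he)
  exact (congrArg (locPt Y y) h).trans (locPt_ι Y y _ j)

/-- A scaled multiplicative map to `y⁻¹Y` is, up to a further power of `y`, the fraction of a
scaled multiplicative map to `Y`. -/
lemma scaledMul_of_loc {j : ℕ} {e₀ : 𝟙_ C ⟶ Y.X} {s₀ : R.X ⟶ Y.X}
    {e : 𝟙_ (Ind C) ⟶ (locRing Y y).X}
    (he : constPt e (Ind.yoneda.obj (𝟙_ C)) = Ind.yoneda.map e₀ ≫ locι Y y j)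
    (hs : ScaledMul ((mapRing Ind.yoneda).obj R) (locRing Y y) e (Ind.yoneda.map s₀ ≫ locι Y y j)) :
    ∃ n, ∀ m, n ≤ m → ScaledMul R Y (constPt y _ ^ m * e₀) (constPt y _ ^ m * s₀) := by
  have hc (c : C) := locPt_constPt he c
  have hp {c : C} (a : c ⟶ R.X) :
      locPt Y y (mapPt Ind.yoneda R c a ≫ Ind.yoneda.map s₀ ≫ locι Y y j) =
        locMk Y y c j (a ≫ s₀) := by
    refine Eq.trans ?_ (locPt_ι Y y (a ≫ s₀) j)
    rw [Functor.map_comp, Category.assoc]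
    rfl
  have h1 := congrArg (locPt Y y) (hs.one (Ind.yoneda.obj (𝟙_ C)))
  rw [← map_one (mapPt Ind.yoneda R _)] at h1
  have h1' := (hp 1).symm.trans (h1.trans (hc _))
  have h2 := congrArg (locPt Y y) (hs.mul (mapPt Ind.yoneda R _ (fst R.X R.X))
    (mapPt Ind.yoneda R _ (snd R.X R.X)))
  rw [locPt_mul, locPt_mul, ← map_mul] at h2
  have h2' := (congrArg₂ (· * ·) (hc _) (hp _)).symm.trans (h2.trans (congrArg₂ (· * ·) (hp _) (hp _)))
  -- Both sides now have the denominator `y ^ (j + j)`, so their numerators agree up to a power of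
  -- `y`.
  rw [locMk_mul, locMk_mul] at h2'
  obtain ⟨n₁, hn₁⟩ := eq_scaled_of_locMk_eq h1'
  obtain ⟨n₂, hn₂⟩ := eq_scaled_of_locMk_eq h2'
  refine ⟨n₁ + n₂, fun m hm => .of_universal ?_ ?_⟩
  · have := hn₁ m (by omega)
    rw [precomp_mul, precomp_pow, comp_constPt, this, constPt_unit e₀]
  · have := hn₂ m (by omega)
    have e1 : constPt (constPt y (𝟙_ C) ^ m * e₀) (R.X ⊗ R.X) =
        constPt y _ ^ m * constPt e₀ _ := by
      rw [constPt, precomp_mul, precomp_pow, comp_constPt]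
    rw [e1, precomp_mul, precomp_mul, precomp_mul, precomp_pow, precomp_pow, precomp_pow,
      comp_constPt, comp_constPt, comp_constPt]
    linear_combination constPt y (R.X ⊗ R.X) ^ m * this

/-- Clear denominators: for large `m`, the numerators multiplied by `y ^ m` are scaled
multiplicative maps to `Y` itself with the same restriction along `i`. The hypothesis applies to
them, and the surplus powers of `y` are invertible in `y⁻¹Y`, so `N` does not change. -/
lemma UniqueUpTo.loc {N : ℕ} {Z : C} {i : Z ⟶ R.X} (h : UniqueUpTo N i Y) :
    UniqueUpTo (R := (mapRing Ind.yoneda).obj R) N (Ind.yoneda.map i) (locRing Y y) :=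
  fun e s s' hs hs' hi => by
  obtain ⟨j₁, h₁⟩ := exists_eq_locι_of_le Y y (c := R.X) s
  obtain ⟨j₂, h₂⟩ := exists_eq_locι_of_le Y y (c := R.X) s'
  obtain ⟨j₃, h₃⟩ := exists_eq_locι_of_le Y y (constPt e (Ind.yoneda.obj (𝟙_ C)))
  let j := j₁ + j₂ + j₃
  obtain ⟨s₀, hs₀⟩ := h₁ j (by omega)
  obtain ⟨s₀', hs₀'⟩ := h₂ j (by omega)
  obtain ⟨e₀, he₀⟩ := h₃ j (by omega)
  subst hs₀ hs₀'
  obtain ⟨n₁, hn₁⟩ := scaledMul_of_loc he₀ hs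
  obtain ⟨n₂, hn₂⟩ := scaledMul_of_loc he₀ hs'
  have hi' : locMk Y y Z j (i ≫ s₀) = locMk Y y Z j (i ≫ s₀') := by
    rw [← locPt_ι, ← locPt_ι, Functor.map_comp, Functor.map_comp, Category.assoc, Category.assoc]
    exact congrArg (locPt Y y) hi
  obtain ⟨n₃, hn₃⟩ := eq_scaled_of_locMk_eq hi'
  -- One power of `y` makes both numerators scaled multiplicative and makes their restrictions to
  -- `Z` equal.
  let m := n₁ + n₂ + n₃
  have key := h (hn₁ m (by omega)) (hn₂ m (by omega)) (by
    rw [precomp_mul, precomp_mul, precomp_pow, comp_constPt]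
    exact hn₃ m (by omega))
  have e1 : constPt (constPt y (𝟙_ C) ^ m * e₀) R.X = constPt y _ ^ m * constPt e₀ _ := by
    rw [constPt, precomp_mul, precomp_pow, comp_constPt]
  rw [e1] at key
  have hc := locPt_constPt he₀ R.X
  have hpow (n : ℕ) (a : R.X ⟶ Y.X) :
      locMk Y y R.X j (constPt e₀ R.X) ^ n * locMk Y y R.X j a =
        locMk Y y R.X (n * j + j) (constPt e₀ R.X ^ n * a) := by
    induction n generalizing a with
    | zero => simp
    | succ n ih =>
      rw [pow_succ', mul_assoc, ih, locMk_mul]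
      congr 1 <;> ring
  have final : locMk Y y R.X (N * j + j) (constPt e₀ R.X ^ N * s₀) =
      locMk Y y R.X (N * j + j) (constPt e₀ R.X ^ N * s₀') := by
    -- `key` carries the factor `(y ^ m) ^ N * y ^ m`, with `N` copies from the scaling factor and
    -- one from the map.
    refine (locMk_eq_iff _ _ _ _ _ _).2 ⟨m * N + m, ?_⟩
    linear_combination constPt y R.X ^ (N * j + j) * key
  apply locPt_injective Y y
  refine ((locPtEquiv Y y R.X).map_mul _ _).trans
    (Eq.trans ?_ ((locPtEquiv Y y R.X).map_mul _ _).symm)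
  have hpp : locPtEquiv Y y R.X (constPt e (Ind.yoneda.obj R.X) ^ N) =
      locMk Y y R.X j (constPt e₀ R.X) ^ N := ((locPtEquiv Y y R.X).map_pow _ _).trans
        (congrArg (· ^ N) hc)
  refine (congrArg₂ (· * ·) hpp (locPt_ι Y y s₀ j)).trans (Eq.trans ?_
    (congrArg₂ (· * ·) hpp (locPt_ι Y y s₀' j)).symm)
  exact (hpow N s₀).trans (final.trans (hpow N s₀').symm)

end locUnique

/-! ### The zigzag computation for fractions. -/

section zigzag
variable {E : Type w} [Category.{v} E] [CartesianMonoidalCategory E] [BraidedCategory E]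

/-- Scaled multiplicative maps that agree on `R₀` agree on fractions of elements of `R₀`. -/
lemma ScaledMul.comp_fraction_eq {R₀ R L W : CommRingObjCat E} (st : R₀ ⟶ R) (p : R ⟶ L)
    [Epi p.hom] {c : E} (b : ℕ → (c ⟶ L.X)) (g : R₀.X ⟶ c) [Epi g]
    (hg : g ≫ b 0 = st.hom ≫ p.hom) (x : 𝟙_ E ⟶ R₀.X) (hx : IsUnit (x ≫ st.hom))
    (hb : ∀ j, constPt ((x ≫ st.hom) ≫ p.hom) c ^ j * b j = b 0) {e : 𝟙_ E ⟶ W.X}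
    {t t' : L.X ⟶ W.X} (hs : ScaledMul R W e (p.hom ≫ t)) (hs' : ScaledMul R W e (p.hom ≫ t'))
    {N : ℕ} (hN : constPt e R₀.X ^ N * (st.hom ≫ p.hom ≫ t) =
      constPt e R₀.X ^ N * (st.hom ≫ p.hom ≫ t')) (j : ℕ) :
    b j ≫ (constPt e L.X ^ (N + 2) * t) = b j ≫ (constPt e L.X ^ (N + 2) * t') := by
  -- Scaled multiplicativity is known only on `R`, and only `p`, not `p ⊗ p`, is assumed to be an
  -- epimorphism. With one factor a constant `r`, cancelling `p` alone carries the rule over to `L`.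
  have act {t : L.X ⟶ W.X} (hs : ScaledMul R W e (p.hom ≫ t)) (r : 𝟙_ E ⟶ R.X) (z : c ⟶ L.X) :
      constPt e c * ((constPt (r ≫ p.hom) c * z) ≫ t) =
        constPt (r ≫ p.hom ≫ t) c * (z ≫ t) := by
    have h1 := hs.mul (constPt r R.X) (𝟙 R.X)
    rw [Category.id_comp, ← Category.assoc, postcomp_mul, Category.id_comp, constPt_comp,
      constPt_comp] at h1
    have h2 : constPt e L.X * ((constPt (r ≫ p.hom) L.X * 𝟙 L.X) ≫ t) =
        constPt (r ≫ p.hom ≫ t) L.X * t := by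
      rw [← cancel_epi p.hom, precomp_mul, precomp_mul, comp_constPt, comp_constPt,
        ← Category.assoc, precomp_mul, comp_constPt, Category.comp_id]
      exact h1
    have h3 : z ≫ _ = z ≫ _ := congrArg (z ≫ ·) h2
    rw [precomp_mul, precomp_mul, comp_constPt, comp_constPt, ← Category.assoc, precomp_mul,
      comp_constPt, Category.comp_id] at h3
    exact h3
  -- `ξ` is the image of `x` in `R` and `η` its inverse, which exists in `R` but need not come from
  -- `R₀`.
  obtain ⟨⟨ξ, η, hξη, _⟩, hξ⟩ := hx
  change ξ = x ≫ st.hom at hξ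
  have h0 : constPt e c ^ N * (b 0 ≫ t) = constPt e c ^ N * (b 0 ≫ t') := by
    rw [← cancel_epi g, precomp_mul, precomp_mul, precomp_pow, comp_constPt, ← Category.assoc,
      ← Category.assoc, hg, Category.assoc, Category.assoc]
    exact hN
  have hbj : constPt ((η ^ j) ≫ p.hom) c * b 0 = b j := by
    rw [← hb j, ← mul_assoc, ← hξ]
    have : constPt ((η ^ j) ≫ p.hom) c * constPt (ξ ≫ p.hom) c ^ j = 1 := by
      rw [constPt, constPt, ← precomp_pow, ← precomp_mul, ← postcomp_pow, ← postcomp_mul,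
        ← mul_pow, mul_comm, hξη, one_pow, postcomp_one, precomp_one]
    rw [this, one_mul]
  have hb0 : constPt ((ξ ^ j) ≫ p.hom) c * b j = b 0 := by
    rw [postcomp_pow, constPt, precomp_pow, ← hb j, ← hξ]
  have h1 := act hs (η ^ j) (b 0)
  rw [hbj] at h1
  have h2 := act hs' (ξ ^ j) (b j)
  rw [hb0] at h2
  have h3 : constPt ((ξ ^ j) ≫ p.hom ≫ t) c * constPt ((η ^ j) ≫ p.hom ≫ t) c =
      constPt e c * constPt e c := by
    have h := hs.mul (ξ ^ j) (η ^ j)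
    rw [← mul_pow, hξη, one_pow, hs.one] at h
    have h' := congrArg (toUnit c ≫ ·) h
    simp only [precomp_mul, comp_constPt] at h'
    exact h'.symm
  have h5 : constPt e c ^ N * constPt ((ξ ^ j) ≫ p.hom ≫ t) c =
      constPt e c ^ N * constPt ((ξ ^ j) ≫ p.hom ≫ t') c := by
    have h := congrArg ((x ^ j) ≫ ·) hN
    simp only [precomp_mul, precomp_pow, comp_constPt] at h
    rw [← Category.assoc, ← Category.assoc (x ^ j), postcomp_pow, ← hξ] at h
    have h' := congrArg (toUnit c ≫ ·) h
    simp only [precomp_mul, precomp_pow, comp_constPt] at h'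
    exact h'
  rw [precomp_mul, precomp_mul, precomp_pow, comp_constPt]
  -- Omitting `p`, the chain is `e^(N+2) t(b_j) = e^(N+1) t(η^j) t(b_0) = e^(N+1) t(η^j) t'(b_0) =
  -- e^N t(η^j) t'(ξ^j) t'(b_j) = e^N t(η^j) t(ξ^j) t'(b_j) = e^(N+2) t'(b_j)`. The two extra powers
  -- of `e` come from the two uses of `act`.
  linear_combination constPt e c ^ (N + 1) * h1 + constPt e c * constPt ((η ^ j) ≫ p.hom ≫ t) c * h0 +
    constPt e c ^ N * constPt ((η ^ j) ≫ p.hom ≫ t) c * h2 -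
    constPt ((η ^ j) ≫ p.hom ≫ t) c * (b j ≫ t') * h5 + constPt e c ^ N * (b j ≫ t') * h3

end zigzag

/-! ### Uniqueness for maps out of a completed localization. -/

section complete
variable {A : Type u} [CommRing A]
variable {C : Type (u + 1)} [Category.{u} C] [CartesianMonoidalCategory C] [BraidedCategory C]

/-- Inverses are unique, so those in the terms are compatible and define a point of the limit. -/
lemma isUnit_limStr {E : Type w} [Category.{v} E] [CartesianMonoidalCategory E]
    [BraidedCategory E] {K : Type v} [SmallCategory K] [HasLimitsOfShape K E] (Q : K ⥤ AlgObj A E)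
    {a : A} (h : ∀ k, IsUnit ((Q.obj k).str a)) : IsUnit (AlgObj.limStr Q a) := by
  choose η hη using fun k => (h k).exists_right_inv
  have hw ⦃k l : K⦄ (f : k ⟶ l) : η k ≫ (Q.map f).hom.hom = η l := by
    have h1 : (Q.obj l).str a * (η k ≫ (Q.map f).hom.hom) = 1 := by
      rw [← (Q.map f).str_comp a, ← postcomp_mul, hη, postcomp_one]
    exact (h l).mul_left_cancel (h1.trans (hη l).symm)
  let ζ : 𝟙_ E ⟶ (AlgObj.algLimRing Q).X :=
    limLiftHom (Q ⋙ AlgObj.forgetRing A E) η hw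
  have hζ (k : K) : ζ ≫ (AlgObj.algLimProj Q k).hom = η k :=
    limLiftHom_proj (Q ⋙ AlgObj.forgetRing A E) η hw k
  refine IsUnit.of_mul_eq_one ζ (AlgObj.algLim_hom_ext Q fun k => ?_)
  rw [postcomp_mul, hζ, postcomp_one]
  exact (congrArg (· * η k) (AlgObj.limStrFun_proj Q a k)).trans (hη k)

lemma isUnit_mapStr {D : Type*} [Category.{u} D] [CartesianMonoidalCategory D]
    [BraidedCategory D] (T : C ⥤ D) [PreservesFiniteProducts T] (P : AlgObj A C) {a : A}
    (h : IsUnit (P.str a)) : IsUnit (AlgObj.mapStr T P a) := by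
  rw [AlgObj.mapStr, RingHom.comp_apply]
  exact h.map _

lemma isUnit_loc_str (P : AlgObj A C) (a : A) : IsUnit (((AlgObj.loc a).obj P).str a) := by
  let : (Ind.yoneda (C := C)).Braided := .ofChosenFiniteProducts _
  have h := (isUnit_mapPt_toLoc P.R (P.str a) (𝟙_ C)).map
    (precomp (locRing P.R (P.str a)) (Functor.LaxMonoidal.ε (Ind.yoneda (C := C))))
  rw [constPt_unit] at h
  have e : ((AlgObj.loc a).obj P).str a = precomp (locRing P.R (P.str a))
      (Functor.LaxMonoidal.ε (Ind.yoneda (C := C))) (mapPt Ind.yoneda P.R (𝟙_ C) (P.str a) ≫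
        (toLoc P.R (P.str a)).hom) :=
    Category.assoc (Functor.LaxMonoidal.ε (Ind.yoneda (C := C))) (mapPt Ind.yoneda P.R (𝟙_ C)
      (P.str a)) (toLoc P.R (P.str a)).hom
  rw [e]
  exact h

lemma isUnit_locComplete_str (G : Ideal A ⥤ AlgObj A C) (a : A) (I J : Ideal A) :
    IsUnit (((locComplete a I G).obj J).str a) :=
  isUnit_limStr ((adicSys I).obj J ⋙ G ⋙ AlgObj.loc a ⋙ AlgObj.mapAlg A (Pro.const (Ind C)))
    fun _ => isUnit_mapStr _ ((AlgObj.loc a).obj _) (isUnit_loc_str _ a)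

lemma toLocComplete_str (G : Ideal A ⥤ AlgObj A C) (a : A) (I : Ideal A) (b : A) :
    (((AlgObj.mapAlg A Ind.yoneda ⋙ AlgObj.mapAlg A (Pro.const (Ind C))).obj (G.obj ⊥)).str b) ≫
      (toLocComplete a I G).hom = ((locComplete a I G).obj ⊥).str b := by
  let Q := (adicSys I).obj ⊥ ⋙ G ⋙ AlgObj.loc a ⋙ AlgObj.mapAlg A (Pro.const (Ind C))
  refine AlgObj.algLim_hom_ext Q fun k => ?_
  let K := ((adicSys I).obj ⊥).obj k
  let m : (AlgObj.mapAlg A Ind.yoneda).obj (G.obj ⊥) ⟶ (AlgObj.loc a).obj (G.obj K) :=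
    (AlgObj.mapAlg A Ind.yoneda).map (G.map (homOfLE bot_le)) ≫
      ⟨algToLoc a (G.obj K), fun _ => rfl⟩
  have h1 := congrArg CommRingObjCat.Hom.hom (toLocComplete_proj a I G k)
  refine (Category.assoc _ _ _).trans ((congrArg (_ ≫ ·) h1).trans ?_)
  exact (AlgObj.mapStr_comp (Pro.const (Ind C)) m b).trans (AlgObj.limStrFun_proj Q b k).symm

lemma constPt_loc_str (P : AlgObj A C) (a : A) (c : C) :
    constPt (((AlgObj.loc a).obj P).str a) (Ind.yoneda.obj c) =
      mapPt Ind.yoneda P.R c (constPt (P.str a) c) ≫ (toLoc P.R (P.str a)).hom := by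
  let : (Ind.yoneda (C := C)).Braided := .ofChosenFiniteProducts _
  have e : ((AlgObj.loc a).obj P).str a =
      mapGlob Ind.yoneda P.R (P.str a) ≫ (toLoc P.R (P.str a)).hom := rfl
  rw [e]
  exact (constPt_comp _ _ _).symm.trans (congrArg (· ≫ _) (constPt_mapGlob Ind.yoneda P.R _ c))

/-- At the identity point, the `j`-th structure map is the fraction with denominator `x ^ j`. This
provides the relation `x^j b_j = b_0` of the zigzag. -/
lemma pow_mul_locι {E : Type w} [Category.{v} E] [CartesianMonoidalCategory E]
    [BraidedCategory E] (R : CommRingObjCat E) (x : 𝟙_ E ⟶ R.X) (j : ℕ) :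
    (mapPt Ind.yoneda R R.X (constPt x R.X) ≫ (toLoc R x).hom) ^ j *
      (show Ind.yoneda.obj R.X ⟶ (locRing R x).X from locι R x j) = locι R x 0 := by
  have h (i : ℕ) : locPtEquiv R x R.X (locι R x i) = locMk R x R.X i (𝟙 R.X) := by
    refine Eq.trans ?_ (locPt_ι R x (𝟙 R.X) i)
    rw [Ind.yoneda.map_id, Category.id_comp]
    rfl
  apply (locPtEquiv R x R.X).injective
  rw [map_mul, map_pow, locPtEquiv_toLoc, ← map_pow, ← locMk_zero]
  refine (congrArg (_ * ·) (h j)).trans (Eq.trans ?_ (h 0).symm)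
  rw [locMk_mul, Nat.zero_add]
  exact locMk_pow_mul R x (Nat.zero_le j) _

/-- Since the target is constant, both maps factor through one term, a localization of the quotient
at `K`. The zigzag applies there because `a` is invertible in the completed localization; it gives
equality on all fractions `r / a ^ j`, at the cost of two powers of `e`. -/
lemma UniqueUpTo.toLocComplete {G : Ideal A ⥤ AlgObj A C} (hG : EpiSys G) (a : A) (I : Ideal A)
    {N : ℕ} {Z : Pro (Ind C)} {i : Z ⟶ ((inclStage C).obj (G.obj ⊥).R).X}
    {W : CommRingObjCat (Ind C)} (h : UniqueUpTo N i ((mapRing (Pro.const (Ind C))).obj W)) :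
    UniqueUpTo (R := ((locComplete a I G).obj ⊥).R) (N + 2) (i ≫ (toLocComplete a I G).hom)
      ((mapRing (Pro.const (Ind C))).obj W) := fun e s s' hs hs' hi => by
  let Q := (adicSys I).obj ⊥ ⋙ G ⋙ AlgObj.loc a ⋙ AlgObj.mapAlg A (Pro.const (Ind C))
  let κ := Pro.const (Ind C)
  obtain ⟨k, t, t', rfl, rfl⟩ := pro_exists_factor_pair (limit.isLimit
    ((Q ⋙ AlgObj.forgetRing A (Pro (Ind C))) ⋙ CommRingObjCat.forget (Pro (Ind C)))) s s'
  let K := ((adicSys I).obj ⊥).obj k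
  let x := (G.obj K).str a
  let L := (mapRing κ).obj (locRing (G.obj K).R x)
  let p : ((locComplete a I G).obj ⊥).R ⟶ L := AlgObj.algLimProj Q k
  have hp : Epi p.hom := algLimProj_epi Q (fun _ _ f =>
    (hG.loc a).const (((adicSys I).obj ⊥).map f)) k
  let b (j : ℕ) : κ.obj (Ind.yoneda.obj (G.obj K).R.X) ⟶ L.X := κ.map (locι (G.obj K).R x j)
  have hg₀ : Epi (G.map (homOfLE bot_le : ⊥ ⟶ K)).hom.hom := hG _
  let g : ((inclStage C).obj (G.obj ⊥).R).X ⟶ κ.obj (Ind.yoneda.obj (G.obj K).R.X) :=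
    κ.map (Ind.yoneda.map (G.map (homOfLE bot_le : ⊥ ⟶ K)).hom.hom)
  have hg : Epi g := inferInstanceAs (Epi (κ.map (Ind.yoneda.map _)))
  have hN := h (hs.precomp (PipeRings.toLocComplete a I G))
    (hs'.precomp (PipeRings.toLocComplete a I G))
    ((Category.assoc _ _ _).symm.trans (hi.trans (Category.assoc _ _ _)))
  let ξ : 𝟙_ (Pro (Ind C)) ⟶ ((inclStage C).obj (G.obj ⊥).R).X :=
    ((AlgObj.mapAlg A Ind.yoneda ⋙ AlgObj.mapAlg A (Pro.const (Ind C))).obj (G.obj ⊥)).str a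
  have hξ : ξ ≫ (PipeRings.toLocComplete a I G).hom = ((locComplete a I G).obj ⊥).str a :=
    toLocComplete_str G a I a
  have key := ScaledMul.comp_fraction_eq (PipeRings.toLocComplete a I G) p b g
    ((κ.map_comp _ _).symm.trans
      (congrArg CommRingObjCat.Hom.hom (toLocComplete_proj a I G k)).symm) ξ
    (by rw [hξ]; exact isUnit_locComplete_str G a I ⊥) (fun j => ?_) hs hs' hN
  · let L' := (mapRing κ).obj W
    let t₁ : L.X ⟶ L'.X := t
    let t₂ : L.X ⟶ L'.X := t'
    -- Full faithfulness of `κ` moves the equation to ind-objects, where the fraction maps jointly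
    -- detect maps out of the localization.
    have hL : constPt e L.X ^ (N + 2) * t₁ = constPt e L.X ^ (N + 2) * t₂ := by
      obtain ⟨q₁, hq₁⟩ := κ.map_surjective (X := locObj (G.obj K).R x) (Y := W.X)
        (constPt e L.X ^ (N + 2) * t₁)
      obtain ⟨q₂, hq₂⟩ := κ.map_surjective (X := locObj (G.obj K).R x) (Y := W.X)
        (constPt e L.X ^ (N + 2) * t₂)
      refine hq₁.symm.trans (Eq.trans ?_ hq₂)
      refine congrArg κ.map (locObj_hom_ext _ _ fun j => κ.map_injective ?_)
      refine (κ.map_comp _ _).trans (Eq.trans ?_ (κ.map_comp _ _).symm)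
      exact (congrArg (b j ≫ ·) hq₁).trans ((key j).trans (congrArg (b j ≫ ·) hq₂.symm))
    have h1 : p.hom ≫ (constPt e L.X ^ (N + 2) * t₁) = p.hom ≫ (constPt e L.X ^ (N + 2) * t₂) :=
      congrArg (p.hom ≫ ·) hL
    rw [precomp_mul, precomp_mul, precomp_pow, comp_constPt] at h1
    exact h1
  · have h1 : (ξ ≫ (PipeRings.toLocComplete a I G).hom) ≫ p.hom = mapGlob κ (locRing (G.obj K).R x)
        (((AlgObj.loc a).obj (G.obj K)).str a) := by
      rw [hξ]
      exact AlgObj.limStrFun_proj Q a k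
    have h2 : constPt ((ξ ≫ (PipeRings.toLocComplete a I G).hom) ≫ p.hom)
        (κ.obj (Ind.yoneda.obj (G.obj K).R.X)) = mapPt κ (locRing (G.obj K).R x) _
          (mapPt Ind.yoneda (G.obj K).R _ (constPt x _) ≫ (toLoc (G.obj K).R x).hom) :=
      (congrArg (constPt · _) h1).trans ((constPt_mapGlob κ _ _ _).trans
        (congrArg (mapPt κ _ _) (constPt_loc_str _ a _)))
    refine (congrArg (· ^ j * b j) h2).trans ?_
    rw [← map_pow]
    exact ((mapPt κ (locRing (G.obj K).R x) (Ind.yoneda.obj (G.obj K).R.X)).map_mul _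
      (locι (G.obj K).R x j)).symm.trans (congrArg κ.map (pow_mul_locι _ x j))

end complete

/-! ### Maps between stages are determined by stage `0`, and there by the base ring. -/

section towerUnique
variable {A A' : Type u} [CommRing A] [CommRing A'] (u : ℕ → A) (v : ℕ → A') (h : ℕ) (ht : ℕ → ℕ)
  (hfin : ∀ m, Finite (A ⧸ flagIdeal u h ^ m)) (hfin' : ∀ m, Finite (A' ⧸ flagIdeal v h ^ m))

/-- Scaled multiplicative maps between the stages of two towers are determined by their
restrictions to stage `0`, up to powers of the scaling factor. -/
lemma uniqueUpTo_towerFromZero (n : ℕ) : ∀ J' : Ideal A',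
    UniqueUpTo (2 * n) (towerFromZero u h ht hfin n).hom ((tower v h ht hfin' n).obj J').R := by
  induction n with
  | zero =>
    intro J' e s s' _ _ hi
    have h1 : 𝟙 _ ≫ s = 𝟙 _ ≫ s' := hi
    rw [Category.id_comp, Category.id_comp] at h1
    rw [h1]
  | succ n ih =>
    -- The quotient of stage `n + 1` by `J'` is built from the quotients of stage `n` by `J' + I ^
    -- (m + 1)`, so the induction hypothesis is needed for all ideals. The target moves up first,
    -- with `N` fixed, and then the source, with `N` raised by `2`.
    exact fun J' => uniqueUpTo_limRing ((adicSys (flagIdeal v (ht (n + 1)))).obj J' ⋙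
      tower v h ht hfin' n ⋙ AlgObj.loc (v (ht (n + 1))) ⋙
        AlgObj.mapAlg A' (Pro.const (Ind (Pipes.{u} n)))) fun k =>
      UniqueUpTo.toLocComplete (epiSys_tower u h ht hfin n) (u (ht (n + 1)))
        (flagIdeal u (ht (n + 1))) (N := 2 * n) (((ih _).loc).map (Pro.const (Ind (Pipes.{u} n))))

/-- Ring maps between the stages of two towers are determined by their restrictions to stage
`0`. -/
lemma tower_hom_ext (n : ℕ) {f g : towerRing u h ht hfin n ⟶ towerRing v h ht hfin' n}
    (hfg : towerFromZero u h ht hfin n ≫ f = towerFromZero u h ht hfin n ≫ g) : f = g :=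
  (uniqueUpTo_towerFromZero u v h ht hfin hfin' n ⊥).hom_ext
    (congrArg CommRingObjCat.Hom.hom hfg)

lemma finRing_hom_ext {B : Type u} [CommRing B] [Finite B] {Y : FintypeCat.{u}}
    {f g : (finRing B).X ⟶ Y} (h : ∀ b : B, (finPt B (𝟙_ _)).symm (fun _ => b) ≫ f =
      (finPt B (𝟙_ _)).symm (fun _ => b) ≫ g) : f = g := by
  refine FintypeCat.hom_ext _ _ fun b => ?_
  -- The image of `b` is an element of the terminal set at which the equation of points can be
  -- evaluated.
  have t : (𝟙_ FintypeCat.{u}).obj := (toUnit (FintypeCat.of B)) b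
  exact ConcreteCategory.congr_hom (h b) t

/-- Maps from stage `0` of a tower to stage `0` of another one are determined by their values on
the elements of the base ring. -/
lemma tower_zero_hom_ext {f g : (towerRing u h ht hfin 0).X ⟶ (towerRing v h ht hfin' 0).X}
    (hfg : ∀ a, towerStr u h ht hfin 0 a ≫ f = towerStr u h ht hfin 0 a ≫ g) : f = g := by
  let Q := (adicSysFin _ hfin).obj ⊥ ⋙ quotFunctor A ⋙ AlgObj.mapAlg A (Pro.const FintypeCat.{u})
  let Q' := (adicSysFin _ hfin').obj ⊥ ⋙ quotFunctor A' ⋙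
    AlgObj.mapAlg A' (Pro.const FintypeCat.{u})
  refine AlgObj.algLim_hom_ext Q' fun k' => ?_
  -- Into a finite quotient of `A'`, both maps factor through one finite quotient of `A`, each
  -- element of which lifts to `A`. Multiplicativity plays no role.
  obtain ⟨k, s, s', hs, hs'⟩ := pro_exists_factor_pair (limit.isLimit
    ((Q ⋙ AlgObj.forgetRing A (Pro FintypeCat)) ⋙ CommRingObjCat.forget (Pro FintypeCat)))
    (Y := ((quotFunctor A').obj (((adicSysFin _ hfin').obj ⊥).obj k')).R.X)
    (f ≫ (AlgObj.algLimProj Q' k').hom) (g ≫ (AlgObj.algLimProj Q' k').hom)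
  refine hs.trans (Eq.trans (congrArg (_ ≫ ·) ?_) hs'.symm)
  let K := ((adicSysFin _ hfin).obj ⊥).obj k
  have := K.2
  obtain ⟨s, rfl⟩ := (Pro.const FintypeCat.{u}).map_surjective
    (X := (finRing (A ⧸ K.1)).X) s
  obtain ⟨s', rfl⟩ := (Pro.const FintypeCat.{u}).map_surjective
    (X := (finRing (A ⧸ K.1)).X) s'
  refine congrArg (Pro.const FintypeCat.{u}).map (finRing_hom_ext fun b => ?_)
  obtain ⟨a, rfl⟩ := Ideal.Quotient.mk_surjective b
  let κ := Pro.const FintypeCat.{u}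
  let : κ.Braided := .ofChosenFiniteProducts κ
  let z : 𝟙_ FintypeCat.{u} ⟶ (finRing (A ⧸ K.1)).X :=
    (finPt (A ⧸ K.1) (𝟙_ _)).symm (fun _ => Ideal.Quotient.mk K.1 a)
  have hz : AlgObj.limStrFun Q a ≫ (AlgObj.algLimProj Q k).hom =
      Functor.LaxMonoidal.ε κ ≫ κ.map z := AlgObj.limStrFun_proj Q a k
  have h1 {t} {f : (towerRing u h ht hfin 0).X ⟶ (towerRing v h ht hfin' 0).X}
      (hs : f ≫ (AlgObj.algLimProj Q' k').hom = (AlgObj.algLimProj Q k).hom ≫ κ.map t) :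
      (towerStr u h ht hfin 0 a ≫ f) ≫ (AlgObj.algLimProj Q' k').hom =
        Functor.LaxMonoidal.ε κ ≫ κ.map (z ≫ t) := by
    refine (Category.assoc _ _ _).trans ((congrArg (_ ≫ ·) hs).trans
      ((Category.assoc _ _ _).symm.trans ?_))
    refine (congrArg (· ≫ κ.map t) hz).trans ((Category.assoc _ _ _).trans ?_)
    exact congrArg (Functor.LaxMonoidal.ε κ ≫ ·) (κ.map_comp z t).symm
  have h2 := (h1 hs).symm.trans ((congrArg (· ≫ _) (hfg a)).trans (h1 hs'))
  exact κ.map_injective ((cancel_epi (Functor.LaxMonoidal.ε κ)).1 h2)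

end towerUnique

/-! ### The isomorphism of towers. -/

section towerIso
variable {A A' : Type u} [CommRing A] [CommRing A'] {u : ℕ → A} {v : ℕ → A'} {h : ℕ} {ht : ℕ → ℕ}
  {hfin : ∀ m, Finite (A ⧸ flagIdeal u h ^ m)} {hfin' : ∀ m, Finite (A' ⧸ flagIdeal v h ^ m)}

/-- Maps of stages that are compatible with the natural maps are compatible with the maps from
stage `0`. -/
lemma towerFromZero_comp (f : ∀ n, towerRing u h ht hfin n ⟶ towerRing v h ht hfin' n)
    (hf : ∀ n, (incl n).map (f n) ≫ towerStep v h ht hfin' n =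
      towerStep u h ht hfin n ≫ f (n + 1)) (n : ℕ) :
    towerFromZero u h ht hfin n ≫ f n = (inclZero n).map (f 0) ≫ towerFromZero v h ht hfin' n := by
  induction n with
  | zero => exact (Category.id_comp _).trans (Category.comp_id _).symm
  | succ n ih =>
    change ((incl n).map (towerFromZero u h ht hfin n) ≫ towerStep u h ht hfin n) ≫ f (n + 1) =
      (incl n).map ((inclZero n).map (f 0)) ≫ (incl n).map (towerFromZero v h ht hfin' n) ≫
        towerStep v h ht hfin' n
    rw [Category.assoc, ← hf, ← Category.assoc, ← Category.assoc, ← Functor.map_comp, ih,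
      Functor.map_comp]

/-- Rigidity of the tower: fixing the elements of `A` forces the identity at stage `0`, and stage
`0` determines the rest. The maps in the two directions are mutually inverse for this reason. -/
lemma tower_hom_eq_id (f : ∀ n, towerRing u h ht hfin n ⟶ towerRing u h ht hfin n)
    (hf₀ : ∀ a, towerStr u h ht hfin 0 a ≫ (f 0).hom = towerStr u h ht hfin 0 a)
    (hf : ∀ n, (incl n).map (f n) ≫ towerStep u h ht hfin n =
      towerStep u h ht hfin n ≫ f (n + 1)) (n : ℕ) : f n = 𝟙 _ := by
  have h0 : f 0 = 𝟙 _ := CommRingObjCat.hom_ext (tower_zero_hom_ext u u h ht hfin hfin fun a =>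
    (hf₀ a).trans (Category.comp_id _).symm)
  refine tower_hom_ext u u h ht hfin hfin n ?_
  rw [towerFromZero_comp f hf, h0, (inclZero n).map_id, Category.comp_id]
  exact Category.id_comp _

variable {φ : A →+* A'} {ψ : A' →+* A}

/-- A map of towers that is the composite of maps in both directions is the identity. -/
lemma LaxMap.tower_comp (hh : ∀ n, ht n ≤ h) (H : ∀ t ≤ h, (flagIdeal u t).map φ ≤ flagIdeal v t ∧
      ∃ w, IsUnit w ∧ φ (u t) - w * v t ∈ flagIdeal v t)
    (H' : ∀ t ≤ h, (flagIdeal v t).map ψ ≤ flagIdeal u t ∧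
      ∃ w, IsUnit w ∧ ψ (v t) - w * u t ∈ flagIdeal u t) (hφψ : ψ.comp φ = RingHom.id A) (n : ℕ) :
    (LaxMap.tower hfin hfin' hh H n).hom (Ideal.map_bot.le : (⊥ : Ideal A).map φ ≤ ⊥) ≫
      (LaxMap.tower hfin' hfin hh H' n).hom (Ideal.map_bot.le : (⊥ : Ideal A').map ψ ≤ ⊥) = 𝟙 _ := by
  refine tower_hom_eq_id (fun n => (LaxMap.tower hfin hfin' hh H n).hom Ideal.map_bot.le ≫
      (LaxMap.tower hfin' hfin hh H' n).hom Ideal.map_bot.le) (fun a => ?_) (fun n => ?_) n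
  · have h1 := (LaxMap.tower hfin hfin' hh H 0).str_hom Ideal.map_bot.le a
    have h2 := (LaxMap.tower hfin' hfin hh H' 0).str_hom Ideal.map_bot.le (φ a)
    have h3 : ψ (φ a) = a := RingHom.congr_fun hφψ a
    rw [h3] at h2
    exact (Category.assoc _ _ _).symm.trans ((congrArg (· ≫ _) h1).trans h2)
  · have h1 := (LaxMap.tower hfin hfin' hh H n).toLocComplete_locComplete
      (killsSys_tower v h ht hfin' n) (H _ (hh (n + 1))).1 (H _ (hh (n + 1))).2 Ideal.map_bot.le
    have h2 := (LaxMap.tower hfin' hfin hh H' n).toLocComplete_locComplete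
      (killsSys_tower u h ht hfin n) (H' _ (hh (n + 1))).1 (H' _ (hh (n + 1))).2 Ideal.map_bot.le
    refine (congrArg (· ≫ _) ((incl n).map_comp _ _)).trans ((Category.assoc _ _ _).trans ?_)
    refine (congrArg (_ ≫ ·) h2.symm).trans ((Category.assoc _ _ _).symm.trans ?_)
    exact (congrArg (· ≫ _) h1.symm).trans (Category.assoc _ _ _)

/-- The isomorphism between the towers for two systems of coordinates that agree up to units and
modulo the preceding coordinates. -/
def towerIso (φ : A ≃+* A') (hh : ∀ n, ht n ≤ h)
    (H : ∀ t ≤ h, (flagIdeal u t).map φ.toRingHom ≤ flagIdeal v t ∧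
      ∃ w, IsUnit w ∧ φ.toRingHom (u t) - w * v t ∈ flagIdeal v t)
    (H' : ∀ t ≤ h, (flagIdeal v t).map φ.symm.toRingHom ≤ flagIdeal u t ∧
      ∃ w, IsUnit w ∧ φ.symm.toRingHom (v t) - w * u t ∈ flagIdeal u t) (n : ℕ) :
    towerRing u h ht hfin n ≅ towerRing v h ht hfin' n where
  hom := (LaxMap.tower hfin hfin' hh H n).hom Ideal.map_bot.le
  inv := (LaxMap.tower hfin' hfin hh H' n).hom Ideal.map_bot.le
  hom_inv_id := LaxMap.tower_comp hh H H' (RingHom.ext φ.symm_apply_apply) n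
  inv_hom_id := LaxMap.tower_comp hh H' H (RingHom.ext φ.apply_symm_apply) n

end towerIso

end PipeRings
end

theorem mainTheorem2 {p : ℕ} [Fact p.Prime] {k : Type u} [Field k] [Finite k] [CharP k p]
    {h : ℕ} (hh : 1 ≤ h) (H : FormalGroup k) [H.IsComm] (hH : PipeRings.HasHeight p h H)
    {A A' : Type u} [CommRing A] [CommRing A'] {π : A →+* k} {π' : A' →+* k}
    (D : PipeRings.Deformation H π) (D' : PipeRings.Deformation H π')
    (hD : D.IsUniversal) (hD' : D'.IsUniversal)
    (U : PipeRings.LubinTateCoords p h D) (V : PipeRings.LubinTateCoords p h D')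
    (ht : ℕ → ℕ) (ht0 : ht 0 = h) (hanti : Antitone ht) :
    ∃ φ : A ≃+* A', D.Classifies D' φ.toRingHom ∧
      (∀ ψ : A ≃+* A', D.Classifies D' ψ.toRingHom → ψ = φ) ∧
      ∃ Φ : ∀ n, U.pipeRing hh ht n ≅ V.pipeRing hh ht n,
        (∀ a, U.str hh ht 0 a ≫ (Φ 0).hom.hom = V.str hh ht 0 (φ a)) ∧
        (∀ n, (PipeRings.incl n).map (Φ n).hom ≫ V.step hh ht n =
          U.step hh ht n ≫ (Φ (n + 1)).hom) ∧
        (∀ Ψ : U.pipeRing hh ht 0 ≅ V.pipeRing hh ht 0,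
          (∀ a, U.str hh ht 0 a ≫ Ψ.hom.hom = V.str hh ht 0 (φ a)) → Ψ = Φ 0) ∧
        ∀ (n : ℕ) (Ψ : U.pipeRing hh ht n ≅ V.pipeRing hh ht n),
          U.fromZero hh ht n ≫ Ψ.hom =
            (PipeRings.inclZero n).map (Φ 0).hom ≫ V.fromZero hh ht n → Ψ = Φ n := by
  obtain ⟨φ, hφ, hφ'⟩ := hD.exists_equiv hD'
  -- Every height in the sequence lies in the range `t ≤ h` in which the coordinates are comparable.
  have hle (n : ℕ) : ht n ≤ h := ht0 ▸ hanti (Nat.zero_le n)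
  have H := U.map_flagIdeal V hφ
  have H' := V.map_flagIdeal U hφ'
  let Φ (n : ℕ) : U.pipeRing hh ht n ≅ V.pipeRing hh ht n := PipeRings.towerIso φ hle H H' n
  have hstep (n : ℕ) : (PipeRings.incl n).map (Φ n).hom ≫ V.step hh ht n =
      U.step hh ht n ≫ (Φ (n + 1)).hom :=
    ((PipeRings.LaxMap.tower (U.finite_quotient hh) (V.finite_quotient hh) hle H
      n).toLocComplete_locComplete (PipeRings.killsSys_tower V.u h ht (V.finite_quotient hh) n)
        (H _ (hle (n + 1))).1 (H _ (hle (n + 1))).2 Ideal.map_bot.le).symm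
  have hstr (a : A) : U.str hh ht 0 a ≫ (Φ 0).hom.hom = V.str hh ht 0 (φ a) :=
    (PipeRings.LaxMap.tower (U.finite_quotient hh) (V.finite_quotient hh) hle H 0).str_hom
      Ideal.map_bot.le a
  refine ⟨φ, hφ, fun ψ hψ => ?_, Φ, hstr, hstep, fun Ψ hΨ => ?_, fun n Ψ hΨ => ?_⟩
  · have h1 := (hD.2 A' π' hD'.1 D').unique hψ hφ
    exact RingEquiv.ext fun a => RingHom.congr_fun h1 a
  · exact Iso.ext (CommRingObjCat.hom_ext (PipeRings.tower_zero_hom_ext U.u V.u h ht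
      (U.finite_quotient hh) (V.finite_quotient hh) fun a => (hΨ a).trans (hstr a).symm))
  -- Compatibility of `Φ` with the successive natural maps implies compatibility with the maps from
  -- stage `0`, so `Ψ` and `Φ n` have the same restriction to stage `0`.
  · exact Iso.ext (PipeRings.tower_hom_ext U.u V.u h ht (U.finite_quotient hh)
      (V.finite_quotient hh) n (hΨ.trans
        (PipeRings.towerFromZero_comp (fun n => (Φ n).hom) hstep n).symm))
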